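/- Let $q,r:\mathbb R\to\mathbb C$ belong to the Schwartz class, and consider the linear system $$\frac{d}{dx}\begin{bmatrix}\alpha\\ \beta\end{bmatrix}=\begin{bmatrix}-i\zeta^2&\zeta q(x)\\ \zeta r(x)&i\zeta^2+\frac i2 q(x)r(x)\end{bmatrix}\begin{bmatrix}\alpha\\ \beta\end{bmatrix},\qquad x\in\mathbb R .\tag{1}$$ (Overbars do not denote complex conjugation.) Put $$E(x)=\exp\Big(\frac i2\int_{-\infty}^x q(y)r(y)\,dy\Big),\qquad \mu=\int_{-\infty}^\infty q(y)r(y)\,dy,\qquad \lambda=\zeta^2,\quad \zeta=\sqrt\lambda\ \text{(principal root)}.$$ **Jost solutions.** Let $\psi,\phi$ (for $\operatorname{Im}\lambda\ge 0$) and $\bar\psi,\bar\phi$ (for $\operatorname{Im}\lambda\le 0$) be the solutions of (1) with $$\psi=\begin{bmatrix}o(1)\\ e^{i\lambda x}[1+o(1)]\end{bmatrix},\quad \bar\psi=\begin{bmatrix}e^{-i\lambda x}[1+o(1)]\\ o(1)\end{bmatrix}\quad (x\to+\infty),$$ $$\phi=\begin{bmatrix}e^{-i\lambda x}[1+o(1)]\\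 o(1)\end{bmatrix},\quad \bar\phi=\begin{bmatrix}o(1)\\ e^{i\lambda x}[1+o(1)]\end{bmatrix}\quad (x\to-\infty).$$ **Scattering coefficients.** The right transmission coefficients $T_{\rm r},\bar T_{\rm r}$ and right reflection coefficients $R,\bar R$ are defined by $$\frac1{T_{\rm r}}=\lim_{x\to+\infty}e^{i\lambda x}\phi_1,\qquad \frac R{T_{\rm r}}=\lim_{x\to+\infty}e^{-i\lambda x}\phi_2,\qquad \frac1{\bar T_{\rm r}}=\lim_{x\to+\infty}e^{-i\lambda x}\bar\phi_2,\qquad \frac{\bar R}{\bar T_{\rm r}}=\lim_{x\to+\infty}e^{i\lambda x}\bar\phi_1,$$ where $1/T_{\rm r}$ is taken for $\operatorname{Im}\lambda\ge0$, $1/\bar T_{\rm r}$ for $\operatorname{Im}\lambda\le 0$, and the two reflection coefficients for $\lambda\in\mathbb R$. Assume that $T_{\rm r}$ and $\bar T_{\rm r}$ have no poles on the real $\lambda$-axis, i.e. $1/T_{\rm r}\neq0$ and $1/\bar T_{\rm r}\ne0$ for all $\lambda\in\mathbb R$. Let $$\hat R(y)=\frac1{2\pi}\int_{-\infty}^\infty\frac{R(\zeta)}{\zeta}e^{i\lambda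 y}\,d\lambda,\qquad \hat{\bar R}(y)=\frac1{2\pi}\int_{-\infty}^\infty\frac{\bar R(\zeta)}{\zeta}e^{-i\lambda y}\,d\lambda .$$ **Bound states.** Let $\lambda_1,\dots,\lambda_N$ be the distinct poles of $T_{\rm r}$ (as a function of $\lambda$) in the open upper half-plane, with orders $m_1,\dots,m_N$, and let $\bar\lambda_1,\dots,\bar\lambda_{\bar N}$ be those of $\bar T_{\rm r}$ in the open lower half-plane, with orders $\bar m_j$; $N=0$ and $\bar N=0$ are allowed. The normalization constants $c_{jk}$ $(0\le k\le m_j-1)$ and $\bar c_{jk}$ $(0\le k\le\bar m_j-1)$ are the constants for which, for every $x$, $$T_{\rm r}\,\phi-i\zeta\sum_{k}\frac{c_{jk}}{(\lambda-\lambda_j)^{k+1}}\,\psi\quad\text{and}\quad \bar T_{\rm r}\,\bar\phi+i\zeta\sum_k\frac{\bar c_{jk}}{(\lambda-\bar\lambda_j)^{k+1}}\,\bar\psi$$ remain bounded as $\lambda\to\lambda_j$ and as $\lambda\to\bar\lambda_j$, respectively. Let $A$ be the block-diagonal matrix whose $j$th block is the $m_j\times m_j$ Jordan block with $\lambda_j$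 on the diagonal and $1$ on the superdiagonal, $B$ the column vector whose $j$th block is $(0,\dots,0,1)^{T}$, and $C$ the row vector whose $j$th block is $(c_{j(m_j-1)},\dots,c_{j1},c_{j0})$; define $\bar A,\bar B,\bar C$ in the same way from the barred data. Set $$\Omega(y)=\hat R(y)+C\,e^{iAy}B,\qquad \bar\Omega(y)=\hat{\bar R}(y)+\bar C\,e^{-i\bar Ay}\bar B .$$ **Theorem.** Let $\mathcal K(x,y)=\begin{bmatrix}\bar K_1&K_1\\ \bar K_2&K_2\end{bmatrix}(x,y)$ be a solution, with $\mathcal K(x,\cdot)$ square integrable on $(x,\infty)$ for each $x\in\mathbb R$, of the Marchenko system $$\begin{bmatrix}0&0\\0&0\end{bmatrix}=\mathcal K(x,y)+\begin{bmatrix}0&\bar\Omega(x+y)\\ \Omega(x+y)&0\end{bmatrix}+\int_x^\infty\begin{bmatrix}-iK_1(x,z)\,\Omega'(z+y)&\bar K_1(x,z)\,\bar\Omega(z+y)\\ K_2(x,z)\,\Omega(z+y)&i\bar K_2(x,z)\,\bar\Omega'(z+y)\end{bmatrix}dz,\qquad x<y .$$ Then, for every $x\in\mathbb R$, the limits $K_j(x,x):=\lim_{y\to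 x^+}K_j(x,y)$ and $\bar K_j(x,x):=\lim_{y\to x^+}\bar K_j(x,y)$, $j=1,2$, exist and $$K_1(x,x)=-\frac{e^{i\mu/2}}2\,\frac{q(x)}{E(x)},\qquad K_2(x,x)=-\frac{i\,q(x)r(x)}4-\frac i4\int_x^\infty q(y)\,r'(y)\,dy,$$ $$\bar K_1(x,x)=-\frac i4\int_x^\infty q(y)\,r'(y)\,dy,\qquad \bar K_2(x,x)=-\frac{e^{-i\mu/2}}2\,r(x)\,E(x).$$ -/

import Mathlib

open Filter Topology MeasureTheory Set
open scoped SchwartzMap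

noncomputable section

namespace CLL

/-! The linear system and its Jost solutions.  An overbar is rendered by the suffix `Bar`; it never
denotes complex conjugation.  Component `1` (`2`) of a column vector has index `0` (`1`). -/

/-- The coefficient matrix of the linear system. -/
def laxMatrix (q r : ℝ → ℂ) (ζ : ℂ) (x : ℝ) : Matrix (Fin 2) (Fin 2) ℂ :=
  !![-Complex.I * ζ ^ 2, ζ * q x;
     ζ * r x, Complex.I * ζ ^ 2 + Complex.I / 2 * (q x * r x)]

/-- `f` is a column-vector solution on the whole line of the linear system. -/
def IsSolution (q r : ℝ → ℂ) (ζ : ℂ) (f : ℝ → Fin 2 → ℂ) : Prop :=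
  ∀ x : ℝ, HasDerivAt f ((laxMatrix q r ζ x).mulVec (f x)) x

/-- `ψ = (o(1), e^{iζ²x}[1 + o(1)])` as `x → +∞`. -/
def IsPsi (q r : ℝ → ℂ) (ζ : ℂ) (f : ℝ → Fin 2 → ℂ) : Prop :=
  IsSolution q r ζ f ∧ Tendsto (fun x => f x 0) atTop (𝓝 0) ∧
    Tendsto (fun x : ℝ => Complex.exp (-Complex.I * ζ ^ 2 * x) * f x 1) atTop (𝓝 1)

/-- `ψ̄ = (e^{-iζ²x}[1 + o(1)], o(1))` as `x → +∞`. -/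
def IsPsiBar (q r : ℝ → ℂ) (ζ : ℂ) (f : ℝ → Fin 2 → ℂ) : Prop :=
  IsSolution q r ζ f ∧
    Tendsto (fun x : ℝ => Complex.exp (Complex.I * ζ ^ 2 * x) * f x 0) atTop (𝓝 1) ∧
    Tendsto (fun x => f x 1) atTop (𝓝 0)

/-- `φ = (e^{-iζ²x}[1 + o(1)], o(1))` as `x → -∞`. -/
def IsPhi (q r : ℝ → ℂ) (ζ : ℂ) (f : ℝ → Fin 2 → ℂ) : Prop :=
  IsSolution q r ζ f ∧
    Tendsto (fun x : ℝ => Complex.exp (Complex.I * ζ ^ 2 * x) * f x 0) atBot (𝓝 1) ∧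
    Tendsto (fun x => f x 1) atBot (𝓝 0)

/-- `φ̄ = (o(1), e^{iζ²x}[1 + o(1)])` as `x → -∞`. -/
def IsPhiBar (q r : ℝ → ℂ) (ζ : ℂ) (f : ℝ → Fin 2 → ℂ) : Prop :=
  IsSolution q r ζ f ∧ Tendsto (fun x => f x 0) atBot (𝓝 0) ∧
    Tendsto (fun x : ℝ => Complex.exp (-Complex.I * ζ ^ 2 * x) * f x 1) atBot (𝓝 1)

/-- The Jost solution `ψ(ζ, ·)`; it exists and is unique for `Im ζ² ≥ 0`. -/
def psi (q r : ℝ → ℂ) (ζ : ℂ) : ℝ → Fin 2 → ℂ := Classical.epsilon (IsPsi q r ζ)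

/-- The Jost solution `ψ̄(ζ, ·)`; it exists and is unique for `Im ζ² ≤ 0`. -/
def psiBar (q r : ℝ → ℂ) (ζ : ℂ) : ℝ → Fin 2 → ℂ := Classical.epsilon (IsPsiBar q r ζ)

/-- The Jost solution `φ(ζ, ·)`; it exists and is unique for `Im ζ² ≥ 0`. -/
def phi (q r : ℝ → ℂ) (ζ : ℂ) : ℝ → Fin 2 → ℂ := Classical.epsilon (IsPhi q r ζ)

/-- The Jost solution `φ̄(ζ, ·)`; it exists and is unique for `Im ζ² ≤ 0`. -/
def phiBar (q r : ℝ → ℂ) (ζ : ℂ) : ℝ → Fin 2 → ℂ := Classical.epsilon (IsPhiBar q r ζ)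

/-- The phase factor `E(x)`. -/
def E (q r : ℝ → ℂ) (x : ℝ) : ℂ :=
  Complex.exp (Complex.I / 2 * ∫ y in Iic x, q y * r y)

/-- The constant `μ`. -/
def mu (q r : ℝ → ℂ) : ℂ := ∫ y, q y * r y

/-! The right scattering coefficients, read off from the Jost solutions `φ`, `φ̄` as `x → +∞`:
`φ ~ ((1/T) e^{-iζ²x}, (R/T) e^{iζ²x})` and `φ̄ ~ ((R̄/T̄) e^{-iζ²x}, (1/T̄) e^{iζ²x})`. -/

/-- `1 / T_r(ζ)`, for `Im ζ² ≥ 0`. -/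
def invT (q r : ℝ → ℂ) (ζ : ℂ) : ℂ :=
  limUnder atTop fun x : ℝ => Complex.exp (Complex.I * ζ ^ 2 * x) * phi q r ζ x 0

/-- `1 / T̄_r(ζ)`, for `Im ζ² ≤ 0`. -/
def invTBar (q r : ℝ → ℂ) (ζ : ℂ) : ℂ :=
  limUnder atTop fun x : ℝ => Complex.exp (-Complex.I * ζ ^ 2 * x) * phiBar q r ζ x 1

/-- The right transmission coefficient `T_r(ζ)`. -/
def T (q r : ℝ → ℂ) (ζ : ℂ) : ℂ := (invT q r ζ)⁻¹

/-- The right transmission coefficient `T̄_r(ζ)`. -/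
def TBar (q r : ℝ → ℂ) (ζ : ℂ) : ℂ := (invTBar q r ζ)⁻¹

/-- The right reflection coefficient `R(ζ)`, for real `ζ²`. -/
def R (q r : ℝ → ℂ) (ζ : ℂ) : ℂ :=
  T q r ζ * limUnder atTop fun x : ℝ => Complex.exp (-Complex.I * ζ ^ 2 * x) * phi q r ζ x 1

/-- The right reflection coefficient `R̄(ζ)`, for real `ζ²`. -/
def RBar (q r : ℝ → ℂ) (ζ : ℂ) : ℂ :=
  TBar q r ζ * limUnder atTop fun x : ℝ => Complex.exp (Complex.I * ζ ^ 2 * x) * phiBar q r ζ x 0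

/-- The principal square root, `ζ = √l`. -/
def root (l : ℂ) : ℂ := l ^ (1 / 2 : ℂ)

/-- `R̂(y) = (1/2π) ∫ (R(ζ)/ζ) e^{ily} dl`, with `ζ = √l`. -/
def RHat (q r : ℝ → ℂ) (y : ℝ) : ℂ :=
  1 / (2 * Real.pi) * ∫ l : ℝ, R q r (root l) / root l * Complex.exp (Complex.I * l * y)

/-- The Fourier transform of `R̄(ζ)/ζ`, `(1/2π) ∫ (R̄(ζ)/ζ) e^{-ily} dl`, with `ζ = √l`. -/
def RBarHat (q r : ℝ → ℂ) (y : ℝ) : ℂ :=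
  1 / (2 * Real.pi) * ∫ l : ℝ, RBar q r (root l) / root l * Complex.exp (-Complex.I * l * y)

/-! Bound-state information and its matrix triplets. -/

/-- A finite list of points `l_j`, multiplicities `m_j` and constants `c_{jk}`, `0 ≤ k ≤ m_j - 1`. -/
structure BoundStates where
  /-- The number of points. -/
  N : ℕ
  /-- The points `l_j`. -/
  pole : Fin N → ℂ
  /-- The multiplicities `m_j`. -/
  mult : Fin N → ℕ
  /-- The constants `c_{jk}`. -/
  c : (j : Fin N) → Fin (mult j) → ℂ

namespace BoundStates

/-- The index set of size `m_1 + ⋯ + m_N`, in blocks. -/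
abbrev Idx (D : BoundStates) : Type := (j : Fin D.N) × Fin (D.mult j)

/-- The `j`th Jordan block, with `l_j` on the diagonal and ones on the superdiagonal. -/
def block (D : BoundStates) (j : Fin D.N) : Matrix (Fin (D.mult j)) (Fin (D.mult j)) ℂ :=
  Matrix.of fun p s => if p = s then D.pole j else if (p : ℕ) + 1 = s then 1 else 0

/-- The block-diagonal matrix `A`. -/
def A (D : BoundStates) : Matrix D.Idx D.Idx ℂ := Matrix.blockDiagonal' D.block

/-- The column vector `B`: within each block, zeros followed by a last entry one. -/
def B (D : BoundStates) : D.Idx → ℂ := fun i => if (i.2 : ℕ) + 1 = D.mult i.1 then 1 else 0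

/-- The row vector `C`: the `j`th block is `(c_{j(m_j-1)}, …, c_{j1}, c_{j0})`. -/
def C (D : BoundStates) : D.Idx → ℂ := fun i => D.c i.1 i.2.rev

/-- The scalar `C e^{sA} B`, where the exponential is the matrix exponential. -/
def kernel (D : BoundStates) (s : ℂ) : ℂ :=
  D.C ⬝ᵥ (NormedSpace.exp (s • D.A)).mulVec D.B

/-- `D` is the bound-state information attached, in the half-plane `H` of the parameter `l = ζ²`,
to a transmission coefficient `τ`, a Jost solution `f` from the left and a Jost solution `g` from
the right: the `l_j` are the distinct poles of `τ(√l)` in `H`, the `m_j` are the orders of these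
poles, and the normalization constants `c_{jk}` are the coefficients in the principal parts
`τ f = σ ζ (∑_k c_{jk} / (l - l_j)^{k+1}) g + (a function of l bounded near l_j)`. -/
def Represents (D : BoundStates) (H : Set ℂ) (τ : ℂ → ℂ) (f g : ℂ → ℝ → Fin 2 → ℂ) (σ : ℂ) :
    Prop :=
  Function.Injective D.pole ∧
  Set.range D.pole = {l | l ∈ H ∧ meromorphicOrderAt (fun w => τ (root w)) l < 0} ∧
  (∀ j, meromorphicOrderAt (fun w => τ (root w)) (D.pole j) = ((-(D.mult j : ℤ) : ℤ) : WithTop ℤ)) ∧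
  ∀ (j : Fin D.N) (x : ℝ) (i : Fin 2),
    (fun l : ℂ => τ (root l) * f (root l) x i -
        σ * root l * (∑ k, D.c j k / (l - D.pole j) ^ ((k : ℕ) + 1)) * g (root l) x i)
      =O[𝓝[≠] (D.pole j)] (fun _ => (1 : ℂ))

end BoundStates

/-- `D` is the bound-state information for the poles of `T_r` in the upper half-plane. -/
def IsBoundStates (q r : ℝ → ℂ) (D : BoundStates) : Prop :=
  D.Represents {l | 0 < l.im} (T q r) (phi q r) (psi q r) Complex.I

/-- `D` is the bound-state information for the poles of `T̄_r` in the lower half-plane. -/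
def IsBoundStatesBar (q r : ℝ → ℂ) (D : BoundStates) : Prop :=
  D.Represents {l | l.im < 0} (TBar q r) (phiBar q r) (psiBar q r) (-Complex.I)

/-! The Marchenko system. -/

/-- `Ω(y) = R̂(y) + C e^{iAy} B`. -/
def Omega (q r : ℝ → ℂ) (D : BoundStates) (y : ℝ) : ℂ :=
  RHat q r y + D.kernel (Complex.I * y)

/-- The kernel `Ω̄`: the transform of `R̄(ζ)/ζ` plus `C̄ e^{-iĀy} B̄`. -/
def OmegaBar (q r : ℝ → ℂ) (D : BoundStates) (y : ℝ) : ℂ :=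
  RBarHat q r y + D.kernel (-Complex.I * y)

/-- `K(x,y) = [K̄₁ K₁; K̄₂ K₂]` solves the Marchenko system with kernels `w = Ω`, `v = Ω̄`: for each
`x` the entries are square integrable in `y` on `(x,∞)`, and the matrix equation holds at every
`y > x`. -/
def IsMarchenkoSolution (w v : ℝ → ℂ) (K : ℝ → ℝ → Matrix (Fin 2) (Fin 2) ℂ) : Prop :=
  ∀ x : ℝ,
    (∀ i j, MemLp (fun y => K x y i j) 2 (volume.restrict (Ioi x))) ∧
    ∀ y : ℝ, x < y →
      0 = K x y + !![0, v (x + y); w (x + y), 0] +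
        !![∫ z in Ioi x, -Complex.I * K x z 0 1 * deriv w (z + y),
           ∫ z in Ioi x, K x z 0 0 * v (z + y);
           ∫ z in Ioi x, K x z 1 1 * w (z + y),
           ∫ z in Ioi x, Complex.I * K x z 1 0 * deriv v (z + y)]

end CLL

end

noncomputable section

namespace CLL

/-! ### The closed upper half-plane and gluing across the real axis -/

section

/-! Fix `x`. The half-line transforms of each row of the Marchenko solution are forced: up to
factors depending only on `x`, and the identity on the diagonal, they are the right Jost functions
with their exponentials and one factor ζ removed. The limits as `y → x⁺` are then the coefficients
of `1/λ` in the expansion of these functions along the imaginary axis, by the initial value theorem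
`tendsto_mul_laplace`. No representation of the Jost solutions by the solution of the Marchenko
system is assumed.

Why the transforms are forced. Let `k`, `kb` be the two entries of a row, shifted to the half-line,
and write hats for transforms. The two Marchenko equations say that `k̂b(-l) + κ̂₁(l) k̂(l)` and
`k̂(-l) + κ̂₂(l) (1 + k̂b(l))` continue to the upper half-plane as transforms `ĥ₁`, `ĥ₂`
(`exists_laplace_eq_of_convolution`). On the real axis the left Jost solutions are combinations of
the right ones; after division by the inverse transmission coefficient and subtraction of a
resolvent of the Jordan matrix, which removes the poles, the same `κ̂₁`, `κ̂₂` appear as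
coefficients (`IsScatteringSide.exists_functions`). Hence a suitable bilinear combination of row
transforms and Jost functions in one half-plane continues across the axis by its analogue in the
other half-plane. It is entire and bounded, so constant (`eq_const_of_glue`). Two such constants and
the Wronskian determine the row: `k̂ p = c g₁` and `(1 + k̂b) p = c G₁`
(`laplace_eq_of_riemannHilbert`). Square integrability is used to make the convolutions with the
rapidly decreasing kernels converge; the equations then make the row integrable and continuous up to
the end point, so that the limits exist.

Why the Jost functions are under control. Once the exponentials and ζ are split off, a coefficient
`λ q` or `λ r` remains. A gauge transformation built from `E` and the potentials turns the system
into `A' = uB`, `B' = 2iλB + vA` with Schwartz potentials that do not contain λ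
(`isReduced_of_gauge`, `isReduced'_of_gauge`). The corresponding Volterra operator has powers of
size `M^n / n!`, uniformly in the closed half-plane (`norm_aknsOp_pow_le`), so its resolvent is
bounded and holomorphic; its derivative satisfies a Riccati identity, whence all derivatives on the
real axis are bounded (`bddSmooth_aknsRes`). Repeated integration by parts makes the reflection
coefficient divided by ζ a Schwartz function of λ (`exists_schwartz_jostN_div`), and one integration
by parts yields the leading terms on the imaginary axis (`tendsto_mul_jostB`,
`tendsto_mul_jostA_sub_one`).

The parametrization `λ = ε z` with `ε = ±1` puts both half-planes of λ on the upper half-plane of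
`z`. The scattering data of the two sides then have one form, `IsScatteringSide`, and the two rows
follow from the single statement `tendsto_of_scatteringSides` with the sides interchanged. -/

/-- The closed upper half-plane. -/
def upper : Set ℂ := {z | 0 ≤ z.im}

/-- The open upper half-plane. -/
def upperOpen : Set ℂ := {z | 0 < z.im}

@[simp] theorem mem_upper {z : ℂ} : z ∈ upper ↔ 0 ≤ z.im := Iff.rfl

@[simp] theorem mem_upperOpen {z : ℂ} : z ∈ upperOpen ↔ 0 < z.im := Iff.rfl

theorem isOpen_upperOpen : IsOpen upperOpen := isOpen_lt continuous_const Complex.continuous_im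

theorem upperOpen_subset : upperOpen ⊆ upper := fun _ hz => (mem_upperOpen.1 hz).le

theorem ofReal_mem_upper (l : ℝ) : (l : ℂ) ∈ upper := by simp [upper]

/-- `f` is continuous on the closed and holomorphic on the open upper half-plane, off `S`. -/
structure HolOff (S : Set ℂ) (f : ℂ → ℂ) : Prop where
  cont : ContinuousOn f (upper \ S)
  diff : DifferentiableOn ℂ f (upperOpen \ S)

namespace HolOff

variable {S : Set ℂ} {f g : ℂ → ℂ}

theorem add (hf : HolOff S f) (hg : HolOff S g) : HolOff S (fun z => f z + g z) :=
  ⟨hf.cont.add hg.cont, hf.diff.add hg.diff⟩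

theorem sub (hf : HolOff S f) (hg : HolOff S g) : HolOff S (fun z => f z - g z) :=
  ⟨hf.cont.sub hg.cont, hf.diff.sub hg.diff⟩

theorem neg (hf : HolOff S f) : HolOff S (fun z => -f z) := ⟨hf.cont.neg, hf.diff.neg⟩

theorem mul (hf : HolOff S f) (hg : HolOff S g) : HolOff S (fun z => f z * g z) :=
  ⟨hf.cont.mul hg.cont, hf.diff.mul hg.diff⟩

theorem inv (hf : HolOff S f) (h0 : ∀ z ∈ upper \ S, f z ≠ 0) : HolOff S (fun z => (f z)⁻¹) :=
  ⟨hf.cont.inv₀ h0, hf.diff.inv fun z hz => h0 z ⟨upperOpen_subset hz.1, hz.2⟩⟩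

theorem of_differentiable (hf : Differentiable ℂ f) : HolOff S f :=
  ⟨hf.continuous.continuousOn, hf.differentiableOn⟩

theorem of_differentiableOn (hf : DifferentiableOn ℂ f (upper \ S)) : HolOff S f :=
  ⟨hf.continuousOn, hf.mono (sdiff_subset_sdiff_left upperOpen_subset)⟩

theorem const (c : ℂ) : HolOff S (fun _ => c) := of_differentiable (differentiable_const c)

theorem id : HolOff S (fun z => z) := of_differentiable differentiable_id

theorem mono {S' : Set ℂ} (hf : HolOff S f) (h : S ⊆ S') : HolOff S' f :=
  ⟨hf.cont.mono (sdiff_subset_sdiff_right h), hf.diff.mono (sdiff_subset_sdiff_right h)⟩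

theorem differentiableAt (hf : HolOff S f) (hS : IsClosed S) {z : ℂ} (hz : 0 < z.im)
    (hzS : z ∉ S) : DifferentiableAt ℂ f z :=
  hf.diff.differentiableAt ((isOpen_upperOpen.sdiff hS).mem_nhds ⟨hz, hzS⟩)

end HolOff

/-- Cauchy's theorem for rectangles and a function continuous on both sides of the real axis and
holomorphic off the real axis: it is conservative. -/
theorem isConservativeOn_of_differentiable_off_real {f : ℂ → ℂ} {U : Set ℂ}
    (hc : ContinuousOn f U) (hd : ∀ z ∈ U, z.im ≠ 0 → DifferentiableAt ℂ f z) :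
    Complex.IsConservativeOn f U := by
  intro z w hzw
  rw [← add_eq_zero_iff_eq_neg, Complex.wedgeIntegral_add_wedgeIntegral_eq]
  have hsub : ∀ x ∈ uIcc z.re w.re, ∀ y ∈ uIcc z.im w.im, (x + y * Complex.I : ℂ) ∈ U := by
    intro x hx y hy
    apply hzw
    simp [Complex.Rectangle, Complex.mem_reProdIm, hx, hy]
  -- the integral over a subrectangle avoiding the real axis in its interior
  have key : ∀ y₁ ∈ uIcc z.im w.im, ∀ y₂ ∈ uIcc z.im w.im,
      (0 : ℝ) ∉ Ioo (min y₁ y₂) (max y₁ y₂) →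
      (∫ x : ℝ in z.re..w.re, f (x + y₁ * Complex.I)) - (∫ x : ℝ in z.re..w.re, f (x + y₂ * Complex.I))
        + Complex.I • (∫ y : ℝ in y₁..y₂, f (w.re + y * Complex.I))
        - Complex.I • (∫ y : ℝ in y₁..y₂, f (z.re + y * Complex.I)) = 0 := by
    intro y₁ h₁ y₂ h₂ h0
    have hy : uIcc y₁ y₂ ⊆ uIcc z.im w.im := uIcc_subset_uIcc h₁ h₂
    have := Complex.integral_boundary_rect_eq_zero_of_continuousOn_of_differentiableOn f
      (⟨z.re, y₁⟩ : ℂ) ⟨w.re, y₂⟩ ?_ ?_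
    · exact this
    · refine hc.mono ?_
      rintro p hp
      rw [Complex.mem_reProdIm] at hp
      have := hsub p.re hp.1 p.im (hy hp.2)
      rwa [Complex.re_add_im] at this
    · rintro p hp
      rw [Complex.mem_reProdIm] at hp
      have hmem := hsub p.re (Ioo_subset_Icc_self hp.1) p.im (hy (Ioo_subset_Icc_self hp.2))
      rw [Complex.re_add_im] at hmem
      refine (hd p hmem ?_).differentiableWithinAt
      intro h
      apply h0
      have := hp.2
      rwa [h] at this
  have hii : ∀ x ∈ uIcc z.re w.re, ∀ y₁ ∈ uIcc z.im w.im, ∀ y₂ ∈ uIcc z.im w.im,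
      IntervalIntegrable (fun y : ℝ => f (x + y * Complex.I)) volume y₁ y₂ := by
    intro x hx y₁ h₁ y₂ h₂
    have hy : uIcc y₁ y₂ ⊆ uIcc z.im w.im := uIcc_subset_uIcc h₁ h₂
    apply ContinuousOn.intervalIntegrable
    refine hc.comp (by fun_prop) fun y hy' => hsub x hx y (hy hy')
  -- A rectangle meeting the real axis is cut along it; the two integrals over the cut cancel, and
  -- each piece has an interior off the axis.
  by_cases h0 : (0 : ℝ) ∈ uIcc z.im w.im
  · have e₁ := key z.im left_mem_uIcc 0 h0 (by
      simp only [mem_Ioo, not_and_or, not_lt]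
      rcases le_total z.im 0 with h | h <;> simp [h])
    have e₂ := key 0 h0 w.im right_mem_uIcc (by
      simp only [mem_Ioo, not_and_or, not_lt]
      rcases le_total w.im 0 with h | h <;> simp [h])
    have a₁ := intervalIntegral.integral_add_adjacent_intervals
      (hii w.re right_mem_uIcc z.im left_mem_uIcc 0 h0) (hii w.re right_mem_uIcc 0 h0 w.im right_mem_uIcc)
    have a₂ := intervalIntegral.integral_add_adjacent_intervals
      (hii z.re left_mem_uIcc z.im left_mem_uIcc 0 h0) (hii z.re left_mem_uIcc 0 h0 w.im right_mem_uIcc)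
    rw [← a₁, ← a₂]
    simp only [smul_eq_mul] at e₁ e₂ ⊢
    linear_combination e₁ + e₂
  · exact key z.im left_mem_uIcc w.im right_mem_uIcc
      (fun h => h0 (by rw [uIcc]; exact Ioo_subset_Icc_self h))

/-- **Painlevé and Liouville.**  Two functions on the closed upper half-plane, one of them reflected
in the origin, which agree on the real line and have removable singularities only, are constant as
soon as they are bounded at infinity. -/
theorem eq_const_of_glue {S₁ S₂ : Set ℂ} (hf₁ : S₁.Finite) (hf₂ : S₂.Finite)
    (hS₁ : S₁ ⊆ upperOpen) (hS₂ : S₂ ⊆ upperOpen) {U L : ℂ → ℂ}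
    (hU : HolOff S₁ U) (hL : HolOff S₂ L)
    (hbU : ∀ s ∈ S₁, U =O[𝓝[≠] s] (fun _ => (1 : ℂ)))
    (hbL : ∀ s ∈ S₂, L =O[𝓝[≠] s] (fun _ => (1 : ℂ)))
    (hiU : ∃ r C : ℝ, ∀ z ∈ upper, r ≤ ‖z‖ → ‖U z‖ ≤ C)
    (hiL : ∃ r C : ℝ, ∀ z ∈ upper, r ≤ ‖z‖ → ‖L z‖ ≤ C)
    (heq : ∀ l : ℝ, U l = L (-l)) {c : ℂ}
    (hlim : Tendsto (fun t : ℝ => U (Complex.I * t)) atTop (𝓝 c)) :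
    (∀ z ∈ upper \ S₁, U z = c) ∧ (∀ z ∈ upper \ S₂, L z = c) := by
  classical
  set S : Set ℂ := S₁ ∪ (fun z => -z) ⁻¹' S₂ with hSdef
  have hSf : S.Finite := hf₁.union (hf₂.preimage (neg_injective.injOn))
  set Φ₀ : ℂ → ℂ := fun z => if 0 ≤ z.im then U z else L (-z) with hΦ₀
  -- Taking punctured limits leaves the values at points of continuity unchanged and fills in the
  -- removable singularities.
  set Φ : ℂ → ℂ := fun z => limUnder (𝓝[≠] z) Φ₀ with hΦ
  have evU : ∀ z : ℂ, 0 < z.im → Φ₀ =ᶠ[𝓝 z] U := by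
    intro z hz
    filter_upwards [isOpen_upperOpen.mem_nhds hz] with y hy
    have : 0 ≤ y.im := le_of_lt hy
    simp [hΦ₀, this]
  have evL : ∀ z : ℂ, z.im < 0 → Φ₀ =ᶠ[𝓝 z] fun y => L (-y) := by
    intro z hz
    filter_upwards [(isOpen_lt Complex.continuous_im continuous_const).mem_nhds hz] with y hy
    have : ¬ 0 ≤ y.im := not_le.2 hy
    simp [hΦ₀, this]
  have hSim : ∀ s ∈ S, s.im ≠ 0 := by
    rintro s (hs | hs)
    · exact (hS₁ hs).ne'
    · have := hS₂ hs
      simp only [mem_upperOpen, Complex.neg_im] at this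
      linarith
  have hdiff : ∀ z, z ∉ S → z.im ≠ 0 → DifferentiableAt ℂ Φ₀ z := by
    intro z hz h0
    rcases lt_or_gt_of_ne h0 with h | h
    · refine DifferentiableAt.congr_of_eventuallyEq ?_ (evL z h)
      have : DifferentiableAt ℂ L (-z) :=
        hL.differentiableAt hf₂.isClosed (by simpa using h) fun hh => hz (Or.inr hh)
      exact this.comp z differentiableAt_id.neg
    · exact (hU.differentiableAt hf₁.isClosed h fun hh => hz (Or.inl hh)).congr_of_eventuallyEq
        (evU z h)
  have hcont : ∀ z, z ∉ S → ContinuousAt Φ₀ z := by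
    intro z hz
    by_cases h0 : z.im = 0
    · have hzr : z = (z.re : ℂ) := by apply Complex.ext <;> simp [h0]
      have cU : ContinuousWithinAt Φ₀ upper z := by
        have h1 : ContinuousWithinAt U (upper \ S₁) z :=
          hU.cont z ⟨h0.ge, fun hh => hSim z (Or.inl hh) h0⟩
        have h2 : ContinuousWithinAt U upper z := by
          refine h1.mono_of_mem_nhdsWithin ?_
          exact inter_mem self_mem_nhdsWithin (mem_nhdsWithin_of_mem_nhds (hf₁.isClosed.isOpen_compl.mem_nhds (fun hh => hSim z (Or.inl hh) h0)))
        refine h2.congr (fun y hy => if_pos hy) (if_pos h0.ge)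
      have cL : ContinuousWithinAt Φ₀ {y | y.im ≤ 0} z := by
        have h1 : ContinuousWithinAt L (upper \ S₂) (-z) :=
          hL.cont (-z) ⟨by simp [upper, h0], fun hh => hSim z (Or.inr hh) h0⟩
        have h2 : ContinuousWithinAt L upper (-z) := by
          refine h1.mono_of_mem_nhdsWithin ?_
          exact inter_mem self_mem_nhdsWithin (mem_nhdsWithin_of_mem_nhds (hf₂.isClosed.isOpen_compl.mem_nhds (fun hh => hSim z (Or.inr hh) h0)))
        have h3 : ContinuousWithinAt (fun y => L (-y)) {y | y.im ≤ 0} z :=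
          h2.comp continuous_neg.continuousWithinAt fun y hy => by
            simpa [upper] using hy
        have e : ∀ y : ℂ, y.im ≤ 0 → Φ₀ y = L (-y) := by
          intro y hy
          rcases hy.lt_or_eq with h | h
          · simp [hΦ₀, not_le.2 h]
          · have hyr : y = (y.re : ℂ) := by apply Complex.ext <;> simp [h]
            rw [hyr]
            simp [hΦ₀, heq]
        exact h3.congr (fun y hy => e y hy) (e z h0.le)
      have := cU.union cL
      rw [show upper ∪ {y : ℂ | y.im ≤ 0} = univ from by
        ext y; simpa [upper] using le_total 0 y.im] at this
      exact (continuousWithinAt_univ _ _).1 this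
    · exact (hdiff z hz h0).continuousAt
  have hopen : IsOpen Sᶜ := hSf.isClosed.isOpen_compl
  have hd₀ : DifferentiableOn ℂ Φ₀ Sᶜ := by
    -- Morera's theorem: continuity across the axis and vanishing rectangle integrals give
    -- holomorphy there.
    refine (Complex.isConservativeOn_and_continuousOn_iff_isDifferentiableOn hopen).1 ⟨?_, ?_⟩
    · exact isConservativeOn_of_differentiable_off_real
        (fun z hz => (hcont z hz).continuousWithinAt) fun z hz h => hdiff z hz h
    · exact fun z hz => (hcont z hz).continuousWithinAt
  have hΦeq : ∀ z, z ∉ S → Φ z = Φ₀ z := fun z hz =>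
    ((hcont z hz).tendsto.mono_left nhdsWithin_le_nhds).limUnder_eq
  have hbd : ∀ s ∈ S, Φ₀ =O[𝓝[≠] s] (fun _ => (1 : ℂ)) := by
    intro s hs
    rcases lt_or_gt_of_ne (hSim s hs) with h | h
    · have hs2 : -s ∈ S₂ := hs.resolve_left fun hh => not_lt.2 h.le (hS₁ hh)
      have ht : Tendsto (fun y : ℂ => -y) (𝓝[≠] s) (𝓝[≠] (-s)) := by
        refine tendsto_nhdsWithin_iff.2 ⟨(continuous_neg.tendsto s).mono_left nhdsWithin_le_nhds, ?_⟩
        filter_upwards [self_mem_nhdsWithin] with y hy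
        simpa using hy
      exact ((hbL (-s) hs2).comp_tendsto ht).congr'
        ((evL s h).symm.filter_mono nhdsWithin_le_nhds) EventuallyEq.rfl
    · have hs1 : s ∈ S₁ := by
        refine hs.resolve_right fun hh => ?_
        have := hS₂ hh
        simp only [mem_upperOpen, Complex.neg_im] at this
        linarith
      exact (hbU s hs1).congr' ((evU s h).symm.filter_mono nhdsWithin_le_nhds) EventuallyEq.rfl
  have hent : Differentiable ℂ Φ := by
    intro z
    by_cases hz : z ∈ S
    · set V : Set ℂ := (S \ {z})ᶜ with hV
      have hVo : V ∈ 𝓝 z := (hSf.subset sdiff_subset).isClosed.isOpen_compl.mem_nhds (by simp)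
      have hVd : V \ {z} ⊆ Sᶜ := by
        rintro y ⟨hy, hyz⟩ hyS
        exact hy ⟨hyS, hyz⟩
      have := Complex.differentiableOn_update_limUnder_of_isLittleO hVo (hd₀.mono hVd) (by
        apply Filter.IsBoundedUnder.isLittleO_sub_self_inv
        have h1 : (fun y => Φ₀ y - Φ₀ z) =O[𝓝[≠] z] (fun _ => (1 : ℂ)) :=
          (hbd z hz).sub (Asymptotics.isBigO_const_const _ one_ne_zero _)
        exact (Asymptotics.isBigO_one_iff ℂ).1 h1)
      refine (this.differentiableAt hVo).congr_of_eventuallyEq ?_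
      filter_upwards [hVo] with y hy
      by_cases hyz : y = z
      · subst hyz; simp [hΦ]
      · rw [Function.update_of_ne hyz]
        exact hΦeq y fun hyS => hy ⟨hyS, hyz⟩
    · refine (hd₀.differentiableAt (hopen.mem_nhds hz)).congr_of_eventuallyEq ?_
      filter_upwards [hopen.mem_nhds hz] with y hy using hΦeq y hy
  obtain ⟨r₀, hr₀⟩ := hSf.isBounded.exists_norm_le
  obtain ⟨r₁, C₁, h₁⟩ := hiU
  obtain ⟨r₂, C₂, h₂⟩ := hiL
  have hbound : Bornology.IsBounded (range Φ) := by
    set r := max (r₀ + 1) (max r₁ r₂) with hr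
    obtain ⟨C₃, h₃⟩ := (isCompact_closedBall (0 : ℂ) r).exists_bound_of_continuousOn
      hent.continuous.continuousOn
    refine isBounded_iff_forall_norm_le.2 ⟨max C₃ (max C₁ C₂), ?_⟩
    rintro _ ⟨z, rfl⟩
    by_cases hz : ‖z‖ ≤ r
    · exact (h₃ z (by simpa using hz)).trans (le_max_left _ _)
    · push Not at hz
      have hzS : z ∉ S := fun hh => by
        have := hr₀ z hh
        have : r₀ + 1 ≤ r := le_max_left _ _
        linarith
      rw [hΦeq z hzS]
      have e1 : r₁ ≤ r := (le_max_left _ _).trans (le_max_right _ _)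
      have e2 : r₂ ≤ r := (le_max_right _ _).trans (le_max_right _ _)
      by_cases him : 0 ≤ z.im
      · simp only [hΦ₀, him, if_true]
        exact (h₁ z him (by linarith)).trans ((le_max_left _ _).trans (le_max_right _ _))
      · simp only [hΦ₀, him, if_false]
        refine (h₂ (-z) ?_ (by simpa using by linarith)).trans
          ((le_max_right _ _).trans (le_max_right _ _))
        simpa [upper] using (not_le.1 him).le
  obtain ⟨d, hd⟩ := hent.exists_const_forall_eq_of_bounded hbound
  have hU' : ∀ z ∈ upper \ S₁, U z = d := by
    rintro z ⟨hz, hzS⟩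
    have hzn : z ∉ S := by
      rintro (hh | hh)
      · exact hzS hh
      · have h1 := hS₂ hh
        have h2 : (0 : ℝ) ≤ z.im := hz
        simp only [mem_upperOpen, Complex.neg_im] at h1
        linarith
    rw [← hd z, hΦeq z hzn]
    exact (if_pos hz).symm
  have hL' : ∀ z ∈ upper \ S₂, L z = d := by
    rintro z ⟨hz, hzS⟩
    by_cases h0 : z.im = 0
    · have hzr : z = (z.re : ℂ) := by apply Complex.ext <;> simp [h0]
      have := heq (-z.re)
      rw [Complex.ofReal_neg, neg_neg, ← hzr] at this
      rw [← this]
      refine hU' _ ⟨by simp [upper, h0], fun hh => ?_⟩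
      have := hS₁ hh
      simp [upperOpen, h0] at this
    · have hzp : 0 < z.im := lt_of_le_of_ne hz (Ne.symm h0)
      have hzn : -z ∉ S := by
        rintro (hh | hh)
        · have h1 := hS₁ hh
          simp only [mem_upperOpen, Complex.neg_im] at h1
          linarith
        · exact hzS (by simpa using hh)
      rw [← hd (-z), hΦeq _ hzn]
      have : ¬ (0 ≤ (-z).im) := by simpa using hzp
      simp only [hΦ₀, this, if_false, neg_neg]
  have hdc : d = c := by
    refine tendsto_nhds_unique (tendsto_const_nhds.congr' ?_) hlim
    filter_upwards [eventually_gt_atTop (max r₀ 0)] with t ht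
    have ht0 : 0 < t := (le_max_right _ _).trans_lt ht
    refine (hU' _ ⟨by simp [upper, ht0.le], fun hh => ?_⟩).symm
    have := hr₀ _ (Or.inl hh)
    simp [abs_of_pos ht0] at this
    exact absurd ((le_max_left r₀ 0).trans_lt ht) (not_lt.2 this)
  exact ⟨fun z hz => (hU' z hz).trans hdc, fun z hz => (hL' z hz).trans hdc⟩

end

/-! ### Half-line Laplace transforms -/

section

/-- The half-line Fourier–Laplace transform `∫₀^∞ h(w) e^{izw} dw`. -/
def laplace (h : ℝ → ℂ) (z : ℂ) : ℂ := ∫ w in Ioi (0 : ℝ), h w * Complex.exp (Complex.I * z * w)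

theorem norm_exp_I_mul_le {z : ℂ} (hz : z ∈ upper) {w : ℝ} (hw : 0 ≤ w) :
    ‖Complex.exp (Complex.I * z * w)‖ ≤ 1 := by
  rw [Complex.norm_exp, Real.exp_le_one_iff]
  have : (Complex.I * z * w).re = -(z.im * w) := by simp
  rw [this]
  have := mul_nonneg (mem_upper.1 hz) hw
  linarith

theorem hasDerivAt_exp_I_mul (z : ℂ) (w : ℝ) :
    HasDerivAt (fun w : ℝ => Complex.exp (Complex.I * z * w))
      (Complex.I * z * Complex.exp (Complex.I * z * w)) w := by
  have h1 : HasDerivAt (fun w : ℝ => Complex.I * z * (w : ℂ)) (Complex.I * z) w := by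
    simpa using (Complex.ofRealCLM.hasDerivAt (x := w)).const_mul (Complex.I * z)
  simpa [mul_comm] using h1.cexp

section Laplace

variable {h : ℝ → ℂ}

theorem integrableOn_laplace (hh : IntegrableOn h (Ioi 0)) {z : ℂ} (hz : z ∈ upper) :
    IntegrableOn (fun w : ℝ => h w * Complex.exp (Complex.I * z * w)) (Ioi 0) := by
  refine hh.mul_bdd (c := 1) (by fun_prop) ?_
  filter_upwards [ae_restrict_mem measurableSet_Ioi] with w hw
  exact norm_exp_I_mul_le hz (le_of_lt hw)

theorem norm_laplace_le (hh : IntegrableOn h (Ioi 0)) {z : ℂ} (hz : z ∈ upper) :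
    ‖laplace h z‖ ≤ ∫ w in Ioi (0 : ℝ), ‖h w‖ := by
  refine norm_integral_le_of_norm_le hh.norm ?_
  filter_upwards [ae_restrict_mem measurableSet_Ioi] with w hw
  rw [norm_mul]
  exact mul_le_of_le_one_right (norm_nonneg _) (norm_exp_I_mul_le hz (le_of_lt hw))

theorem continuousOn_laplace (hh : IntegrableOn h (Ioi 0)) : ContinuousOn (laplace h) upper := by
  refine continuousOn_of_dominated (bound := fun w => ‖h w‖) (fun z hz =>
    (integrableOn_laplace hh hz).aestronglyMeasurable) (fun z hz => ?_) hh.norm ?_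
  · filter_upwards [ae_restrict_mem measurableSet_Ioi] with w hw
    rw [norm_mul]
    exact mul_le_of_le_one_right (norm_nonneg _) (norm_exp_I_mul_le hz (le_of_lt hw))
  · exact ae_of_all _ fun w => by fun_prop

theorem differentiableOn_laplace (hh : IntegrableOn h (Ioi 0)) :
    DifferentiableOn ℂ (laplace h) upperOpen := by
  intro z₀ hz₀
  rw [mem_upperOpen] at hz₀
  refine DifferentiableAt.differentiableWithinAt ?_
  have hd : ∀ (z : ℂ) (w : ℝ), HasDerivAt (fun z : ℂ => h w * Complex.exp (Complex.I * z * w))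
      (h w * (Complex.I * w * Complex.exp (Complex.I * z * w))) z := by
    intro z w
    have h1 : HasDerivAt (fun z : ℂ => Complex.I * z * (w : ℂ)) (Complex.I * w) z := by
      have := ((hasDerivAt_id z).const_mul Complex.I).mul_const (w : ℂ)
      simpa using this
    have := h1.cexp.const_mul (h w)
    exact this.congr_deriv (by ring)
  -- On this half-plane `w e^{-w Im z} ≤ 2 / Im z₀`, because `s e^{-s} ≤ 1` for `s = w Im z₀ / 2`;
  -- this dominates the differentiated integrand.
  set s : Set ℂ := {z | z₀.im / 2 < z.im} with hs
  have hsn : s ∈ 𝓝 z₀ :=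
    (isOpen_lt continuous_const Complex.continuous_im).mem_nhds (by simpa using by linarith)
  refine (hasDerivAt_integral_of_dominated_loc_of_deriv_le (𝕜 := ℂ)
    (F := fun (z : ℂ) (w : ℝ) => h w * Complex.exp (Complex.I * z * w))
    (F' := fun (z : ℂ) (w : ℝ) => h w * (Complex.I * w * Complex.exp (Complex.I * z * w)))
    (bound := fun w => ‖h w‖ * (2 / z₀.im)) hsn ?_ ?_ ?_ ?_ ?_ ?_).2.differentiableAt
  · exact Eventually.of_forall fun z => hh.aestronglyMeasurable.mul (by fun_prop)
  · exact integrableOn_laplace hh (upperOpen_subset hz₀)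
  · exact hh.aestronglyMeasurable.mul (by fun_prop)
  · filter_upwards [ae_restrict_mem measurableSet_Ioi] with w hw z hz
    have hw0 : 0 < w := hw
    have hz' : z₀.im / 2 < z.im := hz
    rw [norm_mul]
    refine mul_le_mul_of_nonneg_left ?_ (norm_nonneg _)
    have e : ‖Complex.I * (w : ℂ) * Complex.exp (Complex.I * z * w)‖ = w * Real.exp (-(z.im * w)) := by
      rw [norm_mul, norm_mul, Complex.norm_exp]
      simp [abs_of_pos hw0]
    rw [e, le_div_iff₀ hz₀]
    have h1 : Real.exp (-(z.im * w)) ≤ Real.exp (-(z₀.im / 2 * w)) := by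
      gcongr
    have h2 : z₀.im / 2 * w * Real.exp (-(z₀.im / 2 * w)) ≤ 1 := by
      rw [Real.exp_neg, ← div_eq_mul_inv, div_le_one (Real.exp_pos _)]
      exact (by linarith [Real.add_one_le_exp (z₀.im / 2 * w)])
    have h3 : w * z₀.im * Real.exp (-(z.im * w)) ≤ w * z₀.im * Real.exp (-(z₀.im / 2 * w)) := by
      gcongr
    linarith
  · exact hh.norm.mul_const _
  · exact ae_of_all _ fun w z _ => hd z w

theorem holOff_laplace (hh : IntegrableOn h (Ioi 0)) (S : Set ℂ) : HolOff S (laplace h) :=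
  ⟨(continuousOn_laplace hh).mono sdiff_subset, (differentiableOn_laplace hh).mono sdiff_subset⟩

/-- **Riemann–Lebesgue lemma** in the closed upper half-plane. -/
theorem tendsto_laplace_zero (hh : IntegrableOn h (Ioi 0)) :
    Tendsto (laplace h) (Bornology.cobounded ℂ ⊓ 𝓟 upper) (𝓝 0) := by
  rw [Metric.tendsto_nhds]
  intro ε hε
  have hm : MemLp ((Ioi (0 : ℝ)).indicator h) 1 volume := by
    rw [memLp_one_iff_integrable]
    exact hh.integrable_indicator measurableSet_Ioi
  -- A smooth compactly supported approximant in `L¹` costs `ε / 2` uniformly in `z`. For it one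
  -- integration by parts gives decay like `1 / ‖z‖` up to the real axis.
  obtain ⟨g, hgc, hgd, hg⟩ := hm.exist_eLpNorm_sub_le (by simp) le_rfl (half_pos hε)
  have hgi : Integrable g := hgd.continuous.integrable_of_hasCompactSupport hgc
  have hg1 : ∫ w in Ioi (0 : ℝ), ‖h w - g w‖ ≤ ε / 2 := by
    have hi : Integrable ((Ioi (0 : ℝ)).indicator h - g) :=
      (memLp_one_iff_integrable.1 hm).sub hgi
    have h1 : ∫ w, ‖((Ioi (0 : ℝ)).indicator h - g) w‖ ≤ ε / 2 := by
      rw [eLpNorm_one_eq_lintegral_enorm, ← ofReal_integral_norm_eq_lintegral_enorm hi] at hg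
      exact (ENNReal.ofReal_le_ofReal_iff (half_pos hε).le).1 hg
    refine le_trans ?_ h1
    calc ∫ w in Ioi (0 : ℝ), ‖h w - g w‖
        = ∫ w in Ioi (0 : ℝ), ‖((Ioi (0 : ℝ)).indicator h - g) w‖ := by
          refine setIntegral_congr_fun measurableSet_Ioi fun w hw => ?_
          simp [indicator_of_mem hw]
      _ ≤ _ := setIntegral_le_integral hi.norm (ae_of_all _ fun w => norm_nonneg _)
  set C : ℝ := ‖g 0‖ + ∫ w in Ioi (0 : ℝ), ‖deriv g w‖ with hC
  have hg' : Integrable (deriv g) :=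
    (hgd.continuous_deriv (by simp)).integrable_of_hasCompactSupport hgc.deriv
  have hbd : ∀ z ∈ upper, ‖z‖ * ‖laplace g z‖ ≤ C := by
    intro z hz
    have hder : ∀ w ∈ Ici (0 : ℝ), HasDerivAt (fun w : ℝ => g w * Complex.exp (Complex.I * z * w))
        (deriv g w * Complex.exp (Complex.I * z * w) +
          g w * (Complex.I * z * Complex.exp (Complex.I * z * w))) w := fun w _ =>
      ((hgd.differentiable (by simp)) w).hasDerivAt.mul (hasDerivAt_exp_I_mul z w)
    have i1 := integrableOn_laplace hg'.integrableOn hz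
    have i2 := integrableOn_laplace hgi.integrableOn hz
    have i3 : IntegrableOn (fun w : ℝ => g w * (Complex.I * z * Complex.exp (Complex.I * z * w)))
        (Ioi 0) := by
      have := i2.const_mul (Complex.I * z)
      refine this.congr (ae_of_all _ fun w => ?_)
      simp only []; ring
    have hlim : Tendsto (fun w : ℝ => g w * Complex.exp (Complex.I * z * w)) atTop (𝓝 0) := by
      have : ∀ᶠ w in atTop, g w = 0 := by
        obtain ⟨r, hr⟩ := hgc.isCompact.isBounded.exists_norm_le
        filter_upwards [eventually_gt_atTop (max r 0)] with w hw
        by_contra hne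
        have h1 := hr w (subset_tsupport g hne)
        rw [Real.norm_of_nonneg ((le_max_right r 0).trans hw.le)] at h1
        exact absurd (lt_of_le_of_lt (le_max_left r 0) hw) (not_lt.2 h1)
      refine tendsto_const_nhds.congr' ?_
      filter_upwards [this] with w hw
      simp [hw]
    have := integral_Ioi_of_hasDerivAt_of_tendsto' hder (i1.add i3) hlim
    rw [integral_add i1 i3] at this
    have e3 : ∫ w in Ioi (0 : ℝ), g w * (Complex.I * z * Complex.exp (Complex.I * z * w)) =
        Complex.I * z * laplace g z := by
      rw [laplace, ← integral_const_mul]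
      congr 1 with w
      ring
    rw [e3] at this
    have e : Complex.I * z * laplace g z = -g 0 - laplace (deriv g) z := by
      have e4 : laplace (deriv g) z =
          ∫ w in Ioi (0 : ℝ), deriv g w * Complex.exp (Complex.I * z * w) := rfl
      rw [← e4] at this
      simp at this
      linear_combination this
    have en : ‖z‖ * ‖laplace g z‖ = ‖Complex.I * z * laplace g z‖ := by simp
    rw [en, e]
    refine (norm_sub_le _ _).trans ?_
    rw [norm_neg]
    exact add_le_add_right (norm_laplace_le hg'.integrableOn hz) _
  have hdiff : ∀ z ∈ upper, ‖laplace h z - laplace g z‖ ≤ ε / 2 := by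
    intro z hz
    rw [laplace, laplace, ← integral_sub (integrableOn_laplace hh hz)
      (integrableOn_laplace hgi.integrableOn hz)]
    refine le_trans ?_ ((norm_laplace_le (hh.sub hgi.integrableOn) hz).trans hg1)
    rw [laplace]
    refine le_of_eq ?_
    congr 2 with w
    simp [sub_mul]
  have hC0 : 0 ≤ C := by positivity
  have hev : ∀ᶠ z in Bornology.cobounded ℂ ⊓ 𝓟 upper, z ∈ upper ∧ 2 * C / ε < ‖z‖ := by
    rw [eventually_inf_principal]
    filter_upwards [(tendsto_norm_cobounded_atTop (E := ℂ)).eventually_gt_atTop (2 * C / ε)]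
      with z hz hz'
    exact ⟨hz', hz⟩
  filter_upwards [hev] with z hz
  rw [dist_zero_right]
  have h1 := hdiff z hz.1
  have h2 := hbd z hz.1
  have hz0 : 0 < ‖z‖ := lt_of_le_of_lt (by positivity) hz.2
  have h3 : ‖laplace g z‖ < ε / 2 := by
    have h4 : 2 * C < ‖z‖ * ε := (div_lt_iff₀ hε).1 hz.2
    by_contra hcon
    push Not at hcon
    have : ‖z‖ * (ε / 2) ≤ C := (mul_le_mul_of_nonneg_left hcon hz0.le).trans h2
    linarith
  calc ‖laplace h z‖ = ‖(laplace h z - laplace g z) + laplace g z‖ := by simp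
    _ ≤ _ := norm_add_le _ _
    _ < ε := by linarith

/-- The initial value theorem for the Laplace transform. -/
theorem tendsto_mul_laplace (hh : IntegrableOn h (Ioi 0)) {C : ℝ} (hC : ∀ w, 0 < w → ‖h w‖ ≤ C)
    {h₀ : ℂ} (h0 : Tendsto h (𝓝[>] 0) (𝓝 h₀)) :
    Tendsto (fun t : ℝ => (t : ℂ) * laplace h (Complex.I * t)) atTop (𝓝 h₀) := by
  -- The substitution `s = t w` concentrates the transform at the end point; the integrand is
  -- dominated by `C e^{-s}`.
  have key : Tendsto (fun t : ℝ => ∫ s in Ioi (0 : ℝ), h (t⁻¹ * s) * Complex.exp (-s)) atTop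
      (𝓝 (∫ s in Ioi (0 : ℝ), h₀ * Complex.exp (-s))) := by
    refine tendsto_integral_filter_of_dominated_convergence (fun s => C * Real.exp (-s)) ?_ ?_ ?_ ?_
    · filter_upwards [eventually_gt_atTop 0] with t ht
      refine AEStronglyMeasurable.mul ?_ (by fun_prop)
      have : IntegrableOn (fun s => h (t⁻¹ * s)) (Ioi 0) := by
        rw [integrableOn_Ioi_comp_mul_left_iff _ _ (inv_pos.2 ht)]
        simpa using hh
      exact this.aestronglyMeasurable
    · filter_upwards [eventually_gt_atTop 0] with t ht
      filter_upwards [ae_restrict_mem measurableSet_Ioi] with s hs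
      have hs0 : 0 < s := hs
      rw [norm_mul, Complex.norm_exp]
      simp only [Complex.neg_re, Complex.ofReal_re]
      gcongr
      exact hC _ (by positivity)
    · exact (integrableOn_exp_neg_Ioi 0).const_mul C
    · filter_upwards [ae_restrict_mem measurableSet_Ioi] with s hs
      have hs0 : 0 < s := hs
      refine Tendsto.mul_const _ (h0.comp ?_)
      refine tendsto_nhdsWithin_iff.2 ⟨?_, ?_⟩
      · simpa using tendsto_inv_atTop_zero.mul_const s
      · filter_upwards [eventually_gt_atTop 0] with t ht
        exact mul_pos (inv_pos.2 ht) hs0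
  have e1 : ∫ s in Ioi (0 : ℝ), h₀ * Complex.exp (-s) = h₀ := by
    rw [integral_const_mul]
    have : ∫ s in Ioi (0 : ℝ), Complex.exp (-s) = ((∫ s in Ioi (0 : ℝ), Real.exp (-s) : ℝ) : ℂ) := by
      rw [← integral_complex_ofReal]
      congr 1 with s
      simp
    rw [this, integral_exp_neg_Ioi_zero]
    simp
  rw [e1] at key
  refine key.congr' ?_
  filter_upwards [eventually_gt_atTop 0] with t ht
  have := integral_comp_mul_left_Ioi (fun w : ℝ => h w * Complex.exp (Complex.I * (Complex.I * t) * w))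
    0 (inv_pos.2 ht)
  simp only [inv_inv, mul_zero] at this
  rw [laplace, ← Complex.real_smul, ← this]
  refine setIntegral_congr_fun measurableSet_Ioi fun s _ => ?_
  have ht' : (t : ℂ) ≠ 0 := by exact_mod_cast ht.ne'
  simp only [Complex.ofReal_mul, Complex.ofReal_inv]
  congr 2
  field_simp
  rw [Complex.I_sq]; ring

end Laplace

/-- The Fourier transform with the normalization `∫ κ(s) e^{-ils} ds`. -/
def ft (κ : ℝ → ℂ) (l : ℝ) : ℂ := ∫ s, κ s * Complex.exp (-(Complex.I * l * s))

/-- If `m` is, on the positive half-line, minus the positive part of a convolution, then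
`m̂ + κ̂ (c + k̂)` extends holomorphically to the upper half-plane. -/
theorem exists_laplace_eq_of_convolution {κ k m : ℝ → ℂ} {c : ℂ} (hκ : Integrable κ)
    (hk : IntegrableOn k (Ioi 0))
    (hm : ∀ y, 0 < y → m y = -(c * κ y) - ∫ z in Ioi (0 : ℝ), k z * κ (z + y)) :
    ∃ h : ℝ → ℂ, IntegrableOn h (Ioi 0) ∧
      ∀ l : ℝ, laplace m (-l) + ft κ l * (c + laplace k l) = laplace h l := by
  set G : ℝ → ℂ := fun y => c * κ y + ∫ z in Ioi (0 : ℝ), k z * κ (z + y) with hG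
  have hprod : Integrable (fun p : ℝ × ℝ => k p.1 * κ (p.1 + p.2))
      ((volume.restrict (Ioi 0)).prod volume) := by
    have h1 : Integrable (fun p : ℝ × ℝ => k p.1 * κ p.2)
      ((volume.restrict (Ioi 0)).prod volume) := Integrable.mul_prod hk hκ
    exact (measurePreserving_prod_add (volume.restrict (Ioi (0 : ℝ))) volume).integrable_comp_of_integrable h1
  have hGi : Integrable G := (hκ.const_mul c).add hprod.integral_prod_right
  have hnorm : ∀ l s : ℝ, ‖Complex.exp (-(Complex.I * l * s))‖ = 1 := by
    intro l s
    rw [Complex.norm_exp]; simp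
  have hexp : ∀ {f : ℝ → ℂ} (l : ℝ), Integrable f →
      Integrable (fun s : ℝ => f s * Complex.exp (-(Complex.I * l * s))) := fun l hf =>
    hf.mul_bdd (c := 1) (by fun_prop) (ae_of_all _ fun s => (hnorm l s).le)
  have hFT : ∀ l : ℝ, ft G l = ft κ l * (c + laplace k l) := by
    intro l
    have hi : Integrable (fun p : ℝ × ℝ => k p.1 * κ (p.1 + p.2) *
        Complex.exp (-(Complex.I * l * p.2))) ((volume.restrict (Ioi 0)).prod volume) :=
      hprod.mul_bdd (c := 1) (by fun_prop) (ae_of_all _ fun s => (hnorm l s.2).le)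
    have e1 : ∫ y, (∫ z in Ioi (0 : ℝ), k z * κ (z + y)) * Complex.exp (-(Complex.I * l * y)) =
        ft κ l * laplace k l := by
      calc ∫ y, (∫ z in Ioi (0 : ℝ), k z * κ (z + y)) * Complex.exp (-(Complex.I * l * y))
          = ∫ y, ∫ z in Ioi (0 : ℝ), k z * κ (z + y) * Complex.exp (-(Complex.I * l * y)) := by
            congr 1 with y
            rw [integral_mul_const]
        _ = ∫ z in Ioi (0 : ℝ), ∫ y, k z * κ (z + y) * Complex.exp (-(Complex.I * l * y)) :=
            (integral_integral_swap hi).symm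
        _ = ∫ z in Ioi (0 : ℝ), ft κ l * (k z * Complex.exp (Complex.I * l * z)) := by
            congr 1 with z
            have := integral_add_left_eq_self (μ := volume)
              (fun y : ℝ => k z * κ y * Complex.exp (-(Complex.I * l * (y - z)))) z
            simp only [Complex.ofReal_add, add_sub_cancel_left] at this
            rw [this, ft, ← integral_mul_const]
            congr 1 with y
            have : Complex.exp (-(Complex.I * l * (y - z))) =
                Complex.exp (-(Complex.I * l * y)) * Complex.exp (Complex.I * l * z) := by
              rw [← Complex.exp_add]; congr 1; ring
            rw [this]; ring
        _ = ft κ l * laplace k l := by rw [integral_const_mul, laplace]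
    have e2 : ft G l = ∫ y, (c * (κ y * Complex.exp (-(Complex.I * l * y))) +
        (∫ z in Ioi (0 : ℝ), k z * κ (z + y)) * Complex.exp (-(Complex.I * l * y))) := by
      rw [ft]
      congr 1 with y
      simp only [hG]; ring
    rw [e2, integral_add ((hexp l hκ).const_mul c) (hexp l hprod.integral_prod_right), e1,
      integral_const_mul, ← ft]
    ring
  -- `G` is the convolution on the whole line. Its positive half is `-m`, so what is left of its
  -- Fourier transform comes from the negative half, which after reflection has a holomorphic
  -- transform.
  refine ⟨fun w => G (-w), ?_, fun l => ?_⟩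
  · exact (hGi.comp_neg).integrableOn
  · have e1 := integral_add_compl (measurableSet_Ioi (a := (0 : ℝ))) (hexp l hGi)
    rw [compl_Ioi] at e1
    have e2 : ∫ y in Ioi (0 : ℝ), G y * Complex.exp (-(Complex.I * l * y)) = -laplace m (-l) := by
      rw [laplace, ← integral_neg]
      refine setIntegral_congr_fun measurableSet_Ioi fun y hy => ?_
      simp only [hm y hy, hG]
      have : Complex.I * -(l : ℂ) * y = -(Complex.I * l * y) := by ring
      rw [this]; ring
    have e3 : ∫ y in Iic (0 : ℝ), G y * Complex.exp (-(Complex.I * l * y)) =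
        laplace (fun w => G (-w)) l := by
      have := integral_comp_neg_Iic 0 (fun w : ℝ => G (-w) * Complex.exp (Complex.I * l * w))
      simp only [neg_neg, neg_zero, Complex.ofReal_neg] at this
      rw [laplace, ← this]
      congr 1 with y
      congr 2
      ring
    rw [← hFT, ft, ← e1, e2, e3]
    ring

end

/-! ### Behaviour at infinity, convolutions and the Riemann–Hilbert argument -/

section

/-- Infinity in the closed upper half-plane. -/
def atInf : Filter ℂ := Bornology.cobounded ℂ ⊓ 𝓟 upper

theorem bound_of_isBigO_atInf {f : ℂ → ℂ} (hf : f =O[atInf] (fun _ => (1 : ℂ))) :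
    ∃ r C : ℝ, ∀ z ∈ upper, r ≤ ‖z‖ → ‖f z‖ ≤ C := by
  obtain ⟨C, hC⟩ := hf.bound
  rw [atInf, eventually_inf_principal, ← comap_norm_atTop, eventually_comap] at hC
  obtain ⟨r, hr⟩ := eventually_atTop.1 hC
  refine ⟨r, C, fun z hz hrz => ?_⟩
  simpa using hr _ hrz z rfl hz

theorem tendsto_I_mul_atInf : Tendsto (fun t : ℝ => Complex.I * t) atTop atInf := by
  rw [atInf, tendsto_inf]
  constructor
  · rw [← tendsto_norm_atTop_iff_cobounded]
    refine tendsto_id.congr' ?_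
    filter_upwards [eventually_ge_atTop 0] with t ht
    simp [abs_of_nonneg ht]
  · rw [tendsto_principal]
    filter_upwards [eventually_ge_atTop 0] with t ht
    simpa using ht

/-- Cubic decay of the kernel is shared out: the first factor is square integrable in `z`, to be
paired with an `L²` function, and the second is integrable in `y`. -/
theorem one_add_cube_inv_le {y z : ℝ} (hy : 0 ≤ y) (hz : 0 ≤ z) :
    ((1 + (z + y)) ^ 3)⁻¹ ≤ (1 + z ^ 2)⁻¹ ^ (1 / 2 : ℝ) * (1 + y ^ 2)⁻¹ := by
  have h1 : (1 + z ^ 2) ^ (1 / 2 : ℝ) ≤ 1 + z := by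
    rw [← Real.sqrt_eq_rpow]
    apply Real.sqrt_le_iff.2
    constructor <;> nlinarith
  have h2 : 1 + y ^ 2 ≤ (1 + y) ^ 2 := by nlinarith
  rw [Real.inv_rpow (by positivity), ← mul_inv]
  apply inv_anti₀ (by positivity)
  calc (1 + z ^ 2) ^ (1 / 2 : ℝ) * (1 + y ^ 2) ≤ (1 + z) * (1 + y) ^ 2 := by gcongr
    _ ≤ (1 + (z + y)) * (1 + (z + y)) ^ 2 := by gcongr <;> linarith
    _ = _ := by ring

section Convolution

variable {κ k : ℝ → ℂ} {C : ℝ}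

theorem integrableOn_mul_weight (hk : MemLp k 2 (volume.restrict (Ioi 0))) :
    IntegrableOn (fun z => ‖k z‖ * (1 + z ^ 2)⁻¹ ^ (1 / 2 : ℝ)) (Ioi 0) := by
  have h2 : MemLp (fun z : ℝ => (1 + z ^ 2)⁻¹ ^ (1 / 2 : ℝ)) 2 (volume.restrict (Ioi 0)) := by
    rw [memLp_two_iff_integrable_sq]
    · refine (integrable_inv_one_add_sq.integrableOn (s := Ioi (0 : ℝ))).congr (ae_of_all _ fun z => ?_)
      have : 0 ≤ (1 + z ^ 2)⁻¹ := by positivity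
      simp only []
      rw [← Real.rpow_mul_natCast this]
      norm_num
    · apply Measurable.aestronglyMeasurable
      fun_prop
  exact hk.norm.integrable_mul h2

theorem norm_conv_integrand_le (hκ : ∀ s, 0 ≤ s → ‖κ s‖ ≤ C * ((1 + s) ^ 3)⁻¹) (hC : 0 ≤ C)
    {y z : ℝ} (hy : 0 ≤ y) (hz : 0 ≤ z) :
    ‖k z * κ (z + y)‖ ≤ C * (1 + y ^ 2)⁻¹ * (‖k z‖ * (1 + z ^ 2)⁻¹ ^ (1 / 2 : ℝ)) := by
  rw [norm_mul]
  calc ‖k z‖ * ‖κ (z + y)‖ ≤ ‖k z‖ * (C * ((1 + (z + y)) ^ 3)⁻¹) := by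
        gcongr; exact hκ _ (by positivity)
    _ ≤ ‖k z‖ * (C * ((1 + z ^ 2)⁻¹ ^ (1 / 2 : ℝ) * (1 + y ^ 2)⁻¹)) := by
        gcongr; exact one_add_cube_inv_le hy hz
    _ = _ := by ring

/-- This is the passage from `L²` to `L¹`: the convolution term of a Marchenko equation is
integrable although the unknown is only known to be square integrable. -/
theorem norm_conv_le (hκ : ∀ s, 0 ≤ s → ‖κ s‖ ≤ C * ((1 + s) ^ 3)⁻¹) (hC : 0 ≤ C)
    (hk : MemLp k 2 (volume.restrict (Ioi 0))) {y : ℝ} (hy : 0 ≤ y) :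
    ‖∫ z in Ioi (0 : ℝ), k z * κ (z + y)‖ ≤
      C * (1 + y ^ 2)⁻¹ * ∫ z in Ioi (0 : ℝ), ‖k z‖ * (1 + z ^ 2)⁻¹ ^ (1 / 2 : ℝ) := by
  rw [← integral_const_mul]
  refine norm_integral_le_of_norm_le ((integrableOn_mul_weight hk).const_mul _) ?_
  filter_upwards [ae_restrict_mem measurableSet_Ioi] with z hz
  exact norm_conv_integrand_le hκ hC hy (le_of_lt hz)

theorem continuousOn_conv (hκc : ContinuousOn κ (Ici 0))
    (hκ : ∀ s, 0 ≤ s → ‖κ s‖ ≤ C * ((1 + s) ^ 3)⁻¹) (hC : 0 ≤ C)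
    (hk : MemLp k 2 (volume.restrict (Ioi 0))) :
    ContinuousOn (fun y => ∫ z in Ioi (0 : ℝ), k z * κ (z + y)) (Ici 0) := by
  refine continuousOn_of_dominated
    (bound := fun z => C * (‖k z‖ * (1 + z ^ 2)⁻¹ ^ (1 / 2 : ℝ))) ?_ ?_ ?_ ?_
  · intro y hy
    refine hk.aestronglyMeasurable.mul (ContinuousOn.aestronglyMeasurable ?_ measurableSet_Ioi)
    refine hκc.comp (by fun_prop) fun z hz => ?_
    have hz' : 0 < z := hz
    have hy' : 0 ≤ y := hy
    exact (by positivity : 0 ≤ z + y)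
  · intro y hy
    have hy' : 0 ≤ y := hy
    filter_upwards [ae_restrict_mem measurableSet_Ioi] with z hz
    refine (norm_conv_integrand_le hκ hC hy (le_of_lt hz)).trans ?_
    have : (1 + y ^ 2)⁻¹ ≤ 1 := inv_le_one_of_one_le₀ (by nlinarith)
    have h0 : 0 ≤ ‖k z‖ * (1 + z ^ 2)⁻¹ ^ (1 / 2 : ℝ) := by positivity
    have := mul_le_mul_of_nonneg_left this hC
    rw [mul_one] at this
    gcongr
  · exact (integrableOn_mul_weight hk).const_mul C
  · filter_upwards [ae_restrict_mem measurableSet_Ioi] with z hz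
    refine continuousOn_const.mul (hκc.comp (by fun_prop) fun y hy => ?_)
    have hz' : 0 < z := hz
    have hy' : 0 ≤ y := hy
    exact (by positivity : 0 ≤ z + y)

end Convolution

/-- The Marchenko equations hold at every point of the open half-line, so the unknown `m` inherits
everything from the continuous right-hand side `f`: integrability, the one-sided limit, and the
bound required by the initial value theorem. -/
theorem integrableOn_and_tendsto_of_decay {f m : ℝ → ℂ} {C : ℝ} (hf : ContinuousOn f (Ici 0))
    (hb : ∀ y, 0 ≤ y → ‖f y‖ ≤ C * (1 + y ^ 2)⁻¹) (hm : ∀ y, 0 < y → m y = f y) :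
    IntegrableOn m (Ioi 0) ∧ Tendsto m (𝓝[>] 0) (𝓝 (f 0)) ∧ ∀ y, 0 < y → ‖m y‖ ≤ |C| := by
  refine ⟨?_, ?_, ?_⟩
  · have : IntegrableOn f (Ioi 0) := by
      refine Integrable.mono' ((integrable_inv_one_add_sq.const_mul C).integrableOn)
        ((hf.mono Ioi_subset_Ici_self).aestronglyMeasurable measurableSet_Ioi) ?_
      filter_upwards [ae_restrict_mem measurableSet_Ioi] with y hy
      exact hb y (le_of_lt hy)
    exact this.congr_fun (fun y hy => (hm y hy).symm) measurableSet_Ioi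
  · have : Tendsto f (𝓝[>] 0) (𝓝 (f 0)) :=
      ((hf 0 self_mem_Ici).mono Ioi_subset_Ici_self)
    refine this.congr' ?_
    filter_upwards [self_mem_nhdsWithin] with y hy using (hm y hy).symm
  · intro y hy
    rw [hm y hy]
    refine (hb y hy.le).trans ?_
    calc C * (1 + y ^ 2)⁻¹ ≤ |C| * (1 + y ^ 2)⁻¹ := by gcongr; exact le_abs_self C
      _ ≤ |C| * 1 := by
        gcongr; exact inv_le_one_of_one_le₀ (by nlinarith)
      _ = |C| := mul_one _

/-- The analytic core of the uniqueness of the solution of the Marchenko system: its transforms are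
determined by the Riemann–Hilbert problem satisfied by the Jost solutions. -/
theorem laplace_eq_of_riemannHilbert {S₁ S₂ : Set ℂ} (hf₁ : S₁.Finite) (hf₂ : S₂.Finite)
    (hS₁ : S₁ ⊆ upperOpen) (hS₂ : S₂ ⊆ upperOpen)
    {g₁ g₂ G₁ G₂ X₁ X₂ Y₁ Y₂ : ℂ → ℂ} {c p : ℂ} {κ₁ κ₂ k kb : ℝ → ℂ}
    (hg₁ : HolOff ∅ g₁) (hg₂ : HolOff ∅ g₂) (hG₁ : HolOff ∅ G₁) (hG₂ : HolOff ∅ G₂)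
    (hX₁ : HolOff S₁ X₁) (hX₂ : HolOff S₁ X₂) (hY₁ : HolOff S₂ Y₁) (hY₂ : HolOff S₂ Y₂)
    (ig₁ : Tendsto g₁ atInf (𝓝 0)) (ig₂ : Tendsto g₂ atInf (𝓝 c))
    (iG₁ : G₁ =O[atInf] (fun _ => (1 : ℂ))) (iG₂ : (fun z => z * G₂ z) =O[atInf] (fun _ => (1 : ℂ)))
    (iX₁ : X₁ =O[atInf] (fun _ => (1 : ℂ))) (iX₂ : X₂ =O[atInf] (fun _ => (1 : ℂ)))
    (iY₁ : Y₁ =O[atInf] (fun _ => (1 : ℂ))) (iY₂ : Y₂ =O[atInf] (fun _ => (1 : ℂ)))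
    (sX₁ : ∀ s ∈ S₁, X₁ =O[𝓝[≠] s] (fun _ => (1 : ℂ)))
    (sX₂ : ∀ s ∈ S₁, X₂ =O[𝓝[≠] s] (fun _ => (1 : ℂ)))
    (sY₁ : ∀ s ∈ S₂, Y₁ =O[𝓝[≠] s] (fun _ => (1 : ℂ)))
    (sY₂ : ∀ s ∈ S₂, Y₂ =O[𝓝[≠] s] (fun _ => (1 : ℂ)))
    (wX : ∀ z ∈ upper \ S₁, X₁ z * g₂ z - X₂ z * g₁ z = p)
    (wY : ∀ z ∈ upper \ S₂, Y₂ z * G₁ z + z * Y₁ z * G₂ z = p)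
    (jX₁ : ∀ l : ℝ, X₁ l = G₁ (-l) + ft κ₁ l * g₁ l)
    (jX₂ : ∀ l : ℝ, X₂ l = l * G₂ (-l) + ft κ₁ l * g₂ l)
    (jY₁ : ∀ l : ℝ, Y₁ (-l) = g₁ l + ft κ₂ (-l) * G₁ (-l))
    (jY₂ : ∀ l : ℝ, Y₂ (-l) = g₂ l + l * ft κ₂ (-l) * G₂ (-l))
    (hκ₁ : Integrable κ₁) (hκ₂ : Integrable κ₂)
    (hk : IntegrableOn k (Ioi 0)) (hkb : IntegrableOn kb (Ioi 0))
    (ekb : ∀ y, 0 < y → kb y = -∫ z in Ioi (0 : ℝ), k z * κ₁ (z + y))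
    (ek : ∀ y, 0 < y → k y = -κ₂ y - ∫ z in Ioi (0 : ℝ), kb z * κ₂ (z + y)) :
    (∀ z ∈ upper \ S₁, laplace k z * p = c * g₁ z) ∧
      ∀ z ∈ upper \ S₂, (1 + laplace kb z) * p = c * G₁ z := by
  -- The constants `0` and `1` record where the identity sits in the row: the equation for `kb` is
  -- homogeneous, the one for `k` has the free term `κ₂`.
  obtain ⟨h₁, hh₁, e₁⟩ := exists_laplace_eq_of_convolution (c := 0) hκ₁ hk (m := kb)
    (fun y hy => by rw [ekb y hy]; ring)
  obtain ⟨h₂, hh₂, e₂⟩ := exists_laplace_eq_of_convolution (c := 1) hκ₂ hkb (m := k)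
    (fun y hy => by rw [ek y hy]; ring)
  have one : ∀ {F : Filter ℂ}, (fun _ : ℂ => (1 : ℂ)) =O[F] (fun _ => (1 : ℂ)) :=
    Asymptotics.isBigO_refl _ _
  have mul1 : ∀ {F : Filter ℂ} {f g : ℂ → ℂ}, f =O[F] (fun _ => (1 : ℂ)) →
      g =O[F] (fun _ => (1 : ℂ)) → (fun z => f z * g z) =O[F] (fun _ => (1 : ℂ)) := by
    intro F f g hf hg
    simpa using hf.mul hg
  have tl : ∀ {h : ℝ → ℂ}, IntegrableOn h (Ioi 0) → Tendsto (laplace h) atInf (𝓝 0) :=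
    fun hh => tendsto_laplace_zero hh
  have il : ∀ {h : ℝ → ℂ}, IntegrableOn h (Ioi 0) → laplace h =O[atInf] (fun _ => (1 : ℂ)) :=
    fun hh => (tl hh).isBigO_one ℂ
  have cat : ∀ {f : ℂ → ℂ}, HolOff ∅ f → ∀ {s : ℂ}, s ∈ upperOpen →
      f =O[𝓝[≠] s] (fun _ => (1 : ℂ)) := by
    intro f hf s hs
    have := (hf.differentiableAt isClosed_empty hs (notMem_empty s)).continuousAt
    exact (this.tendsto.mono_left nhdsWithin_le_nhds).isBigO_one ℂ
  have hol : ∀ {h : ℝ → ℂ}, IntegrableOn h (Ioi 0) → ∀ S : Set ℂ, HolOff S (laplace h) :=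
    fun hh S => holOff_laplace hh S
  have lim0 : Tendsto (fun z => (1 + laplace h₁ z) * g₁ z - laplace k z * X₁ z) atInf (𝓝 0) := by
    have h1 : Tendsto (fun z => laplace k z * X₁ z) atInf (𝓝 0) := by
      rw [← Asymptotics.isLittleO_one_iff ℂ]
      have := ((Asymptotics.isLittleO_one_iff ℂ).2 (tl hk)).mul_isBigO iX₁
      simpa only [mul_one] using this
    have h2 := ((tl hh₁).const_add 1).mul ig₁
    simpa using h2.sub h1
  have lim1 : Tendsto (fun z => (1 + laplace h₁ z) * g₂ z - laplace k z * X₂ z) atInf (𝓝 c) := by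
    have h1 : Tendsto (fun z => laplace k z * X₂ z) atInf (𝓝 0) := by
      rw [← Asymptotics.isLittleO_one_iff ℂ]
      have := ((Asymptotics.isLittleO_one_iff ℂ).2 (tl hk)).mul_isBigO iX₂
      simpa only [mul_one] using this
    have h2 := ((tl hh₁).const_add 1).mul ig₂
    simpa using h2.sub h1
  have sub0 := fun S : Set ℂ => empty_subset S
  have bdd : ∀ {f : ℂ → ℂ}, f =O[atInf] (fun _ => (1 : ℂ)) →
      ∃ r C : ℝ, ∀ z ∈ upper, r ≤ ‖z‖ → ‖f z‖ ≤ C := fun hf => bound_of_isBigO_atInf hf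
  have c₁ : ∀ s ∈ S₁, (fun z => (1 + laplace h₁ z) * g₁ z) =O[𝓝[≠] s] (fun _ => (1 : ℂ)) :=
    fun s hs => mul1 (one.add (cat (hol hh₁ ∅) (hS₁ hs))) (cat hg₁ (hS₁ hs))
  have c₂ : ∀ s ∈ S₁, (fun z => (1 + laplace h₁ z) * g₂ z) =O[𝓝[≠] s] (fun _ => (1 : ℂ)) :=
    fun s hs => mul1 (one.add (cat (hol hh₁ ∅) (hS₁ hs))) (cat hg₂ (hS₁ hs))
  have c₃ : ∀ s ∈ S₂, (fun z => laplace h₂ z * G₁ z) =O[𝓝[≠] s] (fun _ => (1 : ℂ)) :=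
    fun s hs => mul1 (cat (hol hh₂ ∅) (hS₂ hs)) (cat hG₁ (hS₂ hs))
  have c₄ : ∀ s ∈ S₂, (fun z => laplace h₂ z * (z * G₂ z)) =O[𝓝[≠] s] (fun _ => (1 : ℂ)) :=
    fun s hs => mul1 (cat (hol hh₂ ∅) (hS₂ hs)) (cat (HolOff.id.mul hG₂) (hS₂ hs))
  have p₁ : HolOff S₁ (fun z => 1 + laplace h₁ z) := (HolOff.const 1).add (hol hh₁ _)
  have p₂ : HolOff S₂ (fun z => 1 + laplace kb z) := (HolOff.const 1).add (hol hkb _)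
  have q₂ : HolOff S₂ (fun z => z * G₂ z) := HolOff.id.mul (hG₂.mono (sub0 _))
  -- After cancellation of `κ̂₁` and `κ̂₂` both functions equal `(1 + k̂b(-l)) g₁(l) - k̂(l) G₁(-l)`
  -- on the real axis.
  have D₁ := eq_const_of_glue hf₁ hf₂ hS₁ hS₂ (c := 0)
    (U := fun z => (1 + laplace h₁ z) * g₁ z - laplace k z * X₁ z)
    (L := fun z => (1 + laplace kb z) * Y₁ z - laplace h₂ z * G₁ z) ?_ ?_ ?_ ?_ ?_ ?_ ?_ ?_
  rotate_left
  · exact (p₁.mul (hg₁.mono (sub0 _))).sub ((hol hk _).mul hX₁)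
  · exact (p₂.mul hY₁).sub ((hol hh₂ _).mul (hG₁.mono (sub0 _)))
  · exact fun s hs => (c₁ s hs).sub (mul1 (cat (hol hk ∅) (hS₁ hs)) (sX₁ s hs))
  · exact fun s hs => (mul1 (one.add (cat (hol hkb ∅) (hS₂ hs))) (sY₁ s hs)).sub (c₃ s hs)
  · exact bdd (lim0.isBigO_one ℂ)
  · exact bdd ((mul1 (one.add (il hkb)) iY₁).sub (mul1 (il hh₂) iG₁))
  · intro l
    have a := e₁ l
    have b := e₂ (-l)
    push_cast at b
    rw [neg_neg] at b
    rw [jX₁, jY₁, ← a, ← b]; ring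
  · exact lim0.comp tendsto_I_mul_atInf
  -- Here the common boundary value is `(1 + k̂b(-l)) g₂(l) - l k̂(l) G₂(-l)`.
  have D₂ := eq_const_of_glue hf₁ hf₂ hS₁ hS₂ (c := c)
    (U := fun z => (1 + laplace h₁ z) * g₂ z - laplace k z * X₂ z)
    (L := fun z => (1 + laplace kb z) * Y₂ z + laplace h₂ z * (z * G₂ z)) ?_ ?_ ?_ ?_ ?_ ?_ ?_ ?_
  rotate_left
  · exact (p₁.mul (hg₂.mono (sub0 _))).sub ((hol hk _).mul hX₂)
  · exact (p₂.mul hY₂).add ((hol hh₂ _).mul q₂)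
  · exact fun s hs => (c₂ s hs).sub (mul1 (cat (hol hk ∅) (hS₁ hs)) (sX₂ s hs))
  · exact fun s hs => (mul1 (one.add (cat (hol hkb ∅) (hS₂ hs))) (sY₂ s hs)).add (c₄ s hs)
  · exact bdd (lim1.isBigO_one ℂ)
  · exact bdd ((mul1 (one.add (il hkb)) iY₂).add (mul1 (il hh₂) iG₂))
  · intro l
    have a := e₁ l
    have b := e₂ (-l)
    push_cast at b
    rw [neg_neg] at b
    rw [jX₂, jY₂, ← a, ← b]; ring
  · exact lim1.comp tendsto_I_mul_atInf
  -- The two constants give linear equations for `(1 + ĥ₁, k̂)`, and likewise for `(1 + k̂b, ĥ₂)`,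
  -- with determinant `p` by the Wronskian relation; Cramer's rule eliminates the auxiliary `ĥ`.
  constructor
  · intro z hz
    have a := D₁.1 z hz
    have b := D₂.1 z hz
    have w := wX z hz
    linear_combination (-laplace k z) * w + g₁ z * b - g₂ z * a
  · intro z hz
    have a := D₁.2 z hz
    have b := D₂.2 z hz
    have w := wY z hz
    linear_combination (-(1 + laplace kb z)) * w + G₁ z * b + (z * G₂ z) * a

end

section

/-! Integrable functions as elements of `L¹`, and exponential curves in `L¹`. -/

/-- The exponential is 1-Lipschitz on the closed left half-plane, and applying the mean value
inequality once more along the segment makes the first-order remainder quadratic. Since the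
imaginary axis is included, differentiation in the spectral parameter works up to the real axis. -/
theorem norm_exp_sub_exp_sub_le {z w : ℂ} (hz : z.re ≤ 0) (hw : w.re ≤ 0) :
    ‖Complex.exp z - Complex.exp w - (z - w) * Complex.exp w‖ ≤ ‖z - w‖ ^ 2 := by
  have hconv : Convex ℝ {z : ℂ | z.re ≤ 0} := convex_halfSpace_re_le 0
  have h1 : ∀ y ∈ {z : ℂ | z.re ≤ 0}, ‖Complex.exp y - Complex.exp w‖ ≤ ‖y - w‖ := by
    intro y hy
    have := hconv.norm_image_sub_le_of_norm_hasDerivWithin_le (f := Complex.exp)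
      (f' := Complex.exp) (C := 1) (fun x _ => (Complex.hasDerivAt_exp x).hasDerivWithinAt)
      (fun x hx => by rw [Complex.norm_exp, Real.exp_le_one_iff]; exact hx) hw hy
    simpa using this
  have hseg : ∀ y ∈ segment ℝ w z, ‖y - w‖ ≤ ‖z - w‖ := by
    intro y hy
    obtain ⟨a, b, ha, hb, hab, rfl⟩ := hy
    have : a • w + b • z - w = b • (z - w) := by
      have : a = 1 - b := by linarith
      subst this
      simp only [Complex.real_smul]; push_cast; ring
    rw [this, norm_smul, Real.norm_of_nonneg hb]
    exact mul_le_of_le_one_left (norm_nonneg _) (by linarith)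
  have h2 := (convex_segment (𝕜 := ℝ) w z).norm_image_sub_le_of_norm_hasDerivWithin_le
    (f := fun y => Complex.exp y - Complex.exp w - (y - w) * Complex.exp w)
    (f' := fun y => Complex.exp y - Complex.exp w) (C := ‖z - w‖) (x := w) (y := z)
    (fun x _ => by
      have := (((Complex.hasDerivAt_exp x).sub_const (Complex.exp w)).fun_sub
        (((hasDerivAt_id x).sub_const w).mul_const (Complex.exp w))).hasDerivWithinAt
        (s := segment ℝ w z)
      simpa using this)
    (fun x hx => (h1 x (hconv.segment_subset hw hz hx)).trans (hseg x hx))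
    (left_mem_segment ℝ w z) (right_mem_segment ℝ w z)
  simpa [sq] using h2

section L1

variable {X : Type*} [MeasurableSpace X] {μ : Measure X}

open Classical in
/-- The element of `L¹` given by an integrable function, and `0` for other functions. -/
def toL1 (μ : Measure X) (f : X → ℂ) : Lp ℂ 1 μ :=
  if h : Integrable f μ then h.toL1 f else 0

theorem toL1_eq {f : X → ℂ} (h : Integrable f μ) : toL1 μ f = h.toL1 f := dif_pos h

theorem coeFn_toL1 {f : X → ℂ} (h : Integrable f μ) : toL1 μ f =ᵐ[μ] f := by
  rw [toL1_eq h]; exact h.coeFn_toL1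

theorem norm_toL1 {f : X → ℂ} (h : Integrable f μ) : ‖toL1 μ f‖ = ∫ p, ‖f p‖ ∂μ := by
  rw [L1.norm_eq_integral_norm]
  refine integral_congr_ae ?_
  filter_upwards [coeFn_toL1 h] with p hp
  rw [hp]

theorem toL1_sub_sub_smul {f g h : X → ℂ} (hf : Integrable f μ) (hg : Integrable g μ)
    (hh : Integrable h μ) (a : ℂ) :
    toL1 μ f - toL1 μ g - a • toL1 μ h = toL1 μ (fun p => f p - g p - a * h p) := by
  have hi : Integrable (fun p => f p - g p - a * h p) μ := (hf.sub hg).sub (hh.const_mul a)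
  apply Lp.ext
  filter_upwards [coeFn_toL1 hf, coeFn_toL1 hg, coeFn_toL1 hh, coeFn_toL1 hi,
    Lp.coeFn_sub (toL1 μ f - toL1 μ g) (a • toL1 μ h), Lp.coeFn_sub (toL1 μ f) (toL1 μ g),
    Lp.coeFn_smul a (toL1 μ h)] with p h1 h2 h3 h4 h5 h6 h7
  rw [h5, Pi.sub_apply, h6, Pi.sub_apply, h7, Pi.smul_apply, h1, h2, h3, h4, smul_eq_mul]

/-- The function `c(p) e^{izθ(p)}`. -/
def expKer (c : X → ℂ) (θ : X → ℝ) (z : ℂ) (p : X) : ℂ := c p * Complex.exp (Complex.I * z * θ p)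

theorem norm_exp_le_one_of_im_mul {z : ℂ} {t : ℝ} (h : 0 ≤ z.im * t) :
    ‖Complex.exp (Complex.I * z * t)‖ ≤ 1 := by
  rw [Complex.norm_exp, Real.exp_le_one_iff]
  simpa using h

theorem norm_expKer_le {c : X → ℂ} {θ : X → ℝ} {z : ℂ} {p : X}
    (h : c p ≠ 0 → 0 ≤ z.im * θ p) : ‖expKer c θ z p‖ ≤ ‖c p‖ := by
  by_cases hc : c p = 0
  · simp [expKer, hc]
  · rw [expKer, norm_mul]
    exact mul_le_of_le_one_right (norm_nonneg _) (norm_exp_le_one_of_im_mul (h hc))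

theorem integrable_expKer {c : X → ℂ} {θ : X → ℝ} {z : ℂ} (hθ : Measurable θ)
    (h : ∀ p, c p ≠ 0 → 0 ≤ z.im * θ p) (hc : Integrable c μ) : Integrable (expKer c θ z) μ := by
  refine hc.norm.mono' (hc.aestronglyMeasurable.mul ?_) (ae_of_all _ fun p => norm_expKer_le (h p))
  apply Measurable.aestronglyMeasurable
  fun_prop

theorem norm_toL1_expKer_le {c : X → ℂ} {θ : X → ℝ} {z : ℂ} (hθ : Measurable θ)
    (h : ∀ p, c p ≠ 0 → 0 ≤ z.im * θ p) (hc : Integrable c μ) :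
    ‖toL1 μ (expKer c θ z)‖ ≤ ∫ p, ‖c p‖ ∂μ := by
  rw [norm_toL1 (integrable_expKer hθ h hc)]
  exact integral_mono (integrable_expKer hθ h hc).norm hc.norm fun p => norm_expKer_le (h p)

/-- The kernel obtained by differentiating `c e^{izθ}` in `z`. -/
def kerDeriv (θ : X → ℝ) (c : X → ℂ) (p : X) : ℂ := Complex.I * θ p * c p

/-- The remainder is bounded pointwise by `‖θ² c‖ ‖w - z‖²`, so two integrable moments of the kernel
give differentiability in `L¹`, one-sided at boundary points of `Λ`. -/
theorem hasDerivWithinAt_expKer {c : X → ℂ} {θ : X → ℝ} {Λ : Set ℂ} (hθ : Measurable θ)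
    (h : ∀ p, c p ≠ 0 → ∀ z ∈ Λ, 0 ≤ z.im * θ p) (hc : Integrable c μ)
    (hc1 : Integrable (kerDeriv θ c) μ) (hc2 : Integrable (kerDeriv θ (kerDeriv θ c)) μ)
    {z : ℂ} (hz : z ∈ Λ) :
    HasDerivWithinAt (fun z => toL1 μ (expKer c θ z)) (toL1 μ (expKer (kerDeriv θ c) θ z)) Λ z := by
  rw [hasDerivWithinAt_iff_isLittleO]
  have hk : ∀ p, kerDeriv θ c p ≠ 0 → ∀ z ∈ Λ, 0 ≤ z.im * θ p := fun p hp =>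
    h p fun h0 => hp (by simp [kerDeriv, h0])
  have key : ∀ w ∈ Λ, ‖toL1 μ (expKer c θ w) - toL1 μ (expKer c θ z) -
      (w - z) • toL1 μ (expKer (kerDeriv θ c) θ z)‖ ≤
        (∫ p, ‖kerDeriv θ (kerDeriv θ c) p‖ ∂μ) * ‖w - z‖ ^ 2 := by
    intro w hw
    have i1 := integrable_expKer hθ (fun p hp => h p hp w hw) hc
    have i2 := integrable_expKer hθ (fun p hp => h p hp z hz) hc
    have i3 := integrable_expKer hθ (fun p hp => hk p hp z hz) hc1
    have i4 : Integrable (fun p => expKer c θ w p - expKer c θ z p -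
        (w - z) * expKer (kerDeriv θ c) θ z p) μ := (i1.sub i2).sub (i3.const_mul _)
    rw [toL1_sub_sub_smul i1 i2 i3, norm_toL1 i4, ← integral_mul_const]
    refine integral_mono i4.norm (hc2.norm.mul_const _) fun p => ?_
    by_cases hp : c p = 0
    · simp [expKer, kerDeriv, hp]
    · have e : expKer c θ w p - expKer c θ z p - (w - z) * expKer (kerDeriv θ c) θ z p =
          c p * (Complex.exp (Complex.I * w * θ p) - Complex.exp (Complex.I * z * θ p) -
            (Complex.I * w * θ p - Complex.I * z * θ p) * Complex.exp (Complex.I * z * θ p)) := by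
        simp only [expKer, kerDeriv]; ring
      simp only []
      rw [e, norm_mul]
      have h1 := norm_exp_sub_exp_sub_le (z := Complex.I * w * θ p) (w := Complex.I * z * θ p)
        (by simpa using h p hp w hw) (by simpa using h p hp z hz)
      calc _ ≤ ‖c p‖ * ‖Complex.I * w * θ p - Complex.I * z * θ p‖ ^ 2 := by gcongr
        _ = ‖kerDeriv θ (kerDeriv θ c) p‖ * ‖w - z‖ ^ 2 := by
          have : Complex.I * w * θ p - Complex.I * z * θ p = Complex.I * θ p * (w - z) := by ring
          rw [this]
          simp only [kerDeriv, norm_mul]; ring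
  have h1 : (fun w => toL1 μ (expKer c θ w) - toL1 μ (expKer c θ z) -
      (w - z) • toL1 μ (expKer (kerDeriv θ c) θ z)) =O[𝓝[Λ] z] fun w => (w - z) ^ 2 := by
    refine Asymptotics.IsBigO.of_bound (∫ p, ‖kerDeriv θ (kerDeriv θ c) p‖ ∂μ) ?_
    filter_upwards [self_mem_nhdsWithin] with w hw
    rw [norm_pow]
    exact key w hw
  refine h1.trans_isLittleO ?_
  have : Tendsto (fun w : ℂ => w - z) (𝓝[Λ] z) (𝓝 0) := by
    have : Tendsto (fun w : ℂ => w - z) (𝓝 z) (𝓝 (z - z)) := (continuous_sub_right z).tendsto z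
    rw [sub_self] at this
    exact this.mono_left nhdsWithin_le_nhds
  simpa [sq] using ((Asymptotics.isLittleO_one_iff ℂ).2 this).mul_isBigO
    (Asymptotics.isBigO_refl (fun w : ℂ => w - z) (𝓝[Λ] z))

end L1

/-! Bounded functions with bounded derivatives. -/

section BddSmooth

variable {F G H : Type*} [NormedAddCommGroup F] [NormedSpace ℝ F] [NormedAddCommGroup G]
  [NormedSpace ℝ G] [NormedAddCommGroup H] [NormedSpace ℝ H]

/-- `f` and its derivatives up to order `n` exist and are bounded. -/
def BddSmooth : ℕ → (ℝ → F) → Prop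
  | 0, f => ∃ C, ∀ x, ‖f x‖ ≤ C
  | n + 1, f => (∃ C, ∀ x, ‖f x‖ ≤ C) ∧ ∃ f', (∀ x, HasDerivAt f (f' x) x) ∧ BddSmooth n f'

theorem BddSmooth.bdd {n : ℕ} {f : ℝ → F} (h : BddSmooth n f) : ∃ C, ∀ x, ‖f x‖ ≤ C := by
  cases n with
  | zero => exact h
  | succ n => exact h.1

theorem BddSmooth.pred {n : ℕ} : ∀ {f : ℝ → F}, BddSmooth (n + 1) f → BddSmooth n f := by
  induction n with
  | zero => exact fun h => h.1
  | succ n ih =>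
    rintro f ⟨hb, f', hf', h⟩
    exact ⟨hb, f', hf', ih h⟩

theorem BddSmooth.clm (L : F →L[ℝ] G) {n : ℕ} :
    ∀ {f : ℝ → F}, BddSmooth n f → BddSmooth n (fun x => L (f x)) := by
  have hb : ∀ {f : ℝ → F}, (∃ C, ∀ x, ‖f x‖ ≤ C) → ∃ C, ∀ x, ‖L (f x)‖ ≤ C := by
    rintro f ⟨C, hC⟩
    exact ⟨‖L‖ * C, fun x => (L.le_opNorm _).trans (by gcongr; exact hC x)⟩
  induction n with
  | zero => exact fun h => hb h
  | succ n ih =>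
    rintro f ⟨h0, f', hf', h⟩
    exact ⟨hb h0, _, fun x => L.hasFDerivAt.comp_hasDerivAt x (hf' x), ih h⟩

theorem BddSmooth.add {n : ℕ} :
    ∀ {f g : ℝ → F}, BddSmooth n f → BddSmooth n g → BddSmooth n (fun x => f x + g x) := by
  have hb : ∀ {f g : ℝ → F}, (∃ C, ∀ x, ‖f x‖ ≤ C) → (∃ C, ∀ x, ‖g x‖ ≤ C) →
      ∃ C, ∀ x, ‖f x + g x‖ ≤ C := by
    rintro f g ⟨C, hC⟩ ⟨D, hD⟩
    exact ⟨C + D, fun x => norm_add_le_of_le (hC x) (hD x)⟩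
  induction n with
  | zero => exact fun hf hg => hb hf hg
  | succ n ih =>
    rintro f g ⟨hf0, f', hf', hf⟩ ⟨hg0, g', hg', hg⟩
    exact ⟨hb hf0 hg0, _, fun x => (hf' x).add (hg' x), ih hf hg⟩

theorem BddSmooth.const (c : F) : ∀ {n : ℕ}, BddSmooth n (fun _ : ℝ => c)
  | 0 => ⟨‖c‖, fun _ => le_rfl⟩
  | _ + 1 => ⟨⟨‖c‖, fun _ => le_rfl⟩, fun _ => 0, fun x => hasDerivAt_const x c,
      BddSmooth.const 0⟩

theorem BddSmooth.bilin (L : F →L[ℝ] G →L[ℝ] H) {n : ℕ} :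
    ∀ {f : ℝ → F} {g : ℝ → G}, BddSmooth n f → BddSmooth n g →
      BddSmooth n (fun x => L (f x) (g x)) := by
  have hb : ∀ {f : ℝ → F} {g : ℝ → G}, (∃ C, ∀ x, ‖f x‖ ≤ C) → (∃ C, ∀ x, ‖g x‖ ≤ C) →
      ∃ C, ∀ x, ‖L (f x) (g x)‖ ≤ C := by
    rintro f g ⟨C, hC⟩ ⟨D, hD⟩
    refine ⟨‖L‖ * C * D, fun x => (L.le_opNorm₂ _ _).trans ?_⟩
    have : 0 ≤ C := (norm_nonneg _).trans (hC x)
    gcongr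
    exacts [hC x, hD x]
  induction n with
  | zero => exact fun hf hg => hb hf hg
  | succ n ih =>
    rintro f g ⟨hf0, f', hf', hf⟩ ⟨hg0, g', hg', hg⟩
    refine ⟨hb hf0 hg0, _, fun x => L.hasDerivAt_of_bilinear (fun _ => hf' x) (fun _ => hg' x), ?_⟩
    exact (ih (BddSmooth.pred (show BddSmooth (n + 1) f from ⟨hf0, f', hf', hf⟩)) hg).add
      (ih hf (BddSmooth.pred (show BddSmooth (n + 1) g from ⟨hg0, g', hg', hg⟩)))

theorem BddSmooth.mul {R : Type*} [NormedRing R] [NormedAlgebra ℝ R] {n : ℕ} {f g : ℝ → R}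
    (hf : BddSmooth n f) (hg : BddSmooth n g) : BddSmooth n (fun x => f x * g x) :=
  BddSmooth.bilin (ContinuousLinearMap.mul ℝ R) hf hg

/-- Bootstrapping: `n` bounded derivatives of `f` give `n` bounded derivatives of `f q f = f'`,
hence `n + 1` of `f`. Resolvents and reciprocals satisfy such an equation, so only a bound for `f`
itself is ever needed. -/
theorem BddSmooth.of_riccati {R : Type*} [NormedRing R] [NormedAlgebra ℝ R] {f q : ℝ → R}
    (hf0 : ∃ C, ∀ x, ‖f x‖ ≤ C) (hf : ∀ x, HasDerivAt f (f x * q x * f x) x)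
    (hq : ∀ n, BddSmooth n q) : ∀ n, BddSmooth n f
  | 0 => hf0
  | n + 1 =>
    have ih := BddSmooth.of_riccati hf0 hf hq n
    ⟨hf0, _, hf, (ih.mul (hq n)).mul ih⟩

theorem BddSmooth.hasDerivAt_bdd {f f' : ℝ → F} (hf : ∀ n, BddSmooth n f)
    (h : ∀ x, HasDerivAt f (f' x) x) : ∀ n, BddSmooth n f' := by
  intro n
  obtain ⟨-, g, hg, hgn⟩ := hf (n + 1)
  have : f' = g := funext fun x => (h x).unique (hg x)
  rwa [this]

end BddSmooth

/-- Every differentiation multiplies the kernel by `iθ` and keeps the exponential, so integrability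
of all moments bounds all derivatives. -/
theorem bddSmooth_expKer {X : Type*} [MeasurableSpace X] {μ : Measure X} {θ : X → ℝ} {Λ : Set ℂ}
    (hθ : Measurable θ) (hΛ : ∀ l : ℝ, (l : ℂ) ∈ Λ) (n : ℕ) :
    ∀ {c : X → ℂ}, (∀ p, c p ≠ 0 → ∀ z ∈ Λ, 0 ≤ z.im * θ p) →
    (∀ k, Integrable ((kerDeriv θ)^[k] c) μ) →
    BddSmooth n (fun l : ℝ => toL1 μ (expKer c θ l)) := by
  have hb : ∀ {c : X → ℂ}, (∀ p, c p ≠ 0 → ∀ z ∈ Λ, 0 ≤ z.im * θ p) →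
      (∀ k, Integrable ((kerDeriv θ)^[k] c) μ) →
      ∃ C, ∀ l : ℝ, ‖toL1 μ (expKer c θ l)‖ ≤ C := fun h hi =>
    ⟨_, fun l => norm_toL1_expKer_le hθ (fun p hp => h p hp l (hΛ l)) (hi 0)⟩
  induction n with
  | zero => exact fun h hi => hb h hi
  | succ n ih =>
    intro c h hi
    refine ⟨hb h hi, fun l : ℝ => toL1 μ (expKer (kerDeriv θ c) θ l), fun l => ?_, ?_⟩
    · have h1 := hasDerivWithinAt_expKer hθ h (hi 0) (hi 1) (hi 2) (hΛ l)
      have h2 := h1.scomp_hasDerivAt l (Complex.ofRealCLM.hasDerivAt (x := l))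
        (fun y => hΛ y)
      simpa [Function.comp_def] using h2
    · refine ih (fun p hp => h p fun h0 => hp (by simp [kerDeriv, h0])) fun k => ?_
      exact hi (k + 1)

end

section

/-! Operators on bounded continuous functions with kernels in `L¹`. -/

section Operators

open scoped BoundedContinuousFunction

theorem hasDerivAt_integral_Iic_of_integrableOn {V : Type*} [NormedAddCommGroup V]
    [NormedSpace ℝ V] [CompleteSpace V] {g : ℝ → V} (hg : ∀ b, IntegrableOn g (Iic b))
    (hc : Continuous g) (x : ℝ) : HasDerivAt (fun x => ∫ s in Iic x, g s) (g x) x := by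
  have h : (fun x => ∫ s in Iic x, g s) =
      fun x => (∫ s in Iic (0 : ℝ), g s) + ∫ s in (0 : ℝ)..x, g s := by
    funext x
    rw [← intervalIntegral.integral_Iic_sub_Iic (hg _) (hg _)]
    abel
  rw [h]
  exact (intervalIntegral.integral_hasDerivAt_right (hc.intervalIntegrable _ _)
    (hc.stronglyMeasurableAtFilter _ _) hc.continuousAt).const_add _

theorem hasDerivAt_integral_Iic {V : Type*} [NormedAddCommGroup V] [NormedSpace ℝ V]
    [CompleteSpace V] {g : ℝ → V} (hg : Integrable g) (hc : Continuous g) (x : ℝ) :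
    HasDerivAt (fun x => ∫ s in Iic x, g s) (g x) x :=
  hasDerivAt_integral_Iic_of_integrableOn (fun _ => hg.integrableOn) hc x

theorem continuous_integral_Iic {g : ℝ → ℂ} (hg : Integrable g) :
    Continuous (fun x => ∫ s in Iic x, g s) := by
  have h : (fun x => ∫ s in Iic x, g s) =
      fun x => (∫ s in Iic (0 : ℝ), g s) + ∫ s in (0 : ℝ)..x, g s := by
    funext x
    rw [← intervalIntegral.integral_Iic_sub_Iic hg.integrableOn hg.integrableOn]
    ring
  rw [h]
  exact continuous_const.add (intervalIntegral.continuous_primitive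
    (fun a b => hg.intervalIntegrable) 0)

theorem integral_fst_le {F : ℝ × ℝ → ℂ} (hF : Integrable F) (x : ℝ) :
    ∫ p in {p : ℝ × ℝ | p.1 ≤ x}, F p = ∫ s in Iic x, ∫ t, F (s, t) := by
  have h : {p : ℝ × ℝ | p.1 ≤ x} = Iic x ×ˢ univ := by ext p; simp
  rw [h, Measure.volume_eq_prod]
  have := setIntegral_prod (μ := (volume : Measure ℝ)) (ν := (volume : Measure ℝ))
    (s := Iic x) (t := univ) F hF.integrableOn
  simpa using this

theorem continuous_integral_fst_le {F : ℝ × ℝ → ℂ} (hF : Integrable F) :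
    Continuous (fun x => ∫ p in {p : ℝ × ℝ | p.1 ≤ x}, F p) := by
  simp_rw [integral_fst_le hF]
  exact continuous_integral_Iic hF.integral_prod_left

section Pairing

variable {X : Type*} [MeasurableSpace X] {μ : Measure X} {π : X → ℝ}

theorem integrable_mul_comp_bcf {f : X → ℂ} (hf : Integrable f μ) (A : ℝ →ᵇ ℂ)
    (hπ : Measurable π) : Integrable (fun p => f p * A (π p)) μ :=
  hf.mul_bdd (c := ‖A‖) (A.continuous.measurable.comp hπ).aestronglyMeasurable
    (ae_of_all _ fun p => A.norm_coe_le_norm (π p))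

theorem norm_integral_mul_comp_bcf_le {f : X → ℂ} (hf : Integrable f μ) (A : ℝ →ᵇ ℂ) (S : Set X) :
    ‖∫ p in S, f p * A (π p) ∂μ‖ ≤ (∫ p, ‖f p‖ ∂μ) * ‖A‖ := by
  rw [← integral_mul_const]
  calc _ ≤ ∫ p in S, ‖f p‖ * ‖A‖ ∂μ :=
        norm_integral_le_of_norm_le (hf.norm.mul_const _).integrableOn
          (ae_of_all _ fun p => by rw [norm_mul]; gcongr; exact A.norm_coe_le_norm _)
    _ ≤ _ := setIntegral_le_integral (hf.norm.mul_const _) (ae_of_all _ fun p => by positivity)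

/-- The pairing `∫ f(p) A(π p) dp` of an `L¹` function with a bounded continuous one. -/
def pairing (μ : Measure X) (π : X → ℝ) (hπ : Measurable π) : Lp ℂ 1 μ →L[ℂ] (ℝ →ᵇ ℂ) →L[ℂ] ℂ :=
  (LinearMap.mk₂ ℂ (fun (f : Lp ℂ 1 μ) (A : ℝ →ᵇ ℂ) => ∫ p, f p * A (π p) ∂μ)
    (fun f g A => by
      rw [← integral_add (integrable_mul_comp_bcf (L1.integrable_coeFn f) A hπ)
        (integrable_mul_comp_bcf (L1.integrable_coeFn g) A hπ)]
      refine integral_congr_ae ?_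
      filter_upwards [Lp.coeFn_add f g] with p hp
      rw [hp, Pi.add_apply, add_mul])
    (fun c f A => by
      rw [← integral_smul]
      refine integral_congr_ae ?_
      filter_upwards [Lp.coeFn_smul c f] with p hp
      rw [hp, Pi.smul_apply, smul_mul_assoc])
    (fun f A A' => by
      rw [← integral_add (integrable_mul_comp_bcf (L1.integrable_coeFn f) A hπ)
        (integrable_mul_comp_bcf (L1.integrable_coeFn f) A' hπ)]
      exact integral_congr_ae (ae_of_all _ fun p => by simp [mul_add]))
    (fun c f A => by
      rw [← integral_smul]
      exact integral_congr_ae (ae_of_all _ fun p => by simp; ring))).mkContinuous₂ 1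
    (fun f A => by
      have := norm_integral_mul_comp_bcf_le (π := π) (L1.integrable_coeFn f) A univ
      rw [← L1.norm_eq_integral_norm] at this
      simpa using this)

theorem pairing_toL1 {f : X → ℂ} (hf : Integrable f μ) (hπ : Measurable π) (A : ℝ →ᵇ ℂ) :
    pairing μ π hπ (toL1 μ f) A = ∫ p, f p * A (π p) ∂μ := by
  refine integral_congr_ae ?_
  filter_upwards [coeFn_toL1 hf] with p hp
  rw [hp]

end Pairing

/-- The operator `A ↦ ∫_{s ≤ x} f(s,t) A(t) ds dt` on bounded continuous functions. -/
def kernelOp : Lp ℂ 1 (volume : Measure (ℝ × ℝ)) →L[ℂ] (ℝ →ᵇ ℂ) →L[ℂ] (ℝ →ᵇ ℂ) :=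
  (LinearMap.mk₂ ℂ (fun (f : Lp ℂ 1 (volume : Measure (ℝ × ℝ))) (A : ℝ →ᵇ ℂ) =>
      BoundedContinuousFunction.ofNormedAddCommGroup
        (fun x => ∫ p in {p : ℝ × ℝ | p.1 ≤ x}, f p * A p.2)
        (continuous_integral_fst_le
          (integrable_mul_comp_bcf (L1.integrable_coeFn f) A measurable_snd))
        (‖f‖ * ‖A‖) (fun x => by
          have := norm_integral_mul_comp_bcf_le (π := Prod.snd) (L1.integrable_coeFn f) A
            {p : ℝ × ℝ | p.1 ≤ x}
          rwa [← L1.norm_eq_integral_norm] at this))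
    (fun f g A => by
      ext x
      simp only [BoundedContinuousFunction.coe_ofNormedAddCommGroup,
        BoundedContinuousFunction.coe_add, Pi.add_apply]
      rw [← integral_add
        (integrable_mul_comp_bcf (L1.integrable_coeFn f) A measurable_snd).integrableOn
        (integrable_mul_comp_bcf (L1.integrable_coeFn g) A measurable_snd).integrableOn]
      refine integral_congr_ae (ae_restrict_of_ae ?_)
      filter_upwards [Lp.coeFn_add f g] with p hp
      rw [hp, Pi.add_apply, add_mul])
    (fun c f A => by
      ext x
      simp only [BoundedContinuousFunction.coe_ofNormedAddCommGroup,
        BoundedContinuousFunction.coe_smul]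
      rw [← integral_smul]
      refine integral_congr_ae (ae_restrict_of_ae ?_)
      filter_upwards [Lp.coeFn_smul c f] with p hp
      rw [hp, Pi.smul_apply, smul_mul_assoc])
    (fun f A A' => by
      ext x
      simp only [BoundedContinuousFunction.coe_ofNormedAddCommGroup,
        BoundedContinuousFunction.coe_add, Pi.add_apply]
      rw [← integral_add
        (integrable_mul_comp_bcf (L1.integrable_coeFn f) A measurable_snd).integrableOn
        (integrable_mul_comp_bcf (L1.integrable_coeFn f) A' measurable_snd).integrableOn]
      exact integral_congr_ae (ae_of_all _ fun p => by simp [mul_add]))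
    (fun c f A => by
      ext x
      simp only [BoundedContinuousFunction.coe_ofNormedAddCommGroup,
        BoundedContinuousFunction.coe_smul]
      rw [← integral_smul]
      exact integral_congr_ae (ae_of_all _ fun p => by simp; ring))).mkContinuous₂ 1
    (fun f A => by
      simp only [LinearMap.mk₂_apply, one_mul]
      exact BoundedContinuousFunction.norm_ofNormedAddCommGroup_le _ (by positivity) _)

theorem kernelOp_toL1 {f : ℝ × ℝ → ℂ} (hf : Integrable f) (A : ℝ →ᵇ ℂ) (x : ℝ) :
    kernelOp (toL1 volume f) A x = ∫ p in {p : ℝ × ℝ | p.1 ≤ x}, f p * A p.2 := by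
  refine integral_congr_ae (ae_restrict_of_ae ?_)
  filter_upwards [coeFn_toL1 hf] with p hp
  rw [hp]

end Operators

/-! Resolvents of operators with rapidly decreasing powers. -/

section Resolvent

variable {R : Type*} [NormedRing R] [CompleteSpace R]

/-- The Neumann series is dominated by the exponential series, so `q` need not be small and the
bound on the inverse depends on `K` alone. -/
theorem one_sub_inverse_of_norm_pow_le {q : R} {K : ℝ}
    (h : ∀ n : ℕ, ‖q ^ n‖ ≤ K ^ n / n.factorial) :
    Ring.inverse (1 - q) * (1 - q) = 1 ∧ (1 - q) * Ring.inverse (1 - q) = 1 ∧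
      ‖Ring.inverse (1 - q)‖ ≤ Real.exp K := by
  have hs0 : Summable fun n : ℕ => K ^ n / n.factorial := Real.summable_pow_div_factorial K
  have hs : Summable fun n : ℕ => q ^ n := Summable.of_norm_bounded hs0 h
  let U : Rˣ := ⟨1 - q, ∑' n : ℕ, q ^ n, hs.one_sub_mul_tsum_pow, hs.tsum_pow_mul_one_sub⟩
  have hU : Ring.inverse (1 - q) = ∑' n : ℕ, q ^ n := Ring.inverse_unit U
  rw [hU]
  refine ⟨hs.tsum_pow_mul_one_sub, hs.one_sub_mul_tsum_pow, ?_⟩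
  rw [Real.exp_eq_exp_ℝ, NormedSpace.exp_eq_tsum_div]
  exact tsum_of_norm_bounded hs0.hasSum h

/-- The derivative has the Riccati form `r q' r` on which the bootstrap for resolvents rests. -/
theorem hasDerivWithinAt_one_sub_inverse {𝕜 : Type*} [NontriviallyNormedField 𝕜]
    [NormedAlgebra 𝕜 R] {q : 𝕜 → R} {q' : R} {Λ : Set 𝕜} {z : 𝕜} {r : R}
    (hr : r * (1 - q z) = 1) (hr' : (1 - q z) * r = 1) (hq : HasDerivWithinAt q q' Λ z) :
    HasDerivWithinAt (fun z => Ring.inverse (1 - q z)) (r * q' * r) Λ z := by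
  let U : Rˣ := ⟨1 - q z, r, hr', hr⟩
  have h1 := (hasFDerivAt_ringInverse (𝕜 := 𝕜) U).comp_hasDerivWithinAt z (hq.const_sub 1)
  simpa [Function.comp_def, U, ContinuousLinearMap.mulLeftRight_apply] using h1

end Resolvent

end

section

open scoped BoundedContinuousFunction

/-! The Volterra operator of the system `A' = uB`, `B' = 2izB + vA`. -/

theorem tendsto_setIntegral_Iic {V : Type*} [NormedAddCommGroup V] [NormedSpace ℝ V]
    {g : ℝ → V} (hg : Integrable g) :
    Tendsto (fun x => ∫ s in Iic x, g s) atTop (𝓝 (∫ s, g s)) :=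
  (aecover_Iic tendsto_id).integral_tendsto_of_countably_generated hg

theorem integrable_one_add_abs_pow_mul (f : 𝓢(ℝ, ℂ)) (k : ℕ) :
    Integrable fun x : ℝ => (1 + |x|) ^ k * ‖f x‖ := by
  have h := ((f.integrable_pow_mul volume 0).add (f.integrable_pow_mul volume k)).const_mul
    ((2 : ℝ) ^ (k - 1))
  refine h.mono' (by have := f.continuous; fun_prop) (ae_of_all _ fun x => ?_)
  rw [Real.norm_of_nonneg (by positivity)]
  have := add_pow_le (zero_le_one (α := ℝ)) (abs_nonneg x) k
  simp only [Pi.add_apply, pow_zero, one_mul, Real.norm_eq_abs]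
  calc _ ≤ 2 ^ (k - 1) * (1 ^ k + |x| ^ k) * ‖f x‖ := by gcongr
    _ = _ := by ring

theorem kerDeriv_iterate {X : Type*} (θ : X → ℝ) (c : X → ℂ) (k : ℕ) (p : X) :
    (kerDeriv θ)^[k] c p = (Complex.I * θ p) ^ k * c p := by
  induction k generalizing c with
  | zero => simp
  | succ k ih => rw [Function.iterate_succ_apply, ih, kerDeriv]; ring

/-- The kernel `u(s) v(t)`, `t ≤ s`. -/
def aknsKer (u v : ℝ → ℂ) (p : ℝ × ℝ) : ℂ := if p.2 ≤ p.1 then u p.1 * v p.2 else 0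

/-- The phase `2(s - t)`. -/
def aknsPhase (p : ℝ × ℝ) : ℝ := 2 * (p.1 - p.2)

theorem measurable_aknsPhase : Measurable aknsPhase := by unfold aknsPhase; fun_prop

theorem aknsKer_phase {u v : ℝ → ℂ} (p : ℝ × ℝ) (hp : aknsKer u v p ≠ 0) (z : ℂ) (hz : z ∈ upper) :
    0 ≤ z.im * aknsPhase p := by
  have : p.2 ≤ p.1 := by
    by_contra h
    simp [aknsKer, h] at hp
  rw [mem_upper] at hz
  exact mul_nonneg hz (by unfold aknsPhase; linarith)

/-- The weight splits, `|2(s - t)| ≤ 2 (1 + |s|)(1 + |t|)`, so the moments are controlled by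
products of moments of the two Schwartz functions. -/
theorem integrable_aknsKer_iterate (u v : 𝓢(ℝ, ℂ)) (k : ℕ) :
    Integrable ((kerDeriv aknsPhase)^[k] (aknsKer u v)) := by
  have h := ((integrable_one_add_abs_pow_mul u k).mul_prod
    (integrable_one_add_abs_pow_mul v k)).const_mul ((2 : ℝ) ^ k)
  refine h.mono' ?_ (ae_of_all _ fun p => ?_)
  · have h1 : Measurable (aknsKer u v) := by
      unfold aknsKer
      have := u.continuous
      have := v.continuous
      refine Measurable.ite (measurableSet_le measurable_snd measurable_fst) ?_ measurable_const
      fun_prop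
    have h2 := measurable_aknsPhase
    have : (kerDeriv aknsPhase)^[k] (aknsKer u v) =
        fun p => (Complex.I * aknsPhase p) ^ k * aknsKer u v p := funext (kerDeriv_iterate _ _ k)
    rw [this]
    apply Measurable.aestronglyMeasurable
    fun_prop
  · rw [kerDeriv_iterate, norm_mul, norm_pow, norm_mul, Complex.norm_I, one_mul, Complex.norm_real]
    have h1 : ‖aknsPhase p‖ ≤ 2 * ((1 + |p.1|) * (1 + |p.2|)) := by
      unfold aknsPhase
      rw [norm_mul, Real.norm_of_nonneg zero_le_two, Real.norm_eq_abs]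
      have := abs_sub p.1 p.2
      nlinarith [abs_nonneg p.1, abs_nonneg p.2, mul_nonneg (abs_nonneg p.1) (abs_nonneg p.2)]
    have h2 : ‖aknsKer u v p‖ ≤ ‖u p.1‖ * ‖v p.2‖ := by
      unfold aknsKer
      split_ifs
      · rw [norm_mul]
      · simp only [norm_zero]; positivity
    calc _ ≤ (2 * ((1 + |p.1|) * (1 + |p.2|))) ^ k * (‖u p.1‖ * ‖v p.2‖) := by gcongr
      _ = _ := by rw [mul_pow, mul_pow]; ring

variable (u v : 𝓢(ℝ, ℂ))

/-- The Volterra operator `A ↦ ∫_{t ≤ s ≤ x} u(s) v(t) e^{2iz(s-t)} A(t) dt ds`. -/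
def aknsOp (z : ℂ) : (ℝ →ᵇ ℂ) →L[ℂ] (ℝ →ᵇ ℂ) :=
  kernelOp (toL1 volume (expKer (aknsKer u v) aknsPhase z))

theorem integrable_expKer_akns {z : ℂ} (hz : z ∈ upper) :
    Integrable (expKer (aknsKer u v) aknsPhase z) :=
  integrable_expKer measurable_aknsPhase (fun p hp => aknsKer_phase p hp z hz)
    (integrable_aknsKer_iterate u v 0)

theorem aknsOp_apply {z : ℂ} (hz : z ∈ upper) (A : ℝ →ᵇ ℂ) (x : ℝ) :
    aknsOp u v z A x =
      ∫ p in {p : ℝ × ℝ | p.1 ≤ x}, expKer (aknsKer u v) aknsPhase z p * A p.2 :=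
  kernelOp_toL1 (integrable_expKer_akns u v hz) A x

/-- With `U` the primitive of `‖u‖`, the integrand is `U' U^n`. The denominator `n + 1` is the
source of the factorial in the Volterra estimate. -/
theorem integral_Iic_norm_mul_pow (n : ℕ) (x : ℝ) :
    IntegrableOn (fun s => ‖u s‖ * (∫ r in Iic s, ‖u r‖) ^ n) (Iic x) ∧
    ∫ s in Iic x, ‖u s‖ * (∫ r in Iic s, ‖u r‖) ^ n =
      (∫ r in Iic x, ‖u r‖) ^ (n + 1) / (n + 1) := by
  have hi : Integrable fun s => ‖u s‖ := u.integrable.norm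
  have hd := hasDerivAt_integral_Iic hi u.continuous.norm
  have hcont : Continuous fun s => ∫ r in Iic s, ‖u r‖ :=
    continuous_iff_continuousAt.2 fun s => (hd s).continuousAt
  have hle : ∀ s, (∫ r in Iic s, ‖u r‖) ≤ ∫ r, ‖u r‖ := fun s =>
    setIntegral_le_integral hi (ae_of_all _ fun _ => norm_nonneg _)
  have h0 : ∀ s, 0 ≤ ∫ r in Iic s, ‖u r‖ := fun s => integral_nonneg fun _ => norm_nonneg _
  have hint : Integrable fun s => ‖u s‖ * (∫ r in Iic s, ‖u r‖) ^ n :=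
    hi.mul_bdd (c := (∫ r, ‖u r‖) ^ n) (hcont.pow n).aestronglyMeasurable
      (ae_of_all _ fun s => by
        rw [Real.norm_of_nonneg (pow_nonneg (h0 s) n)]
        exact pow_le_pow_left₀ (h0 s) (hle s) n)
  refine ⟨hint.integrableOn, ?_⟩
  have hd' : ∀ s ∈ Iic x, HasDerivAt (fun s => (∫ r in Iic s, ‖u r‖) ^ (n + 1) / (n + 1))
      (‖u s‖ * (∫ r in Iic s, ‖u r‖) ^ n) s := fun s _ => by
    refine (((hd s).fun_pow (n + 1)).div_const ((n : ℝ) + 1)).congr_deriv ?_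
    have : (n : ℝ) + 1 ≠ 0 := by positivity
    push_cast
    rw [mul_assoc, mul_div_cancel_left₀ _ this, mul_comm]
  have hlim : Tendsto (fun s => (∫ r in Iic s, ‖u r‖) ^ (n + 1) / ((n : ℝ) + 1)) atBot (𝓝 0) := by
    have := ((tendsto_integral_Iic_zero (f := fun s => ‖u s‖) (μ := volume)
      (l := atBot) tendsto_id).pow (n + 1)).div_const ((n : ℝ) + 1)
    simpa using this
  rw [integral_Iic_of_hasDerivAt_of_tendsto' hd' hint.integrableOn hlim, sub_zero]

/-- The phase has modulus at most one for `t ≤ s`, and there the primitive of `‖u‖` at `t` is at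
most its value at `s`. The integrals in `s` and `t` then decouple. -/
theorem norm_aknsOp_le {z : ℂ} (hz : z ∈ upper) (n : ℕ) {M : ℝ} {A : ℝ →ᵇ ℂ}
    (hA : ∀ t, ‖A t‖ ≤ M * (∫ r in Iic t, ‖u r‖) ^ n) (x : ℝ) :
    ‖aknsOp u v z A x‖ ≤ (M * (∫ t, ‖v t‖) / (n + 1)) * (∫ r in Iic x, ‖u r‖) ^ (n + 1) := by
  have hi : Integrable fun s => ‖u s‖ := u.integrable.norm
  have hset : {p : ℝ × ℝ | p.1 ≤ x} = Iic x ×ˢ univ := by ext p; simp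
  obtain ⟨h1, h2⟩ := integral_Iic_norm_mul_pow u n x
  have hM : 0 ≤ M * (∫ r in Iic x, ‖u r‖) ^ n := (norm_nonneg _).trans (hA x)
  have hint : IntegrableOn (fun p : ℝ × ℝ => (‖u p.1‖ * (∫ r in Iic p.1, ‖u r‖) ^ n) * (M * ‖v p.2‖))
      (Iic x ×ˢ univ) := by
    rw [IntegrableOn, Measure.volume_eq_prod, ← Measure.prod_restrict]
    exact h1.mul_prod (v.integrable.norm.const_mul M).integrableOn
  rw [aknsOp_apply u v hz, hset]
  refine (norm_integral_le_of_norm_le hint ?_).trans (le_of_eq ?_)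
  · refine ae_of_all _ fun p => ?_
    rw [norm_mul]
    by_cases hp : p.2 ≤ p.1
    · have ha : ‖expKer (aknsKer u v) aknsPhase z p‖ ≤ ‖u p.1‖ * ‖v p.2‖ := by
        refine (norm_expKer_le fun hp => aknsKer_phase p hp z hz).trans ?_
        rw [aknsKer, if_pos hp, norm_mul]
      have hmono : (∫ r in Iic p.2, ‖u r‖) ≤ ∫ r in Iic p.1, ‖u r‖ :=
        setIntegral_mono_set hi.integrableOn (ae_of_all _ fun _ => norm_nonneg _)
          (Eventually.of_forall (Iic_subset_Iic.2 hp))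
      have h0 : 0 ≤ ∫ r in Iic p.2, ‖u r‖ := integral_nonneg fun _ => norm_nonneg _
      rcases le_or_gt 0 M with hM0 | hM0
      · calc _ ≤ (‖u p.1‖ * ‖v p.2‖) * (M * (∫ r in Iic p.1, ‖u r‖) ^ n) := by
              gcongr
              exact (hA p.2).trans (by gcongr)
          _ = _ := by ring
      -- A negative `M` is compatible with the hypothesis only if all the bounds vanish, and then
      -- `A` vanishes as well.
      · have h0' : ∀ t, M * (∫ r in Iic t, ‖u r‖) ^ n = 0 := fun t => le_antisymm
          (mul_nonpos_of_nonpos_of_nonneg hM0.le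
            (pow_nonneg (integral_nonneg fun _ => norm_nonneg _) n)) ((norm_nonneg _).trans (hA t))
        have hA0 : ‖A p.2‖ = 0 := le_antisymm ((hA _).trans_eq (h0' _)) (norm_nonneg _)
        rw [hA0, mul_zero]
        calc (0 : ℝ) = ‖u p.1‖ * ‖v p.2‖ * (M * (∫ r in Iic p.1, ‖u r‖) ^ n) := by
              rw [h0' p.1, mul_zero]
          _ ≤ _ := by apply le_of_eq; ring
    · have : aknsKer u v p = 0 := by simp [aknsKer, hp]
      rw [expKer, this, zero_mul, norm_zero, zero_mul]
      have h0' : 0 ≤ M * (∫ r in Iic p.1, ‖u r‖) ^ n := (norm_nonneg _).trans (hA p.1)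
      calc (0 : ℝ) ≤ (M * (∫ r in Iic p.1, ‖u r‖) ^ n) * (‖u p.1‖ * ‖v p.2‖) := by positivity
        _ = _ := by ring
  · rw [Measure.volume_eq_prod]
    have := setIntegral_prod_mul (μ := (volume : Measure ℝ)) (ν := (volume : Measure ℝ))
      (fun s => ‖u s‖ * (∫ r in Iic s, ‖u r‖) ^ n) (fun t => M * ‖v t‖) (Iic x) univ
    rw [this, h2, setIntegral_univ, integral_const_mul]
    ring

/-- Iterating the one-step estimate multiplies by `‖v‖₁ / (n + 1)` and raises the power of the
primitive of `‖u‖` by one. The bound does not depend on `z`, which makes the resolvent uniformly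
bounded on the closed half-plane. -/
theorem norm_aknsOp_pow_le {z : ℂ} (hz : z ∈ upper) (n : ℕ) :
    ‖aknsOp u v z ^ n‖ ≤ ((∫ t, ‖u t‖) * ∫ t, ‖v t‖) ^ n / n.factorial := by
  have hu0 : 0 ≤ ∫ t, ‖u t‖ := integral_nonneg fun _ => norm_nonneg _
  have hv0 : 0 ≤ ∫ t, ‖v t‖ := integral_nonneg fun _ => norm_nonneg _
  have key : ∀ A : ℝ →ᵇ ℂ, ∀ x, ‖(aknsOp u v z ^ n) A x‖ ≤
      (‖A‖ * (∫ t, ‖v t‖) ^ n / n.factorial) * (∫ r in Iic x, ‖u r‖) ^ n := by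
    intro A
    induction n with
    | zero => intro x; simpa using A.norm_coe_le_norm x
    | succ n ih =>
      intro x
      rw [pow_succ', mul_apply_eq_comp]
      refine (norm_aknsOp_le u v hz n ih x).trans (le_of_eq ?_)
      rw [Nat.factorial_succ]
      have : (n.factorial : ℝ) ≠ 0 := by positivity
      have : (n : ℝ) + 1 ≠ 0 := by positivity
      push_cast
      rw [pow_succ (∫ t, ‖v t‖) n]
      field_simp
  refine ContinuousLinearMap.opNorm_le_bound _ (by positivity) fun A => ?_
  refine (BoundedContinuousFunction.norm_le (by positivity)).2 fun x => (key A x).trans ?_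
  have hle : (∫ r in Iic x, ‖u r‖) ≤ ∫ r, ‖u r‖ :=
    setIntegral_le_integral u.integrable.norm (ae_of_all _ fun _ => norm_nonneg _)
  have h0 : 0 ≤ ∫ r in Iic x, ‖u r‖ := integral_nonneg fun _ => norm_nonneg _
  calc _ ≤ (‖A‖ * (∫ t, ‖v t‖) ^ n / n.factorial) * (∫ r, ‖u r‖) ^ n := by gcongr
    _ = _ := by rw [mul_pow]; ring

end

/-! ### The resolvent of the Volterra operator -/

section

open scoped BoundedContinuousFunction

variable (u v : 𝓢(ℝ, ℂ))

/-- The resolvent of the Volterra operator at `1`. -/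
def aknsRes (z : ℂ) : (ℝ →ᵇ ℂ) →L[ℂ] (ℝ →ᵇ ℂ) := Ring.inverse (1 - aknsOp u v z)

theorem aknsRes_spec {z : ℂ} (hz : z ∈ upper) :
    aknsRes u v z * (1 - aknsOp u v z) = 1 ∧ (1 - aknsOp u v z) * aknsRes u v z = 1 ∧
      ‖aknsRes u v z‖ ≤ Real.exp ((∫ t, ‖u t‖) * ∫ t, ‖v t‖) :=
  one_sub_inverse_of_norm_pow_le (R := (ℝ →ᵇ ℂ) →L[ℂ] (ℝ →ᵇ ℂ)) (norm_aknsOp_pow_le u v hz)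

/-- The derivative of the Volterra operator in the spectral parameter. -/
def aknsOpDeriv (z : ℂ) : (ℝ →ᵇ ℂ) →L[ℂ] (ℝ →ᵇ ℂ) :=
  kernelOp (toL1 volume (expKer (kerDeriv aknsPhase (aknsKer u v)) aknsPhase z))

theorem HasDerivWithinAt.clm_image {F G : Type*} [NormedAddCommGroup F] [NormedSpace ℂ F]
    [NormedAddCommGroup G] [NormedSpace ℂ G] (L : F →L[ℂ] G) {f : ℂ → F} {f' : F} {s : Set ℂ}
    {z : ℂ} (h : HasDerivWithinAt f f' s z) :
    HasDerivWithinAt (fun z => L (f z)) (L f') s z :=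
  L.hasFDerivAt.comp_hasDerivWithinAt z h

theorem hasDerivWithinAt_aknsOp {z : ℂ} (hz : z ∈ upper) :
    HasDerivWithinAt (aknsOp u v) (aknsOpDeriv u v z) upper z := by
  have h := hasDerivWithinAt_expKer measurable_aknsPhase
    (fun p (hp : aknsKer u v p ≠ 0) => aknsKer_phase p hp)
    (integrable_aknsKer_iterate u v 0) (integrable_aknsKer_iterate u v 1)
    (integrable_aknsKer_iterate u v 2) hz
  exact HasDerivWithinAt.clm_image (G := (ℝ →ᵇ ℂ) →L[ℂ] (ℝ →ᵇ ℂ)) kernelOp h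

theorem hasDerivWithinAt_aknsRes {z : ℂ} (hz : z ∈ upper) :
    HasDerivWithinAt (aknsRes u v) (aknsRes u v z * aknsOpDeriv u v z * aknsRes u v z) upper z :=
  hasDerivWithinAt_one_sub_inverse (R := (ℝ →ᵇ ℂ) →L[ℂ] (ℝ →ᵇ ℂ)) (aknsRes_spec u v hz).1 (aknsRes_spec u v hz).2.1
    (hasDerivWithinAt_aknsOp u v hz)

theorem HasDerivWithinAt.comp_ofReal_upper {V : Type*} [NormedAddCommGroup V] [NormedSpace ℂ V]
    {f : ℂ → V} {f' : V} {l : ℝ} (h : HasDerivWithinAt f f' upper l) :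
    HasDerivAt (fun l : ℝ => f l) f' l := by
  have h2 := h.scomp_hasDerivAt l (Complex.ofRealCLM.hasDerivAt (x := l))
    (fun y => ofReal_mem_upper y)
  simpa [Function.comp_def] using h2

/-- The resolvent is uniformly bounded and satisfies a Riccati equation whose coefficient is the
derivative of the operator, a curve with all derivatives bounded. -/
theorem bddSmooth_aknsRes : ∀ n, BddSmooth n fun l : ℝ => aknsRes u v l := by
  refine BddSmooth.of_riccati (q := fun l : ℝ => aknsOpDeriv u v l)
    ⟨_, fun l => (aknsRes_spec u v (ofReal_mem_upper l)).2.2⟩ (fun l => ?_) ?_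
  · exact HasDerivWithinAt.comp_ofReal_upper (hasDerivWithinAt_aknsRes u v (ofReal_mem_upper l))
  · intro n
    refine BddSmooth.clm (F := Lp ℂ 1 (volume : Measure (ℝ × ℝ)))
      (G := (ℝ →ᵇ ℂ) →L[ℂ] (ℝ →ᵇ ℂ)) (kernelOp.restrictScalars ℝ) ?_
    refine bddSmooth_expKer measurable_aknsPhase ofReal_mem_upper n (fun p hp z hz => ?_)
      fun k => integrable_aknsKer_iterate u v (k + 1)
    exact aknsKer_phase p (fun h0 : aknsKer u v p = 0 => hp (by simp [kerDeriv, h0])) z hz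

end

section

open scoped BoundedContinuousFunction

variable (u v : 𝓢(ℝ, ℂ))

/-! The normalized solution of `A' = uB`, `B' = 2izB + vA`. -/

/-- The first component of the solution with `A → 1`, `B → 0` at `-∞`. -/
def jostA (z : ℂ) : ℝ →ᵇ ℂ := aknsRes u v z 1

/-- The second component of the solution with `A → 1`, `B → 0` at `-∞`. -/
def jostB (z : ℂ) (x : ℝ) : ℂ :=
  ∫ t in Iic x, Complex.exp (Complex.I * z * (2 * (x - t) : ℝ)) * (v t * jostA u v z t)

/-- The limit of `A` at `+∞`. -/
def jostAlpha (z : ℂ) : ℂ := 1 + ∫ s, u s * jostB u v z s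

/-- The limit of `e^{-2ilx} B` at `+∞`. -/
def jostN (l : ℝ) : ℂ := ∫ t, Complex.exp (Complex.I * l * (-2 * t : ℝ)) * (v t * jostA u v l t)

theorem norm_jostA_le {z : ℂ} (hz : z ∈ upper) (x : ℝ) :
    ‖jostA u v z x‖ ≤ Real.exp ((∫ t, ‖u t‖) * ∫ t, ‖v t‖) := by
  refine ((jostA u v z).norm_coe_le_norm x).trans ?_
  refine ((aknsRes u v z).le_opNorm 1).trans ?_
  rw [norm_one, mul_one]
  exact (aknsRes_spec u v hz).2.2

theorem integrable_mul_jostA (w : 𝓢(ℝ, ℂ)) (z : ℂ) :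
    Integrable fun t => w t * jostA u v z t :=
  integrable_mul_comp_bcf w.integrable (jostA u v z) measurable_id

theorem norm_exp_phase_le {z : ℂ} (hz : z ∈ upper) {x t : ℝ} (h : t ≤ x) :
    ‖Complex.exp (Complex.I * z * (2 * (x - t) : ℝ))‖ ≤ 1 :=
  norm_exp_le_one_of_im_mul (mul_nonneg hz (by linarith))

theorem integrableOn_exp_phase_mul {z : ℂ} (hz : z ∈ upper) {x : ℝ} {g : ℝ → ℂ}
    (hg : Integrable g) :
    IntegrableOn (fun t => Complex.exp (Complex.I * z * (2 * (x - t) : ℝ)) * g t) (Iic x) := by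
  refine hg.integrableOn.bdd_mul (c := 1) (by
    apply Continuous.aestronglyMeasurable; fun_prop) ?_
  filter_upwards [ae_restrict_mem measurableSet_Iic] with t ht
  exact norm_exp_phase_le hz ht

theorem norm_integral_exp_phase_mul_le {z : ℂ} (hz : z ∈ upper) {x : ℝ} {g : ℝ → ℂ}
    (hg : Integrable g) :
    ‖∫ t in Iic x, Complex.exp (Complex.I * z * (2 * (x - t) : ℝ)) * g t‖ ≤
      ∫ t in Iic x, ‖g t‖ := by
  refine norm_integral_le_of_norm_le hg.norm.integrableOn ?_
  filter_upwards [ae_restrict_mem measurableSet_Iic] with t ht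
  rw [norm_mul]
  exact mul_le_of_le_one_left (norm_nonneg _) (norm_exp_phase_le hz ht)

theorem norm_jostB_le {z : ℂ} (hz : z ∈ upper) (x : ℝ) :
    ‖jostB u v z x‖ ≤ ∫ t in Iic x, ‖v t * jostA u v z t‖ :=
  norm_integral_exp_phase_mul_le hz (integrable_mul_jostA u v v z)

theorem exists_norm_jost_le :
    ∃ C, 0 ≤ C ∧ ∀ z ∈ upper, ∀ x, ‖jostA u v z x‖ ≤ C ∧ ‖jostB u v z x‖ ≤ C := by
  set M := Real.exp ((∫ t, ‖u t‖) * ∫ t, ‖v t‖)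
  have hv0 : 0 ≤ ∫ t, ‖v t‖ := integral_nonneg fun _ => norm_nonneg _
  refine ⟨M + (∫ t, ‖v t‖) * M, by positivity, fun z hz x => ⟨?_, ?_⟩⟩
  · exact (norm_jostA_le u v hz x).trans (le_add_of_nonneg_right (by positivity))
  · refine (norm_jostB_le u v hz x).trans ?_
    calc _ ≤ ∫ t, ‖v t * jostA u v z t‖ :=
          setIntegral_le_integral (integrable_mul_jostA u v v z).norm
            (ae_of_all _ fun _ => norm_nonneg _)
      _ ≤ ∫ t, ‖v t‖ * M := by
          refine integral_mono (integrable_mul_jostA u v v z).norm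
            (v.integrable.norm.mul_const M) fun t => ?_
          simp only [norm_mul]
          gcongr
          exact norm_jostA_le u v hz t
      _ ≤ _ := by rw [integral_mul_const]; exact le_add_of_nonneg_left (by positivity)

theorem hasDerivAt_jostB {z : ℂ} (hz : z ∈ upper) (x : ℝ) :
    HasDerivAt (jostB u v z) (2 * Complex.I * z * jostB u v z x + v x * jostA u v z x) x := by
  have hsplit : ∀ x t : ℝ, Complex.exp (Complex.I * z * (2 * (x - t) : ℝ)) =
      Complex.exp (2 * Complex.I * z * x) * Complex.exp (-(2 * Complex.I * z * t)) := by
    intro x t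
    rw [← Complex.exp_add]; congr 1; push_cast; ring
  -- Once the phase is split, `e^{-2izt}` may grow as `t → +∞`, so integrability is claimed on left
  -- half-lines only.
  have hint : ∀ b, IntegrableOn
      (fun t : ℝ => Complex.exp (-(2 * Complex.I * z * t)) * (v t * jostA u v z t)) (Iic b) := by
    intro b
    have h := (integrableOn_exp_phase_mul hz (x := b) (integrable_mul_jostA u v v z)).const_mul
      (Complex.exp (-(2 * Complex.I * z * b)))
    refine IntegrableOn.congr_fun (μ := volume) h (fun t _ => ?_) measurableSet_Iic
    change Complex.exp (-(2 * Complex.I * z * b)) * (Complex.exp _ * _) = _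
    have e : Complex.exp (-(2 * Complex.I * z * b)) * Complex.exp (2 * Complex.I * z * b) = 1 := by
      rw [← Complex.exp_add, neg_add_cancel, Complex.exp_zero]
    rw [hsplit]
    linear_combination (Complex.exp (-(2 * Complex.I * z * t)) * (v t * jostA u v z t)) * e
  have hc : Continuous
      fun t : ℝ => Complex.exp (-(2 * Complex.I * z * t)) * (v t * jostA u v z t) := by
    have := v.continuous
    have := (jostA u v z).continuous
    fun_prop
  have h1 := hasDerivAt_integral_Iic_of_integrableOn hint hc x
  have h2 : HasDerivAt (fun x : ℝ => Complex.exp (2 * Complex.I * z * x))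
      (Complex.exp (2 * Complex.I * z * x) * (2 * Complex.I * z)) x := by
    have := ((hasDerivAt_id (x : ℂ)).const_mul (2 * Complex.I * z)).cexp.comp_ofReal
    simpa using this
  have heq : jostB u v z = fun x : ℝ => Complex.exp (2 * Complex.I * z * x) *
      ∫ t in Iic x, Complex.exp (-(2 * Complex.I * z * t)) * (v t * jostA u v z t) := by
    funext x
    rw [jostB, ← integral_const_mul]
    exact integral_congr_ae (ae_of_all _ fun t => by simp only [hsplit]; ring)
  rw [congrFun heq x, heq]
  refine (h2.mul h1).congr_deriv ?_
  have e : Complex.exp (2 * Complex.I * z * x) * Complex.exp (-(2 * Complex.I * z * x)) = 1 := by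
    rw [← Complex.exp_add]; simp
  linear_combination (v x * jostA u v z x) * e

theorem continuous_jostB {z : ℂ} (hz : z ∈ upper) : Continuous (jostB u v z) :=
  continuous_iff_continuousAt.2 fun x => (hasDerivAt_jostB u v hz x).continuousAt

theorem integrable_mul_jostB (w : 𝓢(ℝ, ℂ)) {z : ℂ} (hz : z ∈ upper) :
    Integrable fun s => w s * jostB u v z s := by
  obtain ⟨C, -, hC⟩ := exists_norm_jost_le u v
  exact w.integrable.mul_bdd (continuous_jostB u v hz).aestronglyMeasurable
    (ae_of_all _ fun x => (hC z hz x).2)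

theorem integral_expKer_mul_jostA (z : ℂ) (s : ℝ) :
    ∫ t, expKer (aknsKer u v) aknsPhase z (s, t) * jostA u v z t = u s * jostB u v z s := by
  rw [jostB, ← integral_const_mul, ← integral_indicator measurableSet_Iic]
  refine integral_congr_ae (ae_of_all _ fun t => ?_)
  by_cases h : t ≤ s
  · simp only [expKer, aknsKer, h, if_true, aknsPhase]
    rw [indicator_of_mem (show t ∈ Iic s from h)]
    ring
  · simp only [expKer, aknsKer, h, if_false]
    rw [indicator_of_notMem (show t ∉ Iic s from h)]
    ring

/-- This is the identity `(1 - V) A = 1` for the Volterra operator `V`, read pointwise, with the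
inner integral of the kernel recognized as `uB`. -/
theorem jostA_eq {z : ℂ} (hz : z ∈ upper) (x : ℝ) :
    jostA u v z x = 1 + ∫ s in Iic x, u s * jostB u v z s := by
  have h1 : jostA u v z - aknsOp u v z (jostA u v z) = 1 := by
    have := congrArg (fun L : (ℝ →ᵇ ℂ) →L[ℂ] (ℝ →ᵇ ℂ) => L 1) (aknsRes_spec u v hz).2.1
    simpa [mul_apply_eq_comp, jostA] using this
  have h2 := congrArg (fun A : ℝ →ᵇ ℂ => A x) h1
  simp only [BoundedContinuousFunction.coe_sub, Pi.sub_apply, BoundedContinuousFunction.coe_one,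
    Pi.one_apply] at h2
  rw [aknsOp_apply u v hz, integral_fst_le (integrable_mul_comp_bcf
    (integrable_expKer_akns u v hz) (jostA u v z) measurable_snd)] at h2
  simp only [integral_expKer_mul_jostA] at h2
  rw [← h2]; ring

theorem hasDerivAt_jostA {z : ℂ} (hz : z ∈ upper) (x : ℝ) :
    HasDerivAt (jostA u v z) (u x * jostB u v z x) x := by
  have : (jostA u v z : ℝ → ℂ) = fun x => 1 + ∫ s in Iic x, u s * jostB u v z s :=
    funext (jostA_eq u v hz)
  rw [this]
  exact (hasDerivAt_integral_Iic (integrable_mul_jostB u v u hz)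
    (u.continuous.mul (continuous_jostB u v hz)) x).const_add 1

theorem tendsto_jostA_atBot {z : ℂ} (hz : z ∈ upper) :
    Tendsto (jostA u v z) atBot (𝓝 1) := by
  have : (jostA u v z : ℝ → ℂ) = fun x => 1 + ∫ s in Iic x, u s * jostB u v z s :=
    funext (jostA_eq u v hz)
  rw [this]
  have := (tendsto_integral_Iic_zero (f := fun s => u s * jostB u v z s) (μ := volume)
      (l := atBot) tendsto_id).const_add 1
  simpa using this

theorem tendsto_jostA_atTop {z : ℂ} (hz : z ∈ upper) :
    Tendsto (jostA u v z) atTop (𝓝 (jostAlpha u v z)) := by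
  have : (jostA u v z : ℝ → ℂ) = fun x => 1 + ∫ s in Iic x, u s * jostB u v z s :=
    funext (jostA_eq u v hz)
  rw [this]
  exact (tendsto_setIntegral_Iic (integrable_mul_jostB u v u hz)).const_add 1

theorem tendsto_jostB_atBot {z : ℂ} (hz : z ∈ upper) :
    Tendsto (jostB u v z) atBot (𝓝 0) := by
  refine squeeze_zero_norm (norm_jostB_le u v hz) ?_
  exact tendsto_integral_Iic_zero (f := fun t => ‖v t * jostA u v z t‖) (μ := volume)
      (l := atBot) tendsto_id

theorem tendsto_exp_mul_jostB_atTop (l : ℝ) :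
    Tendsto (fun x : ℝ => Complex.exp (-(2 * Complex.I * l * x)) * jostB u v l x) atTop
      (𝓝 (jostN u v l)) := by
  have hint : Integrable
      fun t : ℝ => Complex.exp (Complex.I * l * (-2 * t : ℝ)) * (v t * jostA u v l t) := by
    refine (integrable_mul_jostA u v v l).bdd_mul (c := 1) (by
      apply Continuous.aestronglyMeasurable; fun_prop) (ae_of_all _ fun t => ?_)
    exact norm_exp_le_one_of_im_mul (by simp)
  refine (tendsto_setIntegral_Iic hint).congr fun x => ?_
  rw [jostB, ← integral_const_mul]
  refine integral_congr_ae (ae_of_all _ fun t => ?_)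
  have e : Complex.exp (Complex.I * l * (-2 * t : ℝ)) = Complex.exp (-(2 * Complex.I * l * x)) *
      Complex.exp (Complex.I * l * (2 * (x - t) : ℝ)) := by
    rw [← Complex.exp_add]; congr 1; push_cast; ring
  simp only [e]
  ring

end

section

open scoped BoundedContinuousFunction

variable (u v : 𝓢(ℝ, ℂ))

/-! Dependence of the normalized solution on the spectral parameter. -/

theorem differentiableOn_jostA_bcf : DifferentiableOn ℂ (jostA u v) upper := fun _ hz =>
  ((hasDerivWithinAt_aknsRes u v hz).clm_apply (hasDerivWithinAt_const _ _ 1)).differentiableWithinAt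

theorem differentiableOn_jostA (x : ℝ) : DifferentiableOn ℂ (fun z => jostA u v z x) upper :=
  fun z hz => (HasDerivWithinAt.clm_image (BoundedContinuousFunction.evalCLM ℂ x)
    (differentiableOn_jostA_bcf u v z hz).hasDerivWithinAt).differentiableWithinAt

/-- Both the kernel, as a curve in `L¹`, and `A`, as a curve of bounded continuous functions, are
differentiable within the closed half-plane, and the pairing is bilinear and continuous. -/
theorem differentiableOn_pairing {X : Type*} [MeasurableSpace X] {μ : Measure X} {π : X → ℝ}
    (hπ : Measurable π) {c : X → ℂ} {θ : X → ℝ} (hθ : Measurable θ)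
    (h : ∀ p, c p ≠ 0 → ∀ z ∈ upper, 0 ≤ z.im * θ p)
    (hc : ∀ k, Integrable ((kerDeriv θ)^[k] c) μ) :
    DifferentiableOn ℂ (fun z => ∫ p, expKer c θ z p * jostA u v z (π p) ∂μ) upper := by
  have h1 : DifferentiableOn ℂ
      (fun z => pairing μ π hπ (toL1 μ (expKer c θ z)) (jostA u v z)) upper := by
    intro z hz
    have h2 := hasDerivWithinAt_expKer hθ h (hc 0) (hc 1) (hc 2) hz
    have h3 := HasDerivWithinAt.clm_image (F := Lp ℂ 1 μ) (G := (ℝ →ᵇ ℂ) →L[ℂ] ℂ)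
      (pairing μ π hπ) h2
    exact (h3.clm_apply
      (differentiableOn_jostA_bcf u v z hz).hasDerivWithinAt).differentiableWithinAt
  refine h1.congr fun z hz => ?_
  rw [pairing_toL1 (integrable_expKer hθ (fun p hp => h p hp z hz) (hc 0))]

theorem jostAlpha_eq {z : ℂ} (hz : z ∈ upper) :
    jostAlpha u v z = 1 + ∫ p : ℝ × ℝ, expKer (aknsKer u v) aknsPhase z p * jostA u v z p.2 := by
  have hi := integrable_mul_comp_bcf
    (integrable_expKer_akns u v hz) (jostA u v z) measurable_snd
  rw [Measure.volume_eq_prod] at hi ⊢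
  rw [integral_prod _ hi]
  simp only [integral_expKer_mul_jostA]
  rfl

theorem differentiableOn_jostAlpha : DifferentiableOn ℂ (jostAlpha u v) upper := by
  have := differentiableOn_pairing u v (μ := volume) (π := Prod.snd) measurable_snd
    (c := aknsKer u v) measurable_aknsPhase (fun p hp => aknsKer_phase p hp)
    (integrable_aknsKer_iterate u v)
  exact (this.const_add 1).congr fun z hz => jostAlpha_eq u v hz

theorem differentiableOn_jostB (x : ℝ) : DifferentiableOn ℂ (fun z => jostB u v z x) upper := by
  have h := differentiableOn_pairing u v (μ := volume.restrict (Iic x)) (π := id) measurable_id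
    (c := fun t => if t ≤ x then v t else 0) (θ := fun t => 2 * (x - t)) (by fun_prop)
    (fun t ht z hz => by
      have : t ≤ x := by
        by_contra h
        simp [h] at ht
      exact mul_nonneg hz (by linarith))
    (fun k => by
      have hk : Integrable fun t => 2 ^ k * (1 + |x|) ^ k * ((1 + |t|) ^ k * ‖v t‖) :=
        (integrable_one_add_abs_pow_mul v k).const_mul _
      refine Integrable.mono' hk.integrableOn ?_ (ae_of_all _ fun t => ?_)
      · have : ((kerDeriv fun t => 2 * (x - t))^[k] fun t => if t ≤ x then v t else 0) =
            fun t : ℝ => (Complex.I * (2 * (x - t) : ℝ)) ^ k * (if t ≤ x then v t else 0) :=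
          funext (kerDeriv_iterate _ _ k)
        rw [this]
        have := v.continuous
        have h1 : Measurable fun t => if t ≤ x then v t else 0 :=
          Measurable.ite measurableSet_Iic (by fun_prop) measurable_const
        apply Measurable.aestronglyMeasurable
        fun_prop
      · rw [kerDeriv_iterate, norm_mul, norm_pow, norm_mul, Complex.norm_I, one_mul,
          Complex.norm_real]
        have h1 : ‖2 * (x - t)‖ ≤ 2 * ((1 + |x|) * (1 + |t|)) := by
          rw [norm_mul, Real.norm_of_nonneg zero_le_two, Real.norm_eq_abs]
          have := abs_sub x t
          nlinarith [abs_nonneg x, abs_nonneg t, mul_nonneg (abs_nonneg x) (abs_nonneg t)]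
        have h2 : ‖(if t ≤ x then v t else 0 : ℂ)‖ ≤ ‖v t‖ := by
          split_ifs
          · rfl
          · simp
        calc _ ≤ (2 * ((1 + |x|) * (1 + |t|))) ^ k * ‖v t‖ := by gcongr
          _ = _ := by rw [mul_pow, mul_pow]; ring)
  refine h.congr fun z _ => ?_
  rw [jostB]
  refine setIntegral_congr_fun measurableSet_Iic fun t ht => ?_
  simp only [expKer, if_pos (show t ≤ x from ht), id]
  ring

theorem exists_norm_le (f : 𝓢(ℝ, ℂ)) : ∃ C, 0 ≤ C ∧ ∀ x, ‖f x‖ ≤ C :=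
  ⟨‖f.toBoundedContinuousFunction‖, norm_nonneg _, f.toBoundedContinuousFunction.norm_coe_le_norm⟩

theorem integrable_deriv_mul_jost {z : ℂ} (hz : z ∈ upper) :
    Integrable fun t => deriv v t * jostA u v z t + v t * (u t * jostB u v z t) := by
  refine (integrable_mul_jostA u v (SchwartzMap.derivCLM ℝ ℂ v) z).add ?_
  obtain ⟨C, -, hC⟩ := exists_norm_le v
  exact (integrable_mul_jostB u v u hz).bdd_mul v.continuous.aestronglyMeasurable
    (ae_of_all _ hC)

/-- Integration by parts against the phase. The derivative of `vA` is `v'A + vuB`, which is bounded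
in `L¹` uniformly in `z`, so `B` gains one power of `1/z`. -/
theorem mul_jostB_eq {z : ℂ} (hz : z ∈ upper) (x : ℝ) :
    2 * Complex.I * z * jostB u v z x = -(v x * jostA u v z x) +
      ∫ t in Iic x, Complex.exp (Complex.I * z * (2 * (x - t) : ℝ)) *
        (deriv v t * jostA u v z t + v t * (u t * jostB u v z t)) := by
  have hd : ∀ t, HasDerivAt
      (fun t : ℝ => Complex.exp (Complex.I * z * (2 * (x - t) : ℝ)) * (v t * jostA u v z t))
      (Complex.exp (Complex.I * z * (2 * (x - t) : ℝ)) *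
        (deriv v t * jostA u v z t + v t * (u t * jostB u v z t)) -
        2 * Complex.I * z *
          (Complex.exp (Complex.I * z * (2 * (x - t) : ℝ)) * (v t * jostA u v z t))) t := by
    intro t
    have h1 : HasDerivAt (fun t : ℝ => Complex.exp (Complex.I * z * (2 * (x - t) : ℝ)))
        (Complex.exp (Complex.I * z * (2 * (x - t) : ℝ)) * (Complex.I * z * (-2 : ℝ))) t := by
      have : HasDerivAt (fun t : ℝ => 2 * (x - t)) (-2) t := by
        simpa using ((hasDerivAt_id t).const_sub x).const_mul 2
      exact (this.ofReal_comp.const_mul (Complex.I * z)).cexp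
    refine (h1.mul (v.differentiableAt.hasDerivAt.mul (hasDerivAt_jostA u v hz t))).congr_deriv ?_
    push_cast; simp only [Pi.mul_apply]; ring
  have hi1 := integrableOn_exp_phase_mul hz (x := x) (integrable_deriv_mul_jost u v hz)
  have hi2 := (integrableOn_exp_phase_mul hz (x := x) (integrable_mul_jostA u v v z)).const_mul
    (2 * Complex.I * z)
  have hlim : Tendsto (fun t : ℝ => Complex.exp (Complex.I * z * (2 * (x - t) : ℝ)) *
      (v t * jostA u v z t)) atBot (𝓝 0) := by
    have hv : Tendsto (fun t => ‖v t‖ * ‖jostA u v z‖) atBot (𝓝 0) := by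
      have := (v.tendsto_cocompact.mono_left atBot_le_cocompact).norm.mul_const ‖jostA u v z‖
      simpa using this
    refine squeeze_zero_norm' ?_ hv
    filter_upwards [eventually_le_atBot x] with t ht
    rw [norm_mul, norm_mul]
    calc _ ≤ 1 * (‖v t‖ * ‖jostA u v z‖) := by
          gcongr
          · exact norm_exp_phase_le hz ht
          · exact (jostA u v z).norm_coe_le_norm t
      _ = _ := one_mul _
  have h := integral_Iic_of_hasDerivAt_of_tendsto' (fun t _ => hd t) (hi1.sub hi2) hlim
  rw [integral_sub hi1 hi2, integral_const_mul] at h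
  rw [jostB]
  simp only [sub_self, mul_zero, Complex.ofReal_zero, Complex.exp_zero, one_mul, sub_zero] at h
  linear_combination -h

theorem exists_norm_mul_jostB_le :
    ∃ C, 0 ≤ C ∧ ∀ z ∈ upper, ∀ x, ‖z‖ * ‖jostB u v z x‖ ≤ C := by
  obtain ⟨C, hC0, hC⟩ := exists_norm_jost_le u v
  obtain ⟨Cv, hCv0, hCv⟩ := exists_norm_le v
  have hg : Integrable fun t => ‖deriv v t‖ * C + Cv * (‖u t‖ * C) :=
    ((SchwartzMap.derivCLM ℝ ℂ v).integrable.norm.mul_const C).add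
      ((u.integrable.norm.mul_const C).const_mul Cv)
  have hg0 : 0 ≤ ∫ t, (‖deriv v t‖ * C + Cv * (‖u t‖ * C)) :=
    integral_nonneg fun t => by positivity
  refine ⟨(Cv * C + ∫ t, (‖deriv v t‖ * C + Cv * (‖u t‖ * C))) / 2, by positivity,
    fun z hz x => ?_⟩
  have h1 : ‖2 * Complex.I * z * jostB u v z x‖ = 2 * (‖z‖ * ‖jostB u v z x‖) := by
    simp only [norm_mul, Complex.norm_I, Complex.norm_ofNat]; ring
  have h2 : ‖2 * Complex.I * z * jostB u v z x‖ ≤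
      Cv * C + ∫ t, (‖deriv v t‖ * C + Cv * (‖u t‖ * C)) := by
    rw [mul_jostB_eq u v hz x]
    refine norm_add_le_of_le ?_ ?_
    · rw [norm_neg, norm_mul]
      exact mul_le_mul (hCv x) (hC z hz x).1 (norm_nonneg _) hCv0
    · refine (norm_integral_exp_phase_mul_le hz (integrable_deriv_mul_jost u v hz)).trans ?_
      refine (setIntegral_le_integral (integrable_deriv_mul_jost u v hz).norm
        (ae_of_all _ fun _ => norm_nonneg _)).trans ?_
      refine integral_mono (integrable_deriv_mul_jost u v hz).norm hg fun t => ?_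
      refine norm_add_le_of_le ?_ ?_
      · rw [norm_mul]; gcongr; exact (hC z hz t).1
      · rw [norm_mul, norm_mul]; gcongr
        exacts [hCv t, (hC z hz t).2]
  linarith

/-- Since `A - 1` and the limit at `+∞` minus one are integrals of `uB`, they inherit the decay of
`B` in `z`. -/
theorem exists_norm_mul_jostA_sub_one_le :
    ∃ C, 0 ≤ C ∧ ∀ z ∈ upper, (∀ x, ‖z‖ * ‖jostA u v z x - 1‖ ≤ C) ∧
      ‖z‖ * ‖jostAlpha u v z - 1‖ ≤ C := by
  obtain ⟨C, hC0, hC⟩ := exists_norm_mul_jostB_le u v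
  have hu0 : 0 ≤ ∫ t, ‖u t‖ := integral_nonneg fun _ => norm_nonneg _
  have key : ∀ z ∈ upper, ∀ S : Set ℝ, ‖z‖ * ‖∫ s in S, u s * jostB u v z s‖ ≤ (∫ t, ‖u t‖) * C := by
    intro z hz S
    rw [← norm_mul, ← integral_const_mul, ← integral_mul_const]
    calc _ ≤ ∫ s in S, ‖u s‖ * C := by
          refine norm_integral_le_of_norm_le (u.integrable.norm.mul_const C).integrableOn
            (ae_of_all _ fun s => ?_)
          calc _ = ‖u s‖ * (‖z‖ * ‖jostB u v z s‖) := by simp only [norm_mul]; ring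
            _ ≤ _ := by gcongr; exact hC z hz s
      _ ≤ _ := setIntegral_le_integral (u.integrable.norm.mul_const C)
          (ae_of_all _ fun s => by positivity)
  refine ⟨(∫ t, ‖u t‖) * C, by positivity, fun z hz => ⟨fun x => ?_, ?_⟩⟩
  · rw [jostA_eq u v hz x, add_sub_cancel_left]
    exact key z hz _
  · rw [jostAlpha, add_sub_cancel_left]
    simpa using key z hz univ

theorem tendsto_zero_of_norm_mul_le {f : ℂ → ℂ} {C : ℝ} (h : ∀ z ∈ upper, ‖z‖ * ‖f z‖ ≤ C) :
    Tendsto f atInf (𝓝 0) := by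
  have hn : Tendsto (fun z : ℂ => ‖z‖) atInf atTop :=
    tendsto_norm_cobounded_atTop.mono_left inf_le_left
  refine squeeze_zero_norm' ?_ (hn.const_div_atTop C)
  have : ∀ᶠ z in atInf, z ∈ upper := Filter.mem_inf_of_right (mem_principal_self _)
  filter_upwards [hn.eventually_gt_atTop 0, this] with z h0 hz
  rw [le_div_iff₀ h0, mul_comm]
  exact h z hz

theorem tendsto_jostB_atInf (x : ℝ) : Tendsto (fun z => jostB u v z x) atInf (𝓝 0) := by
  obtain ⟨C, -, hC⟩ := exists_norm_mul_jostB_le u v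
  exact tendsto_zero_of_norm_mul_le fun z hz => hC z hz x

theorem tendsto_jostA_atInf (x : ℝ) : Tendsto (fun z => jostA u v z x) atInf (𝓝 1) := by
  obtain ⟨C, -, hC⟩ := exists_norm_mul_jostA_sub_one_le u v
  have := (tendsto_zero_of_norm_mul_le fun z hz => (hC z hz).1 x).add_const 1
  simpa using this

theorem tendsto_jostAlpha_atInf : Tendsto (jostAlpha u v) atInf (𝓝 1) := by
  obtain ⟨C, -, hC⟩ := exists_norm_mul_jostA_sub_one_le u v
  have := (tendsto_zero_of_norm_mul_le fun z hz => (hC z hz).2).add_const 1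
  simpa using this

theorem I_mul_mem_upper {t : ℝ} (ht : 0 ≤ t) : Complex.I * t ∈ upper := by
  simpa using ht

/-- On the imaginary axis the phase is `e^{-2τ(x - t)}`, so the integral left by the integration by
parts tends to zero and only its boundary term survives. -/
theorem tendsto_mul_jostB (x : ℝ) :
    Tendsto (fun t : ℝ => 2 * Complex.I * (Complex.I * t) * jostB u v (Complex.I * t) x) atTop
      (𝓝 (-v x)) := by
  have hev : ∀ᶠ t : ℝ in atTop, Complex.I * t ∈ upper :=
    (eventually_ge_atTop 0).mono fun t ht => I_mul_mem_upper ht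
  have h1 : Tendsto (fun t : ℝ => -(v x * jostA u v (Complex.I * t) x)) atTop (𝓝 (-(v x * 1))) :=
    (((tendsto_jostA_atInf u v x).comp tendsto_I_mul_atInf).const_mul (v x)).neg
  obtain ⟨C, hC0, hC⟩ := exists_norm_jost_le u v
  obtain ⟨Cv, hCv0, hCv⟩ := exists_norm_le v
  have hg : Integrable fun t => ‖deriv v t‖ * C + Cv * (‖u t‖ * C) :=
    ((SchwartzMap.derivCLM ℝ ℂ v).integrable.norm.mul_const C).add
      ((u.integrable.norm.mul_const C).const_mul Cv)
  have h2 : Tendsto (fun τ : ℝ => ∫ t in Iic x,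
      Complex.exp (Complex.I * (Complex.I * τ) * (2 * (x - t) : ℝ)) *
        (deriv v t * jostA u v (Complex.I * τ) t + v t * (u t * jostB u v (Complex.I * τ) t)))
      atTop (𝓝 (∫ t in Iic x, (0 : ℂ))) := by
    refine tendsto_integral_filter_of_dominated_convergence
      (fun t => ‖deriv v t‖ * C + Cv * (‖u t‖ * C)) ?_ ?_ hg.integrableOn ?_
    · filter_upwards [hev] with τ hτ
      exact (integrableOn_exp_phase_mul hτ (integrable_deriv_mul_jost u v hτ)).aestronglyMeasurable
    · filter_upwards [hev] with τ hτ
      filter_upwards [ae_restrict_mem measurableSet_Iic] with t ht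
      rw [norm_mul]
      refine (mul_le_of_le_one_left (norm_nonneg _) (norm_exp_phase_le hτ ht)).trans ?_
      refine norm_add_le_of_le ?_ ?_
      · rw [norm_mul]; gcongr; exact (hC _ hτ t).1
      · rw [norm_mul, norm_mul]; gcongr
        exacts [hCv t, (hC _ hτ t).2]
    -- At the end point `t = x` the phase does not decay; that point is negligible.
    · have hx : ∀ᵐ t ∂(volume.restrict (Iic x)), t ≠ x := by
        refine ae_restrict_of_ae ?_
        simp [ae_iff]
      filter_upwards [hx, ae_restrict_mem measurableSet_Iic] with t htx ht
      have hlt : 0 < 2 * (x - t) := by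
        have := lt_of_le_of_ne ht htx
        linarith
      have hexp : Tendsto (fun τ : ℝ => Real.exp (-(τ * (2 * (x - t)))) *
          (‖deriv v t‖ * C + Cv * (‖u t‖ * C))) atTop (𝓝 0) := by
        have := (Real.tendsto_exp_neg_atTop_nhds_zero.comp
          (tendsto_id.atTop_mul_const hlt)).mul_const (‖deriv v t‖ * C + Cv * (‖u t‖ * C))
        simpa [Function.comp_def] using this
      refine squeeze_zero_norm' ?_ hexp
      filter_upwards [hev] with τ hτ
      rw [norm_mul, Complex.norm_exp]
      have hre : (Complex.I * (Complex.I * τ) * (2 * (x - t) : ℝ)).re = -(τ * (2 * (x - t))) := by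
        rw [← mul_assoc, Complex.I_mul_I, neg_one_mul, neg_mul, ← Complex.ofReal_mul,
          Complex.neg_re, Complex.ofReal_re]
      rw [hre]
      gcongr
      refine norm_add_le_of_le ?_ ?_
      · rw [norm_mul]; gcongr; exact (hC _ hτ t).1
      · rw [norm_mul, norm_mul]; gcongr
        exacts [hCv t, (hC _ hτ t).2]
  have h3 := h1.add h2
  rw [integral_zero, add_zero, mul_one] at h3
  refine h3.congr' ?_
  filter_upwards [hev] with τ hτ
  rw [mul_jostB_eq u v hτ x]

/-- The asymptotics of `B` are inserted into `A - 1 = ∫ uB`; the uniform bound on `z B` gives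
domination. -/
theorem tendsto_mul_jostA_sub_one (x : ℝ) :
    Tendsto (fun t : ℝ => 2 * Complex.I * (Complex.I * t) * (jostA u v (Complex.I * t) x - 1)) atTop
      (𝓝 (-∫ s in Iic x, u s * v s)) := by
  have hev : ∀ᶠ t : ℝ in atTop, Complex.I * t ∈ upper :=
    (eventually_ge_atTop 0).mono fun t ht => I_mul_mem_upper ht
  obtain ⟨C, hC0, hC⟩ := exists_norm_mul_jostB_le u v
  have h : Tendsto (fun τ : ℝ => ∫ s in Iic x,
      u s * (2 * Complex.I * (Complex.I * τ) * jostB u v (Complex.I * τ) s)) atTop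
      (𝓝 (∫ s in Iic x, u s * (-v s))) := by
    refine tendsto_integral_filter_of_dominated_convergence (fun s => ‖u s‖ * (2 * C)) ?_ ?_
      (u.integrable.norm.mul_const _).integrableOn ?_
    · filter_upwards [hev] with τ hτ
      have := continuous_jostB u v hτ
      have := u.continuous
      exact Continuous.aestronglyMeasurable (by fun_prop)
    · filter_upwards [hev] with τ hτ
      refine ae_of_all _ fun s => ?_
      rw [norm_mul]
      gcongr
      have := hC _ hτ s
      simp only [norm_mul, Complex.norm_I, Complex.norm_ofNat] at this ⊢
      linarith
    · exact ae_of_all _ fun s => (tendsto_mul_jostB u v s).const_mul (u s)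
  simp only [mul_neg, integral_neg] at h
  refine h.congr' ?_
  filter_upwards [hev] with τ hτ
  rw [jostA_eq u v hτ x, add_sub_cancel_left, ← integral_const_mul]
  exact integral_congr_ae (ae_of_all _ fun s => by ring)

end

section

open scoped BoundedContinuousFunction ContDiff

/-! Bounded functions with bounded derivatives and the Schwartz class. -/

theorem bddSmooth_schwartz (n : ℕ) : ∀ f : 𝓢(ℝ, ℂ), BddSmooth n f := by
  induction n with
  | zero => exact fun f => (exists_norm_le f).imp fun C h => h.2
  | succ n ih => exact fun f => ⟨(exists_norm_le f).imp fun C h => h.2,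
      SchwartzMap.derivCLM ℝ ℂ f, fun x => f.differentiableAt.hasDerivAt, ih _⟩

theorem BddSmooth.of_linear {f q : ℝ → ℂ} (hf0 : ∃ C, ∀ x, ‖f x‖ ≤ C)
    (hf : ∀ x, HasDerivAt f (q x * f x) x) (hq : ∀ n, BddSmooth n q) : ∀ n, BddSmooth n f
  | 0 => hf0
  | n + 1 => ⟨hf0, _, hf, (hq n).mul (BddSmooth.of_linear hf0 hf hq n)⟩

theorem BddSmooth.differentiable {f : ℝ → ℂ} (hf : ∀ n, BddSmooth n f) : Differentiable ℝ f := by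
  obtain ⟨-, f', hf', -⟩ := hf 1
  exact fun x => (hf' x).differentiableAt

theorem BddSmooth.deriv {f : ℝ → ℂ} (hf : ∀ n, BddSmooth n f) :
    ∀ n, BddSmooth n (_root_.deriv f) :=
  BddSmooth.hasDerivAt_bdd hf fun x => (BddSmooth.differentiable hf x).hasDerivAt

theorem BddSmooth.iteratedDeriv (m : ℕ) :
    ∀ {f : ℝ → ℂ}, (∀ n, BddSmooth n f) → ∀ n, BddSmooth n (_root_.iteratedDeriv m f) := by
  induction m with
  | zero => intro f hf; simpa using hf
  | succ m ih => intro f hf; rw [iteratedDeriv_succ']; exact ih (BddSmooth.deriv hf)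

theorem BddSmooth.contDiff {f : ℝ → ℂ} (hf : ∀ n, BddSmooth n f) : ContDiff ℝ ∞ f :=
  contDiff_of_differentiable_iteratedDeriv fun m _ =>
    BddSmooth.differentiable (BddSmooth.iteratedDeriv m hf)

theorem BddSmooth.hasTemperateGrowth {f : ℝ → ℂ} (hf : ∀ n, BddSmooth n f) :
    Function.HasTemperateGrowth f := by
  refine ⟨BddSmooth.contDiff hf, fun n => ?_⟩
  obtain ⟨C, hC⟩ := BddSmooth.iteratedDeriv n hf 0
  exact ⟨0, C, fun x => by rw [norm_iteratedFDeriv_eq_norm_iteratedDeriv]; simpa using hC x⟩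

/-- The product of a Schwartz function with a function whose derivatives are bounded. -/
theorem exists_schwartz_mul {f : ℝ → ℂ} (hf : ∀ n, BddSmooth n f) (g : 𝓢(ℝ, ℂ)) :
    ∃ h : 𝓢(ℝ, ℂ), ∀ x, h x = f x * g x :=
  ⟨SchwartzMap.smulLeftCLM ℂ f g, fun x => by
    rw [SchwartzMap.smulLeftCLM_apply_apply (BddSmooth.hasTemperateGrowth hf), smul_eq_mul]⟩

/-- All derivatives of all products `x^k f(x)` are bounded. -/
def RapidlyDecreasing (f : ℝ → ℂ) : Prop := ∀ k n : ℕ, BddSmooth n fun x : ℝ => (x : ℂ) ^ k * f x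

theorem RapidlyDecreasing.bddSmooth {f : ℝ → ℂ} (hf : RapidlyDecreasing f) :
    ∀ n, BddSmooth n f := fun n => by simpa using hf 0 n

theorem RapidlyDecreasing.deriv {f : ℝ → ℂ} (hf : RapidlyDecreasing f) :
    RapidlyDecreasing (deriv f) := by
  intro k n
  have hd := BddSmooth.differentiable hf.bddSmooth
  have h1 : ∀ x : ℝ, HasDerivAt (fun x : ℝ => (x : ℂ) ^ k * f x)
      (k * (x : ℂ) ^ (k - 1) * f x + (x : ℂ) ^ k * _root_.deriv f x) x := by
    intro x
    have h2 : HasDerivAt (fun x : ℝ => (x : ℂ) ^ k) (k * (x : ℂ) ^ (k - 1)) x := by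
      simpa using ((hasDerivAt_id (x : ℂ)).pow k).comp_ofReal
    exact h2.mul (hd x).hasDerivAt
  have h2 := BddSmooth.hasDerivAt_bdd (hf k) h1 n
  -- The product `x^k f'` is written as `(x^k f)' - k x^(k-1) f`. For `k = 0` the truncated exponent
  -- does no harm, since its coefficient is zero.
  have h3 := h2.add ((BddSmooth.const (F := ℂ) (-(k : ℂ))).mul (hf (k - 1) n))
  convert h3 using 2 with x
  ring

theorem RapidlyDecreasing.exists_schwartz {f : ℝ → ℂ} (hf : RapidlyDecreasing f) :
    ∃ h : 𝓢(ℝ, ℂ), ∀ x, h x = f x := by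
  refine ⟨⟨f, BddSmooth.contDiff hf.bddSmooth, fun k n => ?_⟩, fun x => rfl⟩
  have h1 : RapidlyDecreasing (iteratedDeriv n f) := by
    induction n generalizing f with
    | zero => simpa using hf
    | succ n ih => rw [iteratedDeriv_succ']; exact ih hf.deriv
  obtain ⟨C, hC⟩ := h1 k 0
  refine ⟨C, fun x => ?_⟩
  rw [norm_iteratedFDeriv_eq_norm_iteratedDeriv]
  simpa using hC x

theorem RapidlyDecreasing.mul {f g : ℝ → ℂ} (hf : RapidlyDecreasing f) (hg : ∀ n, BddSmooth n g) :
    RapidlyDecreasing fun x => f x * g x := by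
  intro k n
  simpa only [mul_assoc] using (hf k n).mul (hg n)

/-! The reflection data of the normalized solution belong to the Schwartz class. -/

variable (u v : 𝓢(ℝ, ℂ))

theorem bddSmooth_jostA : ∀ n, BddSmooth n fun l : ℝ => jostA u v l := fun n =>
  BddSmooth.clm (F := (ℝ →ᵇ ℂ) →L[ℂ] (ℝ →ᵇ ℂ)) (G := ℝ →ᵇ ℂ)
    ((ContinuousLinearMap.apply ℂ (ℝ →ᵇ ℂ) (1 : ℝ →ᵇ ℂ)).restrictScalars ℝ)
    (bddSmooth_aknsRes u v n)

/-- Only real parameters occur here, so the sign condition on the phase is imposed for real `z`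
only, where it is automatic; this admits the phase `-2t`, which changes sign. -/
theorem bddSmooth_pairing {X : Type*} [MeasurableSpace X] {μ : Measure X} {π : X → ℝ}
    (hπ : Measurable π) {c : X → ℂ} {θ : X → ℝ} (hθ : Measurable θ)
    (h : ∀ p, c p ≠ 0 → ∀ z : ℂ, z.im = 0 → 0 ≤ z.im * θ p)
    (hc : ∀ k, Integrable ((kerDeriv θ)^[k] c) μ) (n : ℕ) :
    BddSmooth n fun l : ℝ => ∫ p, expKer c θ l p * jostA u v l (π p) ∂μ := by
  have h1 := bddSmooth_expKer (Λ := {z : ℂ | z.im = 0}) hθ Complex.ofReal_im n h hc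
  have h2 : BddSmooth n fun l : ℝ => pairing μ π hπ (toL1 μ (expKer c θ l)) := by
    refine BddSmooth.clm (F := Lp ℂ 1 μ) (G := (ℝ →ᵇ ℂ) →L[ℂ] ℂ)
      ((pairing μ π hπ).restrictScalars ℝ) h1
  have h3 := BddSmooth.bilin (F := (ℝ →ᵇ ℂ) →L[ℂ] ℂ) (G := ℝ →ᵇ ℂ) (H := ℂ)
    (((ContinuousLinearMap.restrictScalarsL ℂ (ℝ →ᵇ ℂ) ℂ ℝ ℝ))) h2 (bddSmooth_jostA u v n)
  convert h3 using 2 with l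
  exact (pairing_toL1 (integrable_expKer hθ (fun p hp => h p hp l (Complex.ofReal_im l)) (hc 0))
    hπ _).symm

theorem bddSmooth_jostAlpha (n : ℕ) : BddSmooth n fun l : ℝ => jostAlpha u v l := by
  have h := bddSmooth_pairing u v (μ := volume) (π := Prod.snd) measurable_snd
    (c := aknsKer u v) measurable_aknsPhase (fun p _ z hz => by simp [hz])
    (integrable_aknsKer_iterate u v) n
  have h1 := (BddSmooth.const (F := ℂ) (1 : ℂ)).add h
  convert h1 using 2 with l
  exact jostAlpha_eq u v (ofReal_mem_upper l)

/-- The oscillatory integral `∫ e^{-2ilt} w(t) A(t) dt`. -/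
def jostI (w : 𝓢(ℝ, ℂ)) (l : ℝ) : ℂ :=
  ∫ t, Complex.exp (Complex.I * l * (-2 * t : ℝ)) * (w t * jostA u v l t)

theorem bddSmooth_jostI (w : 𝓢(ℝ, ℂ)) (n : ℕ) : BddSmooth n (jostI u v w) := by
  have h := bddSmooth_pairing u v (μ := volume) (π := id) measurable_id
    (c := w) (θ := fun t => -2 * t) (by fun_prop) (fun p _ z hz => by simp [hz])
    (fun k => by
      have hk : Integrable fun t => 2 ^ k * (|t| ^ k * ‖w t‖) :=
        (w.integrable_pow_mul volume k).const_mul _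
      have : ((kerDeriv fun t => -2 * t)^[k] w) =
          fun t : ℝ => (Complex.I * (-2 * t : ℝ)) ^ k * w t :=
        funext (kerDeriv_iterate _ _ k)
      rw [this]
      refine hk.mono' ?_ (ae_of_all _ fun t => ?_)
      · have := w.continuous
        exact Continuous.aestronglyMeasurable (by fun_prop)
      · simp [mul_pow, mul_assoc]) n
  convert h using 2 with l
  rw [jostI]
  refine integral_congr_ae (ae_of_all _ fun t => ?_)
  simp only [expKer, id]
  ring

theorem norm_exp_real_phase (l t : ℝ) : ‖Complex.exp (Complex.I * l * t)‖ ≤ 1 :=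
  norm_exp_le_one_of_im_mul (by simp)

theorem integrable_exp_real_phase_mul (l : ℝ) {g : ℝ → ℂ} (hg : Integrable g) :
    Integrable fun t => Complex.exp (Complex.I * l * (-2 * t : ℝ)) * g t :=
  hg.bdd_mul (c := 1) (by apply Continuous.aestronglyMeasurable; fun_prop)
    (ae_of_all _ fun t => norm_exp_real_phase l _)

/-- The tail `∫_s^∞ w u`. -/
def tailIntegral (w : ℝ → ℂ) (s : ℝ) : ℂ := ∫ t in Ioi s, w t

theorem integrable_mul_schwartz (w : 𝓢(ℝ, ℂ)) : Integrable fun t => w t * u t := by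
  obtain ⟨C, -, hC⟩ := exists_norm_le u
  exact w.integrable.mul_bdd u.continuous.aestronglyMeasurable (ae_of_all _ hC)

theorem tailIntegral_eq {g : ℝ → ℂ} (hg : Integrable g) (s : ℝ) :
    tailIntegral g s = (∫ t, g t) - ∫ t in Iic s, g t := by
  have := setIntegral_compl (measurableSet_Iic (a := s)) hg
  rw [compl_Iic] at this
  exact this

theorem hasDerivAt_tailIntegral {g : ℝ → ℂ} (hg : Integrable g) (hc : Continuous g) (s : ℝ) :
    HasDerivAt (tailIntegral g) (-g s) s := by
  rw [show tailIntegral g = fun s => (∫ t, g t) - ∫ t in Iic s, g t from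
    funext (tailIntegral_eq hg)]
  exact (hasDerivAt_integral_Iic hg hc s).const_sub _

/-- The tail need not decay at `-∞`, but bounded derivatives suffice for its product with a Schwartz
function to be Schwartz. -/
theorem bddSmooth_tailIntegral (w : 𝓢(ℝ, ℂ)) (n : ℕ) :
    BddSmooth n (tailIntegral fun t => w t * u t) := by
  have h0 : ∃ C, ∀ s, ‖tailIntegral (fun t => w t * u t) s‖ ≤ C :=
    ⟨∫ t, ‖w t * u t‖, fun s => (norm_integral_le_integral_norm _).trans
      (setIntegral_le_integral (integrable_mul_schwartz u w).norm
        (ae_of_all _ fun _ => norm_nonneg _))⟩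
  cases n with
  | zero => exact h0
  | succ n =>
    refine ⟨h0, _, hasDerivAt_tailIntegral (integrable_mul_schwartz u w)
      (w.continuous.mul u.continuous), ?_⟩
    have := (BddSmooth.const (F := ℂ) (-1 : ℂ) (n := n)).mul
      ((bddSmooth_schwartz n w).mul (bddSmooth_schwartz n u))
    simpa using this

/-- Fubini on the region `s ≤ t`: the phases combine to one depending on `s` alone, and the outer
integration collapses to the tail of `wu`. A term in `B` becomes a term in `A` of the type `jostI`.
-/
theorem integral_exp_mul_jostB (w : 𝓢(ℝ, ℂ)) (l : ℝ) :
    ∫ t, Complex.exp (Complex.I * l * (-2 * t : ℝ)) * (w t * (u t * jostB u v l t)) =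
      ∫ s, Complex.exp (Complex.I * l * (-2 * s : ℝ)) *
        (tailIntegral (fun t => w t * u t) s * v s * jostA u v l s) := by
  have hF : Integrable fun p : ℝ × ℝ => (w p.1 * u p.1) *
      (Complex.exp (Complex.I * l * (-2 * p.2 : ℝ)) * (v p.2 * jostA u v l p.2)) :=
    (integrable_mul_schwartz u w).mul_prod
      (integrable_exp_real_phase_mul l (integrable_mul_jostA u v v l))
  have hG : Integrable fun p : ℝ × ℝ => if p.2 ≤ p.1 then (w p.1 * u p.1) *
      (Complex.exp (Complex.I * l * (-2 * p.2 : ℝ)) * (v p.2 * jostA u v l p.2)) else 0 := by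
    have := hF.indicator (measurableSet_le measurable_snd measurable_fst)
    refine this.congr (ae_of_all _ fun p => ?_)
    simp [indicator_apply]
  have e1 : ∀ t, Complex.exp (Complex.I * l * (-2 * t : ℝ)) * (w t * (u t * jostB u v l t)) =
      ∫ s, if s ≤ t then (w t * u t) *
      (Complex.exp (Complex.I * l * (-2 * s : ℝ)) * (v s * jostA u v l s)) else 0 := by
    intro t
    have : (fun s => if s ≤ t then (w t * u t) *
        (Complex.exp (Complex.I * l * (-2 * s : ℝ)) * (v s * jostA u v l s)) else 0) =
        (Iic t).indicator fun s => Complex.exp (Complex.I * l * (-2 * t : ℝ)) * (w t * u t) *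
          (Complex.exp (Complex.I * l * (2 * (t - s) : ℝ)) * (v s * jostA u v l s)) := by
      funext s
      simp only [indicator_apply, mem_Iic]
      split_ifs
      · have : Complex.exp (Complex.I * l * (-2 * s : ℝ)) =
            Complex.exp (Complex.I * l * (-2 * t : ℝ)) *
              Complex.exp (Complex.I * l * (2 * (t - s) : ℝ)) := by
          rw [← Complex.exp_add]; congr 1; push_cast; ring
        rw [this]; ring
      · rfl
    rw [this, integral_indicator measurableSet_Iic, integral_const_mul, jostB]
    ring
  have e2 : ∀ s, Complex.exp (Complex.I * l * (-2 * s : ℝ)) *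
        (tailIntegral (fun t => w t * u t) s * v s * jostA u v l s) =
      ∫ t, if s ≤ t then (w t * u t) *
      (Complex.exp (Complex.I * l * (-2 * s : ℝ)) * (v s * jostA u v l s)) else 0 := by
    intro s
    have : (fun t => if s ≤ t then (w t * u t) *
        (Complex.exp (Complex.I * l * (-2 * s : ℝ)) * (v s * jostA u v l s)) else 0) =
        (Ici s).indicator fun t => (w t * u t) *
        (Complex.exp (Complex.I * l * (-2 * s : ℝ)) * (v s * jostA u v l s)) := by
      funext t
      simp only [indicator_apply, mem_Ici]
    rw [this, integral_indicator measurableSet_Ici, integral_mul_const, integral_Ici_eq_integral_Ioi,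
      tailIntegral]
    ring
  simp only [e1, e2]
  exact integral_integral_swap hG

/-- Integration by parts yields the terms `w'A` and `wuB`, and the second is again of the first type
by Fubini. The class of these oscillatory integrals is therefore closed under multiplication by `l`,
which gives decay of every order. -/
theorem exists_mul_jostI (w : 𝓢(ℝ, ℂ)) :
    ∃ w' : 𝓢(ℝ, ℂ), ∀ l : ℝ, 2 * Complex.I * l * jostI u v w l = jostI u v w' l := by
  obtain ⟨h, hh⟩ := exists_schwartz_mul (bddSmooth_tailIntegral u w) v
  refine ⟨SchwartzMap.derivCLM ℝ ℂ w + h, fun l => ?_⟩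
  have hl := ofReal_mem_upper l
  have hd : ∀ t : ℝ, HasDerivAt
      (fun t : ℝ => Complex.exp (Complex.I * l * (-2 * t : ℝ)) * (w t * jostA u v l t))
      (Complex.exp (Complex.I * l * (-2 * t : ℝ)) * (deriv w t * jostA u v l t) +
        Complex.exp (Complex.I * l * (-2 * t : ℝ)) * (w t * (u t * jostB u v l t)) -
        2 * Complex.I * l *
          (Complex.exp (Complex.I * l * (-2 * t : ℝ)) * (w t * jostA u v l t))) t := by
    intro t
    have h1 : HasDerivAt (fun t : ℝ => Complex.exp (Complex.I * l * (-2 * t : ℝ)))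
        (Complex.exp (Complex.I * l * (-2 * t : ℝ)) * (Complex.I * l * (-2 : ℝ))) t := by
      have : HasDerivAt (fun t : ℝ => -2 * t) (-2) t := by
        simpa using (hasDerivAt_id t).const_mul (-2 : ℝ)
      exact (this.ofReal_comp.const_mul (Complex.I * l)).cexp
    refine (h1.mul (w.differentiableAt.hasDerivAt.mul (hasDerivAt_jostA u v hl t))).congr_deriv ?_
    push_cast; simp only [Pi.mul_apply]; ring
  have hB : Integrable fun t => w t * (u t * jostB u v l t) := by
    obtain ⟨C, -, hC⟩ := exists_norm_le w
    exact (integrable_mul_jostB u v u hl).bdd_mul w.continuous.aestronglyMeasurable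
      (ae_of_all _ hC)
  have i1 := integrable_exp_real_phase_mul l
    (integrable_mul_jostA u v (SchwartzMap.derivCLM ℝ ℂ w) l)
  have i2 := integrable_exp_real_phase_mul l hB
  have i0 := integrable_exp_real_phase_mul l (integrable_mul_jostA u v w l)
  have i3 := i0.const_mul (2 * Complex.I * l)
  have hz := integral_eq_zero_of_hasDerivAt_of_integrable hd ((i1.add i2).sub i3) i0
  have hz' : (∫ t : ℝ, Complex.exp (Complex.I * l * (-2 * t : ℝ)) * (deriv w t * jostA u v l t)) +
      (∫ t : ℝ, Complex.exp (Complex.I * l * (-2 * t : ℝ)) * (w t * (u t * jostB u v l t))) -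
      2 * Complex.I * l * jostI u v w l = 0 := by
    rw [jostI, ← integral_const_mul, ← hz]
    refine (integral_add i1 i2 ▸ integral_sub (i1.add i2) i3).symm
  rw [integral_exp_mul_jostB] at hz'
  have i4 : Integrable fun s : ℝ => Complex.exp (Complex.I * l * (-2 * s : ℝ)) *
      (tailIntegral (fun t => w t * u t) s * v s * jostA u v l s) := by
    have := integrable_exp_real_phase_mul l (integrable_mul_jostA u v h l)
    simpa only [hh] using this
  have : jostI u v (SchwartzMap.derivCLM ℝ ℂ w + h) l =
      (∫ t : ℝ, Complex.exp (Complex.I * l * (-2 * t : ℝ)) * (deriv w t * jostA u v l t)) +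
      ∫ s : ℝ, Complex.exp (Complex.I * l * (-2 * s : ℝ)) *
        (tailIntegral (fun t => w t * u t) s * v s * jostA u v l s) := by
    refine Eq.trans ?_ (integral_add i1 i4)
    refine integral_congr_ae (ae_of_all _ fun t => ?_)
    simp only [add_apply, hh, SchwartzMap.derivCLM_apply]
    ring
  rw [this]
  linear_combination -hz'

theorem rapidlyDecreasing_jostI (w : 𝓢(ℝ, ℂ)) : RapidlyDecreasing (jostI u v w) := by
  intro k
  induction k generalizing w with
  | zero => simpa using bddSmooth_jostI u v w
  | succ k ih =>
    intro n
    obtain ⟨w', hw'⟩ := exists_mul_jostI u v w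
    have := (BddSmooth.const (F := ℂ) (2 * Complex.I : ℂ)⁻¹ (n := n)).mul (ih w' n)
    have e : (fun l : ℝ => (l : ℂ) ^ (k + 1) * jostI u v w l) =
        fun l : ℝ => (2 * Complex.I : ℂ)⁻¹ * ((l : ℂ) ^ k * jostI u v w' l) := by
      funext l
      rw [← hw' l]
      have : (2 * Complex.I : ℂ) ≠ 0 := by simp
      field_simp
      ring
    rw [e]
    exact this

/-- The reciprocal tends to one at both ends of the real line and is continuous in between. -/
theorem exists_bdd_inv_jostAlpha (h0 : ∀ l : ℝ, jostAlpha u v l ≠ 0) :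
    ∃ C, ∀ l : ℝ, ‖(jostAlpha u v l)⁻¹‖ ≤ C := by
  have hc : Continuous fun l : ℝ => (jostAlpha u v l)⁻¹ :=
    (BddSmooth.differentiable (bddSmooth_jostAlpha u v)).continuous.inv₀ h0
  have ht : Tendsto (fun l : ℝ => (jostAlpha u v l)⁻¹) (cocompact ℝ) (𝓝 1) := by
    have h1 : Tendsto (fun l : ℝ => (l : ℂ)) (cocompact ℝ) atInf := by
      refine tendsto_inf.2 ⟨?_, tendsto_principal.2 (Eventually.of_forall ofReal_mem_upper)⟩
      rw [← Metric.cobounded_eq_cocompact, ← tendsto_norm_atTop_iff_cobounded]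
      simp only [Complex.norm_real]
      exact tendsto_norm_cobounded_atTop (E := ℝ)
    have := ((tendsto_jostAlpha_atInf u v).comp h1).inv₀ one_ne_zero
    simpa [Function.comp_def] using this
  have h1 : ∀ᶠ l in cocompact ℝ, ‖(jostAlpha u v (l : ℝ))⁻¹‖ ≤ 2 := by
    have := ht.norm.eventually (gt_mem_nhds (show ‖(1 : ℂ)‖ < 2 by norm_num))
    exact this.mono fun l hl => hl.le
  obtain ⟨K, hK, hKs⟩ := mem_cocompact.1 h1
  obtain ⟨C, hC⟩ := hK.exists_bound_of_continuousOn hc.continuousOn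
  refine ⟨max C 2, fun l => ?_⟩
  by_cases hl : l ∈ K
  · exact (hC l hl).trans (le_max_left _ _)
  · exact (hKs hl : _ ≤ _).trans (le_max_right _ _)

theorem bddSmooth_inv_jostAlpha (h0 : ∀ l : ℝ, jostAlpha u v l ≠ 0) (n : ℕ) :
    BddSmooth n fun l : ℝ => (jostAlpha u v l)⁻¹ := by
  have hb := bddSmooth_jostAlpha u v
  refine BddSmooth.of_riccati (q := fun l => -1 * deriv (fun l : ℝ => jostAlpha u v l) l)
    (exists_bdd_inv_jostAlpha u v h0) (fun l => ?_) (fun n => ?_) n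
  · have := (BddSmooth.differentiable hb l).hasDerivAt.fun_inv (h0 l)
    refine this.congr_deriv ?_
    have := h0 l
    field_simp
  · exact (BddSmooth.const (F := ℂ) (-1 : ℂ)).mul (BddSmooth.deriv hb n)

/-- The quotient of the two limits at `+∞` belongs to the Schwartz class. -/
theorem exists_schwartz_jostN_div (h0 : ∀ l : ℝ, jostAlpha u v l ≠ 0) :
    ∃ ρ : 𝓢(ℝ, ℂ), ∀ l : ℝ, ρ l = jostN u v l / jostAlpha u v l :=
  ((rapidlyDecreasing_jostI u v v).mul (bddSmooth_inv_jostAlpha u v h0)).exists_schwartz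

end

section

open scoped BoundedContinuousFunction ContDiff

variable (q r : 𝓢(ℝ, ℂ))

/-! The phase factor and the gauge transformed potentials. -/

theorem hasDerivAt_E (x : ℝ) : HasDerivAt (E q r) (Complex.I / 2 * (q x * r x) * E q r x) x := by
  have h := ((hasDerivAt_integral_Iic (integrable_mul_schwartz r q)
    (q.continuous.mul r.continuous) x).const_mul (Complex.I / 2)).cexp
  refine h.congr_deriv ?_
  rw [E]; ring

theorem E_ne_zero (x : ℝ) : E q r x ≠ 0 := Complex.exp_ne_zero _

theorem tendsto_E_atBot : Tendsto (E q r) atBot (𝓝 1) := by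
  have := ((tendsto_integral_Iic_zero (f := fun s => q s * r s) (μ := volume)
    (l := atBot) tendsto_id).const_mul (Complex.I / 2)).cexp
  rw [mul_zero, Complex.exp_zero] at this
  exact this

theorem tendsto_E_atTop : Tendsto (E q r) atTop (𝓝 (Complex.exp (Complex.I * mu q r / 2))) := by
  have := ((tendsto_setIntegral_Iic (integrable_mul_schwartz r q)).const_mul (Complex.I / 2)).cexp
  rw [mu, show Complex.I * (∫ y, q y * r y) / 2 = Complex.I / 2 * ∫ y, q y * r y by ring]
  exact this

theorem exists_norm_E_le : ∃ C, ∀ x, ‖E q r x‖ ≤ C ∧ ‖(E q r x)⁻¹‖ ≤ C := by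
  have h : ∀ x, ‖Complex.I / 2 * ∫ y in Iic x, q y * r y‖ ≤ 1 / 2 * ∫ y, ‖q y * r y‖ := by
    intro x
    rw [norm_mul, norm_div, Complex.norm_I, Complex.norm_ofNat]
    gcongr
    exact (norm_integral_le_integral_norm _).trans (setIntegral_le_integral
      (integrable_mul_schwartz r q).norm (ae_of_all _ fun _ => norm_nonneg _))
  refine ⟨Real.exp (1 / 2 * ∫ y, ‖q y * r y‖), fun x => ⟨?_, ?_⟩⟩
  · exact (Complex.norm_exp_le_exp_norm _).trans (Real.exp_le_exp.2 (h x))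
  · rw [E, ← Complex.exp_neg]
    refine (Complex.norm_exp_le_exp_norm _).trans (Real.exp_le_exp.2 ?_)
    rw [norm_neg]
    exact h x

theorem bddSmooth_mul_schwartz (c : ℂ) (n : ℕ) : BddSmooth n fun x => c * (q x * r x) :=
  (BddSmooth.const c).mul ((bddSmooth_schwartz n q).mul (bddSmooth_schwartz n r))

theorem bddSmooth_E : ∀ n, BddSmooth n (E q r) :=
  BddSmooth.of_linear ((exists_norm_E_le q r).imp fun _ h x => (h x).1) (hasDerivAt_E q r)
    (bddSmooth_mul_schwartz q r (Complex.I / 2))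

theorem bddSmooth_inv_E : ∀ n, BddSmooth n fun x => (E q r x)⁻¹ := by
  refine BddSmooth.of_linear (q := fun x => -(Complex.I / 2) * (q x * r x))
    ((exists_norm_E_le q r).imp fun _ h x => (h x).2) (fun x => ?_)
    (bddSmooth_mul_schwartz q r (-(Complex.I / 2)))
  refine ((hasDerivAt_E q r x).fun_inv (E_ne_zero q r x)).congr_deriv ?_
  have := E_ne_zero q r x
  field_simp

/-- The first gauge transformed potential, `(i/2) q' / E`. -/
def gaugeU₁ : 𝓢(ℝ, ℂ) :=
  (Complex.I / 2) • SchwartzMap.smulLeftCLM ℂ (fun x => (E q r x)⁻¹) (SchwartzMap.derivCLM ℝ ℂ q)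

/-- The second gauge transformed potential, `r E`. -/
def gaugeV₁ : 𝓢(ℝ, ℂ) := SchwartzMap.smulLeftCLM ℂ (E q r) r

/-- The third gauge transformed potential, `-(i/2) r' E`. -/
def gaugeU₂ : 𝓢(ℝ, ℂ) :=
  (-(Complex.I / 2)) • SchwartzMap.smulLeftCLM ℂ (E q r) (SchwartzMap.derivCLM ℝ ℂ r)

/-- The fourth gauge transformed potential, `q / E`. -/
def gaugeV₂ : 𝓢(ℝ, ℂ) := SchwartzMap.smulLeftCLM ℂ (fun x => (E q r x)⁻¹) q

theorem gaugeU₁_apply (x : ℝ) : gaugeU₁ q r x = Complex.I / 2 * deriv q x / E q r x := by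
  rw [gaugeU₁, smul_apply, SchwartzMap.smulLeftCLM_apply_apply
    (BddSmooth.hasTemperateGrowth (bddSmooth_inv_E q r)), SchwartzMap.derivCLM_apply]
  simp only [smul_eq_mul]; ring

theorem gaugeV₁_apply (x : ℝ) : gaugeV₁ q r x = r x * E q r x := by
  rw [gaugeV₁, SchwartzMap.smulLeftCLM_apply_apply
    (BddSmooth.hasTemperateGrowth (bddSmooth_E q r)), smul_eq_mul, mul_comm]

theorem gaugeU₂_apply (x : ℝ) : gaugeU₂ q r x = -(Complex.I / 2) * deriv r x * E q r x := by
  rw [gaugeU₂, smul_apply, SchwartzMap.smulLeftCLM_apply_apply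
    (BddSmooth.hasTemperateGrowth (bddSmooth_E q r)), SchwartzMap.derivCLM_apply]
  simp only [smul_eq_mul]; ring

theorem gaugeV₂_apply (x : ℝ) : gaugeV₂ q r x = q x / E q r x := by
  rw [gaugeV₂, SchwartzMap.smulLeftCLM_apply_apply
    (BddSmooth.hasTemperateGrowth (bddSmooth_inv_E q r)), smul_eq_mul, mul_comm, div_eq_mul_inv]

/-- The reflected potential `-w(-s)`. -/
def reflNeg (w : 𝓢(ℝ, ℂ)) : 𝓢(ℝ, ℂ) :=
  -SchwartzMap.compCLMOfContinuousLinearEquiv ℝ (ContinuousLinearEquiv.neg ℝ) w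

theorem reflNeg_apply (w : 𝓢(ℝ, ℂ)) (x : ℝ) : reflNeg w x = -w (-x) := by
  simp [reflNeg]

/-! The reduced Jost solutions, as functions of a parameter in the closed upper half-plane. -/

variable (x : ℝ) (z : ℂ)

/-- `f₁` in `φ = (e^{-iλx} f₁, ζ e^{-iλx} f₂)`. -/
def redF₁ : ℂ := E q r x * jostA (gaugeU₁ q r) (gaugeV₁ q r) z x -
  Complex.I / 2 * q x * jostB (gaugeU₁ q r) (gaugeV₁ q r) z x

/-- `f₂` in `φ = (e^{-iλx} f₁, ζ e^{-iλx} f₂)`. -/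
def redF₂ : ℂ := jostB (gaugeU₁ q r) (gaugeV₁ q r) z x

/-- `F₁` in `φ̄ = (ζ e^{iλx} F₁, e^{iλx} F₂)`, at `λ = -z`. -/
def redFBar₁ : ℂ := E q r x * jostB (gaugeU₂ q r) (gaugeV₂ q r) z x

/-- `F₂` in `φ̄ = (ζ e^{iλx} F₁, e^{iλx} F₂)`, at `λ = -z`. -/
def redFBar₂ : ℂ := jostA (gaugeU₂ q r) (gaugeV₂ q r) z x +
  Complex.I / 2 * r x * E q r x * jostB (gaugeU₂ q r) (gaugeV₂ q r) z x

/-- `g₁` in `ψ = (ζ e^{iλx} g₁, e^{iλx} g₂)`. -/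
def redG₁ : ℂ := E q r x * jostB (reflNeg (gaugeU₂ q r)) (reflNeg (gaugeV₂ q r)) z (-x)

/-- `g₂` in `ψ = (ζ e^{iλx} g₁, e^{iλx} g₂)`. -/
def redG₂ : ℂ := jostA (reflNeg (gaugeU₂ q r)) (reflNeg (gaugeV₂ q r)) z (-x) +
  Complex.I / 2 * r x * E q r x * jostB (reflNeg (gaugeU₂ q r)) (reflNeg (gaugeV₂ q r)) z (-x)

/-- `G₁` in `ψ̄ = (e^{-iλx} G₁, ζ e^{-iλx} G₂)`, at `λ = -z`. -/
def redGBar₁ : ℂ := Complex.exp (-(Complex.I * mu q r / 2)) *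
  (E q r x * jostA (reflNeg (gaugeU₁ q r)) (reflNeg (gaugeV₁ q r)) z (-x) -
    Complex.I / 2 * q x * jostB (reflNeg (gaugeU₁ q r)) (reflNeg (gaugeV₁ q r)) z (-x))

/-- `G₂` in `ψ̄ = (e^{-iλx} G₁, ζ e^{-iλx} G₂)`, at `λ = -z`. -/
def redGBar₂ : ℂ := Complex.exp (-(Complex.I * mu q r / 2)) *
  jostB (reflNeg (gaugeU₁ q r)) (reflNeg (gaugeV₁ q r)) z (-x)

/-- The system satisfied by `(f₁, f₂)` at `l = λ`. -/
def IsReduced (l : ℂ) (y₁ y₂ : ℝ → ℂ) : Prop := ∀ x : ℝ,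
  HasDerivAt y₁ (l * q x * y₂ x) x ∧
  HasDerivAt y₂ (r x * y₁ x + (2 * Complex.I * l + Complex.I / 2 * (q x * r x)) * y₂ x) x

/-- The system satisfied by `(g₁, g₂)` at `l = λ`. -/
def IsReduced' (l : ℂ) (y₁ y₂ : ℝ → ℂ) : Prop := ∀ x : ℝ,
  HasDerivAt y₁ (-(2 * Complex.I * l) * y₁ x + q x * y₂ x) x ∧
  HasDerivAt y₂ (l * r x * y₁ x + Complex.I / 2 * (q x * r x) * y₂ x) x

variable {q r x z}

/-- The correction `-(i/2) q B` produces `λ q B` from the term `2iλB` of `B'`. The remaining `q'B`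
is absorbed in the potential `u`, and the terms in `qrA` cancel because `E' = (i/2) q r E`. -/
theorem isReduced_of_gauge {l c : ℂ} {A B : ℝ → ℂ}
    (hA : ∀ x, HasDerivAt A (gaugeU₁ q r x * B x) x)
    (hB : ∀ x, HasDerivAt B (2 * Complex.I * l * B x + gaugeV₁ q r x * A x) x) :
    IsReduced q r l (fun x => c * (E q r x * A x - Complex.I / 2 * q x * B x))
      (fun x => c * B x) := by
  intro x
  have hq := q.differentiableAt.hasDerivAt (x := x)
  have hE := hasDerivAt_E q r x
  have h0 := E_ne_zero q r x
  constructor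
  · refine (((hE.fun_mul (hA x)).fun_sub ((hq.const_mul (Complex.I / 2)).fun_mul
      (hB x))).const_mul c).congr_deriv ?_
    rw [gaugeU₁_apply, gaugeV₁_apply]
    field_simp
    linear_combination (-(2 * c * l * q x * B x)) * Complex.I_sq
  · refine ((hB x).const_mul c).congr_deriv ?_
    rw [gaugeV₁_apply]; ring

/-- The mirror case: now `λ r` stands in the second equation, and `(i/2) r E B` generates it. -/
theorem isReduced'_of_gauge {l : ℂ} {A B : ℝ → ℂ}
    (hA : ∀ x, HasDerivAt A (gaugeU₂ q r x * B x) x)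
    (hB : ∀ x, HasDerivAt B (-(2 * Complex.I * l) * B x + gaugeV₂ q r x * A x) x) :
    IsReduced' q r l (fun x => E q r x * B x)
      (fun x => A x + Complex.I / 2 * r x * E q r x * B x) := by
  intro x
  have hr := r.differentiableAt.hasDerivAt (x := x)
  have hE := hasDerivAt_E q r x
  have h0 := E_ne_zero q r x
  constructor
  · refine (hE.fun_mul (hB x)).congr_deriv ?_
    rw [gaugeV₂_apply]
    field_simp
    ring
  · refine ((hA x).fun_add (((hr.const_mul (Complex.I / 2)).fun_mul hE).fun_mul
      (hB x))).congr_deriv ?_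
    rw [gaugeU₂_apply, gaugeV₂_apply]
    field_simp
    linear_combination (-(4 * l * E q r x * B x * r x)) * Complex.I_sq

/-- Reversing the line turns the solution normalized at `-∞` into one normalized at `+∞`. The sign
in the reflected potential compensates the chain rule, so the right Jost solutions need no separate
construction. -/
theorem hasDerivAt_jostA_reflNeg (u v : 𝓢(ℝ, ℂ)) (hz : z ∈ upper) (x : ℝ) :
    HasDerivAt (fun x => jostA (reflNeg u) (reflNeg v) z (-x))
      (u x * jostB (reflNeg u) (reflNeg v) z (-x)) x := by
  refine ((hasDerivAt_jostA (reflNeg u) (reflNeg v) hz (-x)).scomp x (hasDerivAt_neg x)).congr_deriv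
    ?_
  simp [reflNeg_apply]

theorem hasDerivAt_jostB_reflNeg (u v : 𝓢(ℝ, ℂ)) (hz : z ∈ upper) (x : ℝ) :
    HasDerivAt (fun x => jostB (reflNeg u) (reflNeg v) z (-x))
      (-(2 * Complex.I * z) * jostB (reflNeg u) (reflNeg v) z (-x) +
        v x * jostA (reflNeg u) (reflNeg v) z (-x)) x := by
  refine ((hasDerivAt_jostB (reflNeg u) (reflNeg v) hz (-x)).scomp x (hasDerivAt_neg x)).congr_deriv
    ?_
  simp [reflNeg_apply]

theorem isReduced_redF (hz : z ∈ upper) :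
    IsReduced q r z (fun x => redF₁ q r x z) (fun x => redF₂ q r x z) := by
  have := isReduced_of_gauge (c := 1) (l := z) (hasDerivAt_jostA (gaugeU₁ q r) (gaugeV₁ q r) hz)
    (hasDerivAt_jostB (gaugeU₁ q r) (gaugeV₁ q r) hz)
  simp only [one_mul] at this
  exact this

theorem isReduced'_redFBar (hz : z ∈ upper) :
    IsReduced' q r (-z) (fun x => redFBar₁ q r x z) (fun x => redFBar₂ q r x z) :=
  isReduced'_of_gauge (hasDerivAt_jostA (gaugeU₂ q r) (gaugeV₂ q r) hz)
    (fun x => by simpa using hasDerivAt_jostB (gaugeU₂ q r) (gaugeV₂ q r) hz x)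

theorem isReduced'_redG (hz : z ∈ upper) :
    IsReduced' q r z (fun x => redG₁ q r x z) (fun x => redG₂ q r x z) :=
  isReduced'_of_gauge (hasDerivAt_jostA_reflNeg (gaugeU₂ q r) (gaugeV₂ q r) hz)
    (hasDerivAt_jostB_reflNeg (gaugeU₂ q r) (gaugeV₂ q r) hz)

theorem isReduced_redGBar (hz : z ∈ upper) :
    IsReduced q r (-z) (fun x => redGBar₁ q r x z) (fun x => redGBar₂ q r x z) :=
  isReduced_of_gauge (hasDerivAt_jostA_reflNeg (gaugeU₁ q r) (gaugeV₁ q r) hz)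
    (fun x => by simpa using hasDerivAt_jostB_reflNeg (gaugeU₁ q r) (gaugeV₁ q r) hz x)

/-! Wronskians. -/

theorem exists_eq_mul_of_hasDerivAt {e W τ : ℝ → ℂ} (he : ∀ x, HasDerivAt e (τ x * e x) x)
    (hW : ∀ x, HasDerivAt W (τ x * W x) x) (h0 : ∀ x, e x ≠ 0) : ∃ c, ∀ x, W x = c * e x := by
  have hd : ∀ x, HasDerivAt (fun x => W x / e x) 0 x := fun x => by
    refine ((hW x).fun_div (he x) (h0 x)).congr_deriv ?_
    have := h0 x
    field_simp
    ring
  refine ⟨W 0 / e 0, fun x => ?_⟩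
  have := is_const_of_deriv_eq_zero (fun x => (hd x).differentiableAt) (fun x => (hd x).deriv) x 0
  rw [← this]
  exact (div_mul_cancel₀ _ (h0 x)).symm

/-- Liouville's formula: the exponentials of the two kinds of solutions are inverse to each other,
so the trace `(i/2) q r` of the original system governs the Wronskian, as it governs `E`. -/
theorem IsReduced.wronskian {l : ℂ} {y₁ y₂ w₁ w₂ : ℝ → ℂ} (hy : IsReduced q r l y₁ y₂)
    (hw : IsReduced' q r l w₁ w₂) : ∃ c, ∀ x, y₁ x * w₂ x - l * y₂ x * w₁ x = c * E q r x := by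
  refine exists_eq_mul_of_hasDerivAt (hasDerivAt_E q r) (fun x => ?_) (E_ne_zero q r)
  refine (((hy x).1.fun_mul (hw x).2).fun_sub (((hy x).2.const_mul l).fun_mul
    (hw x).1)).congr_deriv ?_
  ring

end

section

variable {q r : 𝓢(ℝ, ℂ)} {x : ℝ} {z : ℂ}

/-! Limits of the reduced Jost solutions. -/

theorem tendsto_mul_zero_of_bdd {L : Filter ℝ} {f g : ℝ → ℂ} {C : ℝ} (hf : Tendsto f L (𝓝 0))
    (hg : ∀ᶠ x in L, ‖g x‖ ≤ C) : Tendsto (fun x => f x * g x) L (𝓝 0) :=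
  hf.zero_mul_isBoundedUnder_le ⟨C, by simpa using hg⟩

theorem tendsto_of_eq {L : Filter ℝ} {f : ℝ → ℂ} {a b : ℂ} (h : Tendsto f L (𝓝 a)) (hab : a = b) :
    Tendsto f L (𝓝 b) := hab ▸ h

theorem tendsto_schwartz_atTop (f : 𝓢(ℝ, ℂ)) : Tendsto f atTop (𝓝 0) :=
  f.tendsto_cocompact.mono_left atTop_le_cocompact

theorem tendsto_schwartz_atBot (f : 𝓢(ℝ, ℂ)) : Tendsto f atBot (𝓝 0) :=
  f.tendsto_cocompact.mono_left atBot_le_cocompact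

variable (q r) in
theorem exists_norm_jostB_gauge_le (hz : z ∈ upper) : ∃ C, ∀ x,
    ‖jostB (gaugeU₁ q r) (gaugeV₁ q r) z x‖ ≤ C ∧ ‖jostB (gaugeU₂ q r) (gaugeV₂ q r) z x‖ ≤ C ∧
    ‖jostB (reflNeg (gaugeU₁ q r)) (reflNeg (gaugeV₁ q r)) z x‖ ≤ C ∧
    ‖jostB (reflNeg (gaugeU₂ q r)) (reflNeg (gaugeV₂ q r)) z x‖ ≤ C := by
  obtain ⟨C₁, -, h₁⟩ := exists_norm_jost_le (gaugeU₁ q r) (gaugeV₁ q r)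
  obtain ⟨C₂, -, h₂⟩ := exists_norm_jost_le (gaugeU₂ q r) (gaugeV₂ q r)
  obtain ⟨C₃, -, h₃⟩ := exists_norm_jost_le (reflNeg (gaugeU₁ q r)) (reflNeg (gaugeV₁ q r))
  obtain ⟨C₄, -, h₄⟩ := exists_norm_jost_le (reflNeg (gaugeU₂ q r)) (reflNeg (gaugeV₂ q r))
  refine ⟨max (max C₁ C₂) (max C₃ C₄), fun x => ⟨?_, ?_, ?_, ?_⟩⟩
  · exact (h₁ z hz x).2.trans ((le_max_left _ _).trans (le_max_left _ _))
  · exact (h₂ z hz x).2.trans ((le_max_right _ _).trans (le_max_left _ _))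
  · exact (h₃ z hz x).2.trans ((le_max_left _ _).trans (le_max_right _ _))
  · exact (h₄ z hz x).2.trans ((le_max_right _ _).trans (le_max_right _ _))

variable (q r) in
/-- `1 / T` as a function of `z = λ`. -/
def scatA (z : ℂ) : ℂ :=
  Complex.exp (Complex.I * mu q r / 2) * jostAlpha (gaugeU₁ q r) (gaugeV₁ q r) z

variable (q r) in
/-- `1 / T̄` as a function of `z = -λ`. -/
def scatABar (z : ℂ) : ℂ := jostAlpha (gaugeU₂ q r) (gaugeV₂ q r) z

theorem tendsto_redF₁_atBot (hz : z ∈ upper) : Tendsto (fun x => redF₁ q r x z) atBot (𝓝 1) := by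
  have h1 := (tendsto_E_atBot q r).mul (tendsto_jostA_atBot (gaugeU₁ q r) (gaugeV₁ q r) hz)
  have h2 := ((tendsto_schwartz_atBot q).const_mul (Complex.I / 2)).mul
    (tendsto_jostB_atBot (gaugeU₁ q r) (gaugeV₁ q r) hz)
  exact tendsto_of_eq (h1.sub h2) (by simp)

theorem tendsto_redF₂_atBot (hz : z ∈ upper) : Tendsto (fun x => redF₂ q r x z) atBot (𝓝 0) :=
  tendsto_jostB_atBot (gaugeU₁ q r) (gaugeV₁ q r) hz

theorem tendsto_redFBar₁_atBot (hz : z ∈ upper) :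
    Tendsto (fun x => redFBar₁ q r x z) atBot (𝓝 0) := by
  exact tendsto_of_eq ((tendsto_E_atBot q r).mul
    (tendsto_jostB_atBot (gaugeU₂ q r) (gaugeV₂ q r) hz)) (by simp)

theorem tendsto_redFBar₂_atBot (hz : z ∈ upper) :
    Tendsto (fun x => redFBar₂ q r x z) atBot (𝓝 1) := by
  have h1 := tendsto_jostA_atBot (gaugeU₂ q r) (gaugeV₂ q r) hz
  have h2 := (((tendsto_schwartz_atBot r).const_mul (Complex.I / 2)).mul
    (tendsto_E_atBot q r)).mul (tendsto_jostB_atBot (gaugeU₂ q r) (gaugeV₂ q r) hz)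
  exact tendsto_of_eq (h1.add h2) (by simp)

theorem tendsto_redF₁_atTop (hz : z ∈ upper) :
    Tendsto (fun x => redF₁ q r x z) atTop (𝓝 (scatA q r z)) := by
  obtain ⟨C, hC⟩ := exists_norm_jostB_gauge_le q r hz
  have h1 := (tendsto_E_atTop q r).mul (tendsto_jostA_atTop (gaugeU₁ q r) (gaugeV₁ q r) hz)
  have h0 := (tendsto_schwartz_atTop q).const_mul (Complex.I / 2)
  rw [mul_zero] at h0
  have h2 := tendsto_mul_zero_of_bdd h0 (Eventually.of_forall fun x => (hC x).1)
  exact tendsto_of_eq (h1.sub h2) (by simp [scatA])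

theorem tendsto_redFBar₂_atTop (hz : z ∈ upper) :
    Tendsto (fun x => redFBar₂ q r x z) atTop (𝓝 (scatABar q r z)) := by
  obtain ⟨C, hC⟩ := exists_norm_jostB_gauge_le q r hz
  have h1 := tendsto_jostA_atTop (gaugeU₂ q r) (gaugeV₂ q r) hz
  have h0 := ((tendsto_schwartz_atTop r).const_mul (Complex.I / 2)).mul (tendsto_E_atTop q r)
  rw [mul_zero, zero_mul] at h0
  have h2 := tendsto_mul_zero_of_bdd h0 (Eventually.of_forall fun x => (hC x).2.1)
  exact tendsto_of_eq (h1.add h2) (by simp [scatABar])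

theorem exists_norm_redFBar₁_le (hz : z ∈ upper) : ∃ C, ∀ x, ‖redFBar₁ q r x z‖ ≤ C := by
  obtain ⟨C, hC⟩ := exists_norm_jostB_gauge_le q r hz
  obtain ⟨D, hD⟩ := exists_norm_E_le q r
  refine ⟨D * C, fun x => ?_⟩
  rw [redFBar₁, norm_mul]
  exact mul_le_mul (hD x).1 (hC x).2.1 (norm_nonneg _) ((norm_nonneg _).trans (hD x).1)

theorem tendsto_redG₁_atTop (hz : z ∈ upper) : Tendsto (fun x => redG₁ q r x z) atTop (𝓝 0) := by
  exact tendsto_of_eq ((tendsto_E_atTop q r).mul ((tendsto_jostB_atBot (reflNeg (gaugeU₂ q r))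
    (reflNeg (gaugeV₂ q r)) hz).comp tendsto_neg_atTop_atBot)) (by simp)

theorem tendsto_redG₂_atTop (hz : z ∈ upper) : Tendsto (fun x => redG₂ q r x z) atTop (𝓝 1) := by
  have h1 := (tendsto_jostA_atBot (reflNeg (gaugeU₂ q r)) (reflNeg (gaugeV₂ q r)) hz).comp
    tendsto_neg_atTop_atBot
  have h2 := (((tendsto_schwartz_atTop r).const_mul (Complex.I / 2)).mul
    (tendsto_E_atTop q r)).mul ((tendsto_jostB_atBot (reflNeg (gaugeU₂ q r))
    (reflNeg (gaugeV₂ q r)) hz).comp tendsto_neg_atTop_atBot)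
  exact tendsto_of_eq (h1.add h2) (by simp)

theorem tendsto_redGBar₁_atTop (hz : z ∈ upper) :
    Tendsto (fun x => redGBar₁ q r x z) atTop (𝓝 1) := by
  have h1 := (tendsto_E_atTop q r).mul ((tendsto_jostA_atBot (reflNeg (gaugeU₁ q r))
    (reflNeg (gaugeV₁ q r)) hz).comp tendsto_neg_atTop_atBot)
  have h2 := ((tendsto_schwartz_atTop q).const_mul (Complex.I / 2)).mul
    ((tendsto_jostB_atBot (reflNeg (gaugeU₁ q r))
    (reflNeg (gaugeV₁ q r)) hz).comp tendsto_neg_atTop_atBot)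
  have h3 := (h1.sub h2).const_mul (Complex.exp (-(Complex.I * mu q r / 2)))
  rw [mul_zero, sub_zero, mul_one, ← Complex.exp_add, neg_add_cancel,
    Complex.exp_zero] at h3
  exact h3

theorem tendsto_redGBar₂_atTop (hz : z ∈ upper) :
    Tendsto (fun x => redGBar₂ q r x z) atTop (𝓝 0) := by
  exact tendsto_of_eq (((tendsto_jostB_atBot (reflNeg (gaugeU₁ q r))
    (reflNeg (gaugeV₁ q r)) hz).comp tendsto_neg_atTop_atBot).const_mul
      (Complex.exp (-(Complex.I * mu q r / 2)))) (by simp)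

theorem tendsto_exp_mul_redF₂_atTop (l : ℝ) :
    Tendsto (fun x : ℝ => Complex.exp (-(2 * Complex.I * l * x)) * redF₂ q r x l) atTop
      (𝓝 (jostN (gaugeU₁ q r) (gaugeV₁ q r) l)) :=
  tendsto_exp_mul_jostB_atTop _ _ l

theorem tendsto_exp_mul_redFBar₁_atTop (l : ℝ) :
    Tendsto (fun x : ℝ => Complex.exp (-(2 * Complex.I * l * x)) * redFBar₁ q r x l) atTop
      (𝓝 (Complex.exp (Complex.I * mu q r / 2) * jostN (gaugeU₂ q r) (gaugeV₂ q r) l)) := by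
  refine ((tendsto_E_atTop q r).mul (tendsto_exp_mul_jostB_atTop _ _ l)).congr fun x => ?_
  rw [redFBar₁]; ring

variable (q r) in
/-- The common factor of the Wronskians. -/
def wronskianFactor (x : ℝ) : ℂ := E q r x * Complex.exp (-(Complex.I * mu q r / 2))

theorem wronskianFactor_ne_zero : wronskianFactor q r x ≠ 0 :=
  mul_ne_zero (E_ne_zero q r x) (Complex.exp_ne_zero _)

/-- The multiple of `E` is fixed by the limit at `+∞`, where `wronskianFactor` tends to one. -/
theorem IsReduced.wronskian_eq {l a : ℂ} {y₁ y₂ w₁ w₂ : ℝ → ℂ} (hy : IsReduced q r l y₁ y₂)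
    (hw : IsReduced' q r l w₁ w₂)
    (ha : Tendsto (fun x => y₁ x * w₂ x - l * y₂ x * w₁ x) atTop (𝓝 a)) (x : ℝ) :
    y₁ x * w₂ x - l * y₂ x * w₁ x = a * wronskianFactor q r x := by
  obtain ⟨c, hc⟩ := hy.wronskian hw
  simp only [hc] at ha
  have := tendsto_nhds_unique ha ((tendsto_E_atTop q r).const_mul c)
  rw [hc, this, wronskianFactor]
  have h : Complex.exp (Complex.I * mu q r / 2) * Complex.exp (-(Complex.I * mu q r / 2)) = 1 := by
    rw [← Complex.exp_add, add_neg_cancel, Complex.exp_zero]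
  linear_combination (-(c * E q r x)) * h

theorem wronskian_redF_redG (hz : z ∈ upper) (x : ℝ) :
    redF₁ q r x z * redG₂ q r x z - z * redF₂ q r x z * redG₁ q r x z =
      scatA q r z * wronskianFactor q r x := by
  obtain ⟨C, hC⟩ := exists_norm_jostB_gauge_le q r hz
  refine (isReduced_redF hz).wronskian_eq (isReduced'_redG hz) ?_ x
  have h1 := (tendsto_redF₁_atTop (q := q) (r := r) hz).mul (tendsto_redG₂_atTop (q := q) (r := r) hz)
  have h2 := (tendsto_mul_zero_of_bdd (tendsto_redG₁_atTop (q := q) (r := r) hz)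
    (Eventually.of_forall fun x => (hC x).1)).const_mul z
  rw [mul_zero] at h2
  have h3 := h1.sub h2
  rw [mul_one, sub_zero] at h3
  refine h3.congr fun x => ?_
  rw [redF₂]; ring

theorem wronskian_redFBar_redGBar (hz : z ∈ upper) (x : ℝ) :
    redFBar₂ q r x z * redGBar₁ q r x z + z * redFBar₁ q r x z * redGBar₂ q r x z =
      scatABar q r z * wronskianFactor q r x := by
  obtain ⟨C, hC⟩ := exists_norm_redFBar₁_le (q := q) (r := r) hz
  have h := (isReduced_redGBar (q := q) (r := r) hz).wronskian_eq (isReduced'_redFBar hz)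
    (a := scatABar q r z) ?_ x
  · rw [← h]; ring
  have h1 := (tendsto_redFBar₂_atTop (q := q) (r := r) hz).mul (tendsto_redGBar₁_atTop (q := q) (r := r) hz)
  have h2 := (tendsto_mul_zero_of_bdd (tendsto_redGBar₂_atTop (q := q) (r := r) hz)
    (Eventually.of_forall fun x => hC x)).const_mul z
  rw [mul_zero] at h2
  have h3 := h1.add h2
  rw [mul_one, add_zero] at h3
  refine h3.congr fun x => ?_
  ring

end

section

variable {q r : 𝓢(ℝ, ℂ)} {x : ℝ} {z : ℂ}

/-! Expansion of the left Jost solutions in the right ones, on the real axis. -/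

theorem hasDerivAt_exp_real_mul (c : ℂ) (x : ℝ) :
    HasDerivAt (fun x : ℝ => Complex.exp (c * x)) (Complex.exp (c * x) * c) x := by
  simpa using ((hasDerivAt_id (x : ℂ)).const_mul c).cexp.comp_ofReal

variable (q r) in
/-- The interaction form of the reduced systems at `l = s t`. -/
def IsNormal (s t : ℂ) (l : ℝ) (y₁ y₂ : ℝ → ℂ) : Prop := ∀ x : ℝ,
  HasDerivAt y₁ (s * q x * Complex.exp (2 * Complex.I * l * x) * y₂ x) x ∧
  HasDerivAt y₂ (t * r x * Complex.exp (-(2 * Complex.I * l) * x) * y₁ x +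
    Complex.I / 2 * (q x * r x) * y₂ x) x

theorem exp_phase_mul_exp_neg (l : ℂ) (x : ℝ) :
    Complex.exp (2 * Complex.I * l * x) * Complex.exp (-(2 * Complex.I * l) * x) = 1 := by
  rw [← Complex.exp_add, neg_mul, add_neg_cancel, Complex.exp_zero]

/-- Moving the oscillation into the coefficients brings both reduced systems to one form.
Distributing `λ = s t` between the off-diagonal entries with `s` or `t` equal to one avoids division
by λ or ζ, so `λ = 0` needs no separate treatment. -/
theorem IsReduced.isNormal {s t : ℂ} {l : ℝ} (hst : s * t = l) {y₁ y₂ : ℝ → ℂ}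
    (hy : IsReduced q r l y₁ y₂) :
    IsNormal q r s t l y₁ (fun x => t * (Complex.exp (-(2 * Complex.I * l) * x) * y₂ x)) := by
  intro x
  have he := exp_phase_mul_exp_neg l x
  constructor
  · refine (hy x).1.congr_deriv ?_
    rw [← hst]
    rw [← hst] at he
    linear_combination (-(s * t * q x * y₂ x)) * he
  · refine (((hasDerivAt_exp_real_mul _ x).fun_mul (hy x).2).const_mul t).congr_deriv ?_
    ring

theorem IsReduced'.isNormal {s t : ℂ} {l : ℝ} (hst : s * t = l) {y₁ y₂ : ℝ → ℂ}
    (hy : IsReduced' q r l y₁ y₂) :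
    IsNormal q r s t l (fun x => s * (Complex.exp (2 * Complex.I * l * x) * y₁ x)) y₂ := by
  intro x
  have he := exp_phase_mul_exp_neg l x
  constructor
  · refine (((hasDerivAt_exp_real_mul _ x).fun_mul (hy x).1).const_mul s).congr_deriv ?_
    ring
  · refine (hy x).2.congr_deriv ?_
    rw [← hst]
    rw [← hst] at he
    linear_combination (-(s * t * r x * y₁ x)) * he

/-- The Wronskians of `d` with `y` and with `w` are multiples of `E` that vanish at `+∞`, hence
identically. At each point `d` then solves a homogeneous linear system whose determinant, the
Wronskian of `y` and `w`, is not zero. -/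
theorem IsNormal.eq_zero {s t : ℂ} {l : ℝ} {d₁ d₂ y₁ y₂ w₁ w₂ : ℝ → ℂ}
    (hd : IsNormal q r s t l d₁ d₂) (hy : IsNormal q r s t l y₁ y₂) (hw : IsNormal q r s t l w₁ w₂)
    (hd₁ : Tendsto d₁ atTop (𝓝 0)) (hd₂ : Tendsto d₂ atTop (𝓝 0))
    (hy₁ : Tendsto y₁ atTop (𝓝 1)) (hy₂ : Tendsto y₂ atTop (𝓝 0))
    (hw₁ : Tendsto w₁ atTop (𝓝 0)) (hw₂ : Tendsto w₂ atTop (𝓝 1)) (x : ℝ) :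
    d₁ x = 0 ∧ d₂ x = 0 := by
  have hdet : ∀ {a₁ a₂ b₁ b₂ : ℝ → ℂ}, IsNormal q r s t l a₁ a₂ → IsNormal q r s t l b₁ b₂ →
      ∃ c, ∀ x : ℝ, a₁ x * b₂ x - a₂ x * b₁ x = c * E q r x := by
    intro a₁ a₂ b₁ b₂ ha hb
    refine exists_eq_mul_of_hasDerivAt (hasDerivAt_E q r) (fun x => ?_) (E_ne_zero q r)
    refine (((ha x).1.fun_mul (hb x).2).fun_sub ((ha x).2.fun_mul (hb x).1)).congr_deriv ?_
    ring
  have hE0 : Complex.exp (Complex.I * mu q r / 2) ≠ 0 := Complex.exp_ne_zero _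
  obtain ⟨c, hc⟩ := hdet hd hy
  obtain ⟨c', hc'⟩ := hdet hd hw
  obtain ⟨e, he⟩ := hdet hy hw
  have lc := tendsto_of_eq ((hd₁.mul hy₂).sub (hd₂.mul hy₁)) (b := 0) (by simp)
  have lc' := tendsto_of_eq ((hd₁.mul hw₂).sub (hd₂.mul hw₁)) (b := 0) (by simp)
  have le := tendsto_of_eq ((hy₁.mul hw₂).sub (hy₂.mul hw₁)) (b := 1) (by simp)
  simp only [hc] at lc
  simp only [hc'] at lc'
  simp only [he] at le
  have kc := tendsto_nhds_unique lc ((tendsto_E_atTop q r).const_mul c)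
  have kc' := tendsto_nhds_unique lc' ((tendsto_E_atTop q r).const_mul c')
  have ke := tendsto_nhds_unique le ((tendsto_E_atTop q r).const_mul e)
  have hc0 : c = 0 := (mul_eq_zero.1 kc.symm).resolve_right hE0
  have hc0' : c' = 0 := (mul_eq_zero.1 kc'.symm).resolve_right hE0
  have he0 : e ≠ 0 := by rintro rfl; simp at ke
  have e1 := hc x
  have e2 := hc' x
  rw [hc0, zero_mul] at e1
  rw [hc0', zero_mul] at e2
  have e3 : y₁ x * w₂ x - y₂ x * w₁ x ≠ 0 := by
    rw [he]; exact mul_ne_zero he0 (E_ne_zero q r x)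
  constructor
  · refine (mul_eq_zero.1 (?_ : d₁ x * (y₁ x * w₂ x - y₂ x * w₁ x) = 0)).resolve_right e3
    linear_combination y₁ x * e2 - w₁ x * e1
  · refine (mul_eq_zero.1 (?_ : d₂ x * (y₁ x * w₂ x - y₂ x * w₁ x) = 0)).resolve_right e3
    linear_combination y₂ x * e2 - w₂ x * e1

theorem IsNormal.eq_add {s t : ℂ} {l : ℝ} {a b : ℂ} {d₁ d₂ y₁ y₂ w₁ w₂ : ℝ → ℂ}
    (hd : IsNormal q r s t l d₁ d₂) (hy : IsNormal q r s t l y₁ y₂) (hw : IsNormal q r s t l w₁ w₂)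
    (hd₁ : Tendsto d₁ atTop (𝓝 a)) (hd₂ : Tendsto d₂ atTop (𝓝 b))
    (hy₁ : Tendsto y₁ atTop (𝓝 1)) (hy₂ : Tendsto y₂ atTop (𝓝 0))
    (hw₁ : Tendsto w₁ atTop (𝓝 0)) (hw₂ : Tendsto w₂ atTop (𝓝 1)) (x : ℝ) :
    d₁ x = a * y₁ x + b * w₁ x ∧ d₂ x = a * y₂ x + b * w₂ x := by
  have hD : IsNormal q r s t l (fun x => d₁ x - a * y₁ x - b * w₁ x)
      (fun x => d₂ x - a * y₂ x - b * w₂ x) := by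
    intro x
    constructor
    · refine (((hd x).1.fun_sub ((hy x).1.const_mul a)).fun_sub
        ((hw x).1.const_mul b)).congr_deriv ?_
      ring
    · refine (((hd x).2.fun_sub ((hy x).2.const_mul a)).fun_sub
        ((hw x).2.const_mul b)).congr_deriv ?_
      ring
  obtain ⟨h1, h2⟩ := hD.eq_zero hy hw
    (tendsto_of_eq ((hd₁.sub (hy₁.const_mul a)).sub (hw₁.const_mul b)) (by simp))
    (tendsto_of_eq ((hd₂.sub (hy₂.const_mul a)).sub (hw₂.const_mul b)) (by simp)) hy₁ hy₂ hw₁ hw₂ x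
  constructor
  · linear_combination h1
  · linear_combination h2

theorem tendsto_const_mul_exp_mul_zero {f : ℝ → ℂ} (hf : Tendsto f atTop (𝓝 0)) (c : ℂ) {b : ℂ}
    (hb : b.re = 0) : Tendsto (fun x : ℝ => c * (Complex.exp (b * x) * f x)) atTop (𝓝 0) := by
  have h := tendsto_mul_zero_of_bdd (C := 1) (g := fun x : ℝ => Complex.exp (b * x)) hf
    (Eventually.of_forall fun x => by
      rw [Complex.norm_exp, Real.exp_le_one_iff]
      simp [hb])
  refine (tendsto_of_eq (h.const_mul c) (mul_zero c)).congr fun x => ?_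
  ring

/-- This is the expansion of φ in ψ̄ and ψ, with coefficients read off at `+∞`. It supplies the jump
of the Riemann–Hilbert problem on the real axis, where both right Jost solutions exist. -/
theorem redF_eq_add (l x : ℝ) :
    redF₁ q r x l = scatA q r l * redGBar₁ q r x (-l) + jostN (gaugeU₁ q r) (gaugeV₁ q r) l *
      (l * (Complex.exp (2 * Complex.I * l * x) * redG₁ q r x l)) ∧
    redF₂ q r x l = scatA q r l * redGBar₂ q r x (-l) + jostN (gaugeU₁ q r) (gaugeV₁ q r) l *
      (Complex.exp (2 * Complex.I * l * x) * redG₂ q r x l) := by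
  have hl := ofReal_mem_upper l
  have hl' : (-l : ℂ) ∈ upper := by simp
  have hGB := isReduced_redGBar (q := q) (r := r) hl'
  rw [neg_neg] at hGB
  have h := ((isReduced_redF (q := q) (r := r) hl).isNormal (s := l) (t := 1)
    (mul_one _)).eq_add (hGB.isNormal (mul_one _)) ((isReduced'_redG hl).isNormal (mul_one _))
    (tendsto_redF₁_atTop hl)
    (b := jostN (gaugeU₁ q r) (gaugeV₁ q r) l)
    (by simpa only [one_mul, neg_mul] using tendsto_exp_mul_redF₂_atTop (q := q) (r := r) l)
    (tendsto_redGBar₁_atTop hl')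
    (tendsto_const_mul_exp_mul_zero (tendsto_redGBar₂_atTop hl') _ (by simp))
    (tendsto_const_mul_exp_mul_zero (tendsto_redG₁_atTop hl) _ (by simp))
    (tendsto_redG₂_atTop hl) x
  refine ⟨h.1, ?_⟩
  have he := exp_phase_mul_exp_neg l x
  linear_combination Complex.exp (2 * Complex.I * l * x) * h.2 -
    (redF₂ q r x l - scatA q r l * redGBar₂ q r x (-l)) * he

theorem redFBar_eq_add (m x : ℝ) :
    redFBar₁ q r x m = scatABar q r m * redG₁ q r x (-m) +
      Complex.exp (Complex.I * mu q r / 2) * jostN (gaugeU₂ q r) (gaugeV₂ q r) m *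
      (Complex.exp (2 * Complex.I * m * x) * redGBar₁ q r x m) ∧
    redFBar₂ q r x m = scatABar q r m * redG₂ q r x (-m) -
      Complex.exp (Complex.I * mu q r / 2) * jostN (gaugeU₂ q r) (gaugeV₂ q r) m *
      (m * (Complex.exp (2 * Complex.I * m * x) * redGBar₂ q r x m)) := by
  have hm := ofReal_mem_upper m
  have hm' : (-m : ℂ) ∈ upper := by simp
  have hst : (1 : ℂ) * (-m : ℝ) = (-m : ℝ) := one_mul _
  have hF := isReduced'_redFBar (q := q) (r := r) hm
  have hGB := isReduced_redGBar (q := q) (r := r) hm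
  have hG := isReduced'_redG (q := q) (r := r) hm'
  rw [← Complex.ofReal_neg] at hF hGB hG
  have h := (hF.isNormal hst).eq_add (hGB.isNormal hst) (hG.isNormal hst)
    (a := Complex.exp (Complex.I * mu q r / 2) * jostN (gaugeU₂ q r) (gaugeV₂ q r) m)
    ((tendsto_exp_mul_redFBar₁_atTop (q := q) (r := r) m).congr fun x => by
      rw [one_mul]; congr 2; push_cast; ring)
    (tendsto_redFBar₂_atTop hm)
    (tendsto_redGBar₁_atTop hm)
    (tendsto_const_mul_exp_mul_zero (tendsto_redGBar₂_atTop hm) _ (by simp))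
    (tendsto_const_mul_exp_mul_zero (tendsto_redG₁_atTop (by simp)) _ (by simp))
    (tendsto_redG₂_atTop (by simp)) x
  have he := exp_phase_mul_exp_neg m x
  obtain ⟨h1, h2⟩ := h
  have e1 : (2 * Complex.I * ((-m : ℝ) : ℂ) * x) = -(2 * Complex.I * m) * x := by push_cast; ring
  have e2 : (-(2 * Complex.I * ((-m : ℝ) : ℂ)) * x) = 2 * Complex.I * m * x := by push_cast; ring
  rw [e1] at h1
  rw [e2] at h2
  push_cast at h1 h2
  constructor
  · linear_combination Complex.exp (2 * Complex.I * m * x) * h1 -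
      (redFBar₁ q r x m - scatABar q r m * redG₁ q r x (-m)) * he
  · linear_combination h2

/-! Uniqueness of the Jost solutions. -/

theorem isSolution_iff {q r : ℝ → ℂ} {ζ : ℂ} {f : ℝ → Fin 2 → ℂ} : IsSolution q r ζ f ↔ ∀ x,
    HasDerivAt (fun x => f x 0) (-Complex.I * ζ ^ 2 * f x 0 + ζ * q x * f x 1) x ∧
    HasDerivAt (fun x => f x 1) (ζ * r x * f x 0 +
      (Complex.I * ζ ^ 2 + Complex.I / 2 * (q x * r x)) * f x 1) x := by
  refine forall_congr' fun x => ?_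
  rw [hasDerivAt_pi, Fin.forall_fin_two]
  simp [laxMatrix, Matrix.mulVec, dotProduct, Fin.sum_univ_two]

theorem IsSolution.unique {ζ : ℂ} {f g : ℝ → Fin 2 → ℂ} (hf : IsSolution q r ζ f)
    (hg : IsSolution q r ζ g) {x₀ : ℝ} (h : f x₀ = g x₀) : f = g := by
  obtain ⟨Cq, hCq0, hCq⟩ := exists_norm_le q
  obtain ⟨Cr, hCr0, hCr⟩ := exists_norm_le r
  set K : ℝ := ‖ζ‖ ^ 2 + ‖ζ‖ * Cq + ‖ζ‖ * Cr + 1 / 2 * (Cq * Cr) with hK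
  have hK0 : 0 ≤ K := by positivity
  refine ODE_solution_unique_univ (v := fun x y => (laxMatrix q r ζ x).mulVec y) (s := fun _ => univ)
    (K := K.toNNReal) (t₀ := x₀) (fun t => ?_) (fun t => ⟨hf t, mem_univ _⟩)
    (fun t => ⟨hg t, mem_univ _⟩) h
  refine LipschitzWith.lipschitzOnWith (LipschitzWith.of_dist_le_mul fun a b => ?_)
  rw [dist_eq_norm, dist_eq_norm, ← Matrix.mulVec_sub, Real.coe_toNNReal _ hK0]
  have h0 : ‖(a - b) 0‖ ≤ ‖a - b‖ := norm_le_pi_norm _ 0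
  have h1 : ‖(a - b) 1‖ ≤ ‖a - b‖ := norm_le_pi_norm _ 1
  refine (pi_norm_le_iff_of_nonneg (by positivity)).2 ?_
  rw [Fin.forall_fin_two]
  have n1 : ‖Complex.I * ζ ^ 2‖ = ‖ζ‖ ^ 2 := by simp
  have n2 : ‖Complex.I / 2 * (q t * r t)‖ ≤ 1 / 2 * (Cq * Cr) := by
    rw [norm_mul, norm_div, Complex.norm_I, Complex.norm_ofNat, norm_mul]
    gcongr
    exacts [hCq t, hCr t]
  constructor
  · have : (laxMatrix q r ζ t).mulVec (a - b) 0 =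
        -(Complex.I * ζ ^ 2) * (a - b) 0 + ζ * q t * (a - b) 1 := by
      simp [laxMatrix, Matrix.mulVec, dotProduct, Fin.sum_univ_two]
    rw [this]
    calc _ ≤ ‖ζ‖ ^ 2 * ‖a - b‖ + ‖ζ‖ * Cq * ‖a - b‖ := by
          refine norm_add_le_of_le ?_ ?_
          · rw [norm_mul, norm_neg, n1]; gcongr
          · rw [norm_mul, norm_mul]; gcongr; exact hCq t
      _ ≤ K * ‖a - b‖ := by
          rw [← add_mul]; gcongr; rw [hK]
          have : 0 ≤ ‖ζ‖ * Cr + 1 / 2 * (Cq * Cr) := by positivity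
          linarith
  · have : (laxMatrix q r ζ t).mulVec (a - b) 1 = ζ * r t * (a - b) 0 +
        (Complex.I * ζ ^ 2 + Complex.I / 2 * (q t * r t)) * (a - b) 1 := by
      simp [laxMatrix, Matrix.mulVec, dotProduct, Fin.sum_univ_two]
    rw [this]
    calc _ ≤ ‖ζ‖ * Cr * ‖a - b‖ + (‖ζ‖ ^ 2 + 1 / 2 * (Cq * Cr)) * ‖a - b‖ := by
          refine norm_add_le_of_le ?_ ?_
          · rw [norm_mul, norm_mul]; gcongr; exact hCr t
          · rw [norm_mul]; gcongr
            exact norm_add_le_of_le n1.le n2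
      _ ≤ K * ‖a - b‖ := by
          rw [← add_mul]; gcongr; rw [hK]
          have : 0 ≤ ‖ζ‖ * Cq := by positivity
          linarith

/-- A vanishing Wronskian makes the two solutions proportional at a point where `y` has a nonzero
component, hence everywhere by uniqueness for the initial value problem; the common normalization
fixes the factor. -/
theorem IsSolution.eq_of_wronskian {ζ : ℂ} {f y : ℝ → Fin 2 → ℂ} (hf : IsSolution q r ζ f)
    (hy : IsSolution q r ζ y) {L : Filter ℝ} [L.NeBot] {e : ℂ} (he : e ≠ 0)
    (hE : Tendsto (E q r) L (𝓝 e))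
    (hW : Tendsto (fun x => f x 0 * y x 1 - f x 1 * y x 0) L (𝓝 0)) {i : Fin 2} {n : ℝ → ℂ}
    (hn : Tendsto (fun x => n x * y x i) L (𝓝 1)) (hn' : Tendsto (fun x => n x * f x i) L (𝓝 1)) :
    f = y := by
  have hf' := isSolution_iff.1 hf
  have hy' := isSolution_iff.1 hy
  obtain ⟨c, hc⟩ := exists_eq_mul_of_hasDerivAt (W := fun x => f x 0 * y x 1 - f x 1 * y x 0)
    (hasDerivAt_E q r) (fun x => by
      refine (((hf' x).1.fun_mul (hy' x).2).fun_sub ((hf' x).2.fun_mul (hy' x).1)).congr_deriv ?_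
      ring) (E_ne_zero q r)
  have hc0 : c = 0 := by
    simp only [hc] at hW
    exact (mul_eq_zero.1 (tendsto_nhds_unique hW (hE.const_mul c)).symm).resolve_right he
  obtain ⟨x₀, hx₀⟩ : ∃ x, n x * y x i ≠ 0 :=
    (hn.eventually_ne one_ne_zero).exists
  have hyi : y x₀ i ≠ 0 := right_ne_zero_of_mul hx₀
  have hpar := hc x₀
  rw [hc0, zero_mul] at hpar
  have hfy : f = fun x => (f x₀ i / y x₀ i) • y x := by
    have hsol : IsSolution q r ζ fun x => (f x₀ i / y x₀ i) • y x := by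
      intro x
      refine ((hy x).const_smul (f x₀ i / y x₀ i)).congr_deriv ?_
      rw [Matrix.mulVec_smul]
    refine hf.unique hsol (x₀ := x₀) ?_
    funext j
    simp only [Pi.smul_apply, smul_eq_mul]
    fin_cases i <;> fin_cases j <;> simp at hyi ⊢ <;> field_simp <;>
      first | linear_combination hpar | linear_combination -hpar
  have : f x₀ i / y x₀ i = 1 := by
    have h1 := hn.const_mul (f x₀ i / y x₀ i)
    rw [mul_one] at h1
    refine tendsto_nhds_unique (h1.congr fun x => ?_) hn'
    rw [congrFun hfy x]
    simp only [Pi.smul_apply, smul_eq_mul]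
    rw [congrFun hfy x₀]
    simp only [Pi.smul_apply, smul_eq_mul]
    field_simp
  rw [hfy, this]
  simp

end

section

variable {q r : 𝓢(ℝ, ℂ)} {x : ℝ} {z : ℂ}

/-! Identification of the Jost solutions and of the scattering coefficients. -/

theorem root_sq (l : ℂ) : root l ^ 2 = l := by
  rw [root, ← Complex.cpow_nat_mul]
  norm_num

theorem root_ne_zero {l : ℂ} (hl : l ≠ 0) : root l ≠ 0 := fun h => hl (by rw [← root_sq l, h]; simp)

/-- The weak condition `o(1)` on one component is enough: the exponential has modulus at most one at
the relevant end, so the Wronskian with the constructed solution still tends to zero. Thus the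
solution picked by `Classical.epsilon` is the constructed one. -/
theorem jost_unique {ζ l e : ℂ} {y₁ y₂ : ℝ → ℂ} (hζ : ζ ^ 2 = l) (hy : IsReduced q r l y₁ y₂)
    {L : Filter ℝ} [L.NeBot] (he : e ≠ 0) (hE : Tendsto (E q r) L (𝓝 e))
    (hexp : ∀ᶠ x : ℝ in L, ‖Complex.exp (-(Complex.I * l * x))‖ ≤ 1)
    (h₁ : Tendsto y₁ L (𝓝 1)) (h₂ : Tendsto y₂ L (𝓝 0)) :
    let y : ℝ → Fin 2 → ℂ := fun x => ![Complex.exp (-(Complex.I * l * x)) * y₁ x,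
      ζ * (Complex.exp (-(Complex.I * l * x)) * y₂ x)]
    let P : (ℝ → Fin 2 → ℂ) → Prop := fun f => IsSolution q r ζ f ∧
      Tendsto (fun x : ℝ => Complex.exp (Complex.I * ζ ^ 2 * x) * f x 0) L (𝓝 1) ∧
      Tendsto (fun x => f x 1) L (𝓝 0)
    Classical.epsilon P = y := by
  intro y P
  have hinv : ∀ x : ℝ, Complex.exp (Complex.I * l * x) * Complex.exp (-(Complex.I * l * x)) = 1 :=
    fun x => by rw [← Complex.exp_add, add_neg_cancel, Complex.exp_zero]
  have hsol : IsSolution q r ζ y := by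
    rw [isSolution_iff]
    intro x
    have hd : HasDerivAt (fun x : ℝ => Complex.exp (-(Complex.I * l * x)))
        (Complex.exp (-(Complex.I * l * x)) * -(Complex.I * l)) x := by
      simpa only [neg_mul] using hasDerivAt_exp_real_mul (-(Complex.I * l)) x
    constructor
    · refine (hd.fun_mul (hy x).1).congr_deriv ?_
      simp only [y, Matrix.cons_val_zero, Matrix.cons_val_one]
      rw [← hζ]; ring
    · refine ((hd.fun_mul (hy x).2).const_mul ζ).congr_deriv ?_
      simp only [y, Matrix.cons_val_zero, Matrix.cons_val_one]
      rw [← hζ]; ring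
  have hy1 : Tendsto (fun x : ℝ => Complex.exp (Complex.I * ζ ^ 2 * x) * y x 0) L (𝓝 1) := by
    refine h₁.congr fun x => ?_
    simp only [y, Matrix.cons_val_zero]
    rw [hζ]
    linear_combination (-y₁ x) * hinv x
  have hy2 : Tendsto (fun x => y x 1) L (𝓝 0) := by
    refine (tendsto_of_eq ((tendsto_mul_zero_of_bdd h₂ hexp).const_mul ζ) (mul_zero _)).congr
      fun x => ?_
    simp only [y, Matrix.cons_val_zero, Matrix.cons_val_one]
    ring
  have hP : P y := ⟨hsol, hy1, hy2⟩
  obtain ⟨hs, hs1, hs2⟩ := Classical.epsilon_spec (p := P) ⟨y, hP⟩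
  refine hs.eq_of_wronskian hsol he hE ?_ hy1 hs1
  have t1 := hs1.mul ((tendsto_mul_zero_of_bdd (tendsto_mul_zero_of_bdd h₂ hexp) hexp).const_mul ζ)
  have t2 := (tendsto_mul_zero_of_bdd hs2 hexp).mul h₁
  refine (tendsto_of_eq (t1.sub t2) (by simp)).congr fun x => ?_
  simp only [y, Matrix.cons_val_zero, Matrix.cons_val_one]
  rw [hζ]
  linear_combination (Classical.epsilon P x 0 * ζ * y₂ x * Complex.exp (-(Complex.I * l * x))) *
    hinv x

theorem jost_unique' {ζ l e : ℂ} {y₁ y₂ : ℝ → ℂ} (hζ : ζ ^ 2 = l) (hy : IsReduced' q r l y₁ y₂)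
    {L : Filter ℝ} [L.NeBot] (he : e ≠ 0) (hE : Tendsto (E q r) L (𝓝 e))
    (hexp : ∀ᶠ x : ℝ in L, ‖Complex.exp (Complex.I * l * x)‖ ≤ 1)
    (h₁ : Tendsto y₁ L (𝓝 0)) (h₂ : Tendsto y₂ L (𝓝 1)) :
    let y : ℝ → Fin 2 → ℂ := fun x => ![ζ * (Complex.exp (Complex.I * l * x) * y₁ x),
      Complex.exp (Complex.I * l * x) * y₂ x]
    let P : (ℝ → Fin 2 → ℂ) → Prop := fun f => IsSolution q r ζ f ∧
      Tendsto (fun x => f x 0) L (𝓝 0) ∧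
      Tendsto (fun x : ℝ => Complex.exp (-Complex.I * ζ ^ 2 * x) * f x 1) L (𝓝 1)
    Classical.epsilon P = y := by
  intro y P
  have hinv : ∀ x : ℝ, Complex.exp (Complex.I * l * x) * Complex.exp (-Complex.I * l * x) = 1 :=
    fun x => by rw [← Complex.exp_add, ← Complex.exp_zero]; congr 1; ring
  have hsol : IsSolution q r ζ y := by
    rw [isSolution_iff]
    intro x
    have hd := hasDerivAt_exp_real_mul (Complex.I * l) x
    constructor
    · refine ((hd.fun_mul (hy x).1).const_mul ζ).congr_deriv ?_
      simp only [y, Matrix.cons_val_zero, Matrix.cons_val_one]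
      rw [← hζ]; ring
    · refine (hd.fun_mul (hy x).2).congr_deriv ?_
      simp only [y, Matrix.cons_val_zero, Matrix.cons_val_one]
      rw [← hζ]; ring
  have hy2 : Tendsto (fun x : ℝ => Complex.exp (-Complex.I * ζ ^ 2 * x) * y x 1) L (𝓝 1) := by
    refine h₂.congr fun x => ?_
    simp only [y, Matrix.cons_val_zero, Matrix.cons_val_one]
    rw [hζ]
    linear_combination (-y₂ x) * hinv x
  have hy1 : Tendsto (fun x => y x 0) L (𝓝 0) := by
    refine (tendsto_of_eq ((tendsto_mul_zero_of_bdd h₁ hexp).const_mul ζ) (mul_zero _)).congr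
      fun x => ?_
    simp only [y, Matrix.cons_val_zero]
    ring
  have hP : P y := ⟨hsol, hy1, hy2⟩
  obtain ⟨hs, hs1, hs2⟩ := Classical.epsilon_spec (p := P) ⟨y, hP⟩
  refine hs.eq_of_wronskian hsol he hE ?_ hy2 hs2
  have t1 := (tendsto_mul_zero_of_bdd hs1 hexp).mul h₂
  have t2 := hs2.mul ((tendsto_mul_zero_of_bdd (tendsto_mul_zero_of_bdd h₁ hexp) hexp).const_mul ζ)
  refine (tendsto_of_eq (t1.sub t2) (by simp)).congr fun x => ?_
  simp only [y, Matrix.cons_val_zero, Matrix.cons_val_one]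
  rw [hζ]
  linear_combination (-(Classical.epsilon P x 1 * ζ * y₁ x * Complex.exp (Complex.I * l * x))) *
    hinv x

theorem eventually_norm_exp_le_one_atTop (hz : z ∈ upper) :
    ∀ᶠ x : ℝ in atTop, ‖Complex.exp (Complex.I * z * x)‖ ≤ 1 :=
  (eventually_ge_atTop 0).mono fun _ hx => norm_exp_I_mul_le hz hx

theorem eventually_norm_exp_le_one_atBot (hz : z ∈ upper) :
    ∀ᶠ x : ℝ in atBot, ‖Complex.exp (-(Complex.I * z * x))‖ ≤ 1 := by
  filter_upwards [eventually_le_atBot 0] with x hx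
  have := norm_exp_I_mul_le hz (neg_nonneg.2 hx)
  simpa using this

theorem phi_eq {ζ : ℂ} (hz : z ∈ upper) (hζ : ζ ^ 2 = z) :
    phi q r ζ = fun x : ℝ => ![Complex.exp (-(Complex.I * z * x)) * redF₁ q r x z,
      ζ * (Complex.exp (-(Complex.I * z * x)) * redF₂ q r x z)] :=
  jost_unique hζ (isReduced_redF hz) one_ne_zero (tendsto_E_atBot q r)
    (eventually_norm_exp_le_one_atBot hz) (tendsto_redF₁_atBot hz) (tendsto_redF₂_atBot hz)

theorem psiBar_eq {ζ : ℂ} (hz : z ∈ upper) (hζ : ζ ^ 2 = -z) :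
    psiBar q r ζ = fun x : ℝ => ![Complex.exp (-(Complex.I * -z * x)) * redGBar₁ q r x z,
      ζ * (Complex.exp (-(Complex.I * -z * x)) * redGBar₂ q r x z)] :=
  jost_unique hζ (isReduced_redGBar hz) (Complex.exp_ne_zero _) (tendsto_E_atTop q r)
    (by simpa using eventually_norm_exp_le_one_atTop hz) (tendsto_redGBar₁_atTop hz)
    (tendsto_redGBar₂_atTop hz)

theorem psi_eq {ζ : ℂ} (hz : z ∈ upper) (hζ : ζ ^ 2 = z) :
    psi q r ζ = fun x : ℝ => ![ζ * (Complex.exp (Complex.I * z * x) * redG₁ q r x z),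
      Complex.exp (Complex.I * z * x) * redG₂ q r x z] :=
  jost_unique' hζ (isReduced'_redG hz) (Complex.exp_ne_zero _) (tendsto_E_atTop q r)
    (eventually_norm_exp_le_one_atTop hz) (tendsto_redG₁_atTop hz) (tendsto_redG₂_atTop hz)

theorem phiBar_eq {ζ : ℂ} (hz : z ∈ upper) (hζ : ζ ^ 2 = -z) :
    phiBar q r ζ = fun x : ℝ => ![ζ * (Complex.exp (Complex.I * -z * x) * redFBar₁ q r x z),
      Complex.exp (Complex.I * -z * x) * redFBar₂ q r x z] :=
  jost_unique' hζ (isReduced'_redFBar hz) one_ne_zero (tendsto_E_atBot q r)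
    (by simpa using eventually_norm_exp_le_one_atBot hz) (tendsto_redFBar₁_atBot hz)
    (tendsto_redFBar₂_atBot hz)

theorem invT_eq {ζ : ℂ} (hz : z ∈ upper) (hζ : ζ ^ 2 = z) : invT q r ζ = scatA q r z := by
  refine Tendsto.limUnder_eq ((tendsto_redF₁_atTop hz).congr fun x => ?_)
  rw [phi_eq hz hζ, hζ]
  simp only [Matrix.cons_val_zero]
  rw [← mul_assoc, ← Complex.exp_add, add_neg_cancel, Complex.exp_zero, one_mul]

theorem invTBar_eq {ζ : ℂ} (hz : z ∈ upper) (hζ : ζ ^ 2 = -z) :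
    invTBar q r ζ = scatABar q r z := by
  refine Tendsto.limUnder_eq ((tendsto_redFBar₂_atTop hz).congr fun x => ?_)
  rw [phiBar_eq hz hζ, hζ]
  simp only [Matrix.cons_val_zero, Matrix.cons_val_one]
  rw [← mul_assoc, ← Complex.exp_add, show -Complex.I * -z * x + Complex.I * -z * x = 0 by ring,
    Complex.exp_zero, one_mul]

/-- The reflection coefficient is ζ times a function of λ, so the choice of the square root does not
enter its quotient by ζ. -/
theorem R_eq {ζ : ℂ} {l : ℝ} (hζ : ζ ^ 2 = l) :
    R q r ζ = ζ * (jostN (gaugeU₁ q r) (gaugeV₁ q r) l / scatA q r l) := by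
  have hl := ofReal_mem_upper l
  have : (limUnder atTop fun x : ℝ => Complex.exp (-Complex.I * ζ ^ 2 * x) * phi q r ζ x 1) =
      ζ * jostN (gaugeU₁ q r) (gaugeV₁ q r) l := by
    refine Tendsto.limUnder_eq (((tendsto_exp_mul_redF₂_atTop (q := q) (r := r) l).const_mul
      ζ).congr fun x => ?_)
    rw [phi_eq hl hζ, hζ]
    simp only [Matrix.cons_val_zero, Matrix.cons_val_one]
    have e : Complex.exp (-(2 * Complex.I * l * x)) =
        Complex.exp (-Complex.I * l * x) * Complex.exp (-(Complex.I * l * x)) := by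
      rw [← Complex.exp_add]; congr 1; ring
    rw [e]; ring
  rw [R, this, T, invT_eq hl hζ]
  ring

theorem RBar_eq {ζ : ℂ} {m : ℝ} (hζ : ζ ^ 2 = -m) :
    RBar q r ζ = ζ * (Complex.exp (Complex.I * mu q r / 2) *
      jostN (gaugeU₂ q r) (gaugeV₂ q r) m / scatABar q r m) := by
  have hm := ofReal_mem_upper m
  have : (limUnder atTop fun x : ℝ => Complex.exp (Complex.I * ζ ^ 2 * x) * phiBar q r ζ x 0) =
      ζ * (Complex.exp (Complex.I * mu q r / 2) * jostN (gaugeU₂ q r) (gaugeV₂ q r) m) := by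
    refine Tendsto.limUnder_eq (((tendsto_exp_mul_redFBar₁_atTop (q := q) (r := r) m).const_mul
      ζ).congr fun x => ?_)
    rw [phiBar_eq hm hζ, hζ]
    simp only [Matrix.cons_val_zero]
    have e : Complex.exp (-(2 * Complex.I * m * x)) =
        Complex.exp (Complex.I * -m * x) * Complex.exp (Complex.I * -m * x) := by
      rw [← Complex.exp_add]; congr 1; ring
    rw [e]; ring
  rw [RBar, this, TBar, invTBar_eq hm hζ]
  ring

end

section

/-! The kernel of a matrix triplet. -/

/-- The entries `e^{sl} s^k / k!` of the exponential of a Jordan block. -/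
def jordanExp (l : ℂ) (k : ℕ) (s : ℂ) : ℂ := Complex.exp (s * l) * (s ^ k / k.factorial)

theorem hasDerivAt_jordanExp_zero (l s : ℂ) :
    HasDerivAt (jordanExp l 0) (l * jordanExp l 0 s) s := by
  have h := ((hasDerivAt_id s).mul_const l).cexp
  simp only [id, one_mul] at h
  have e : jordanExp l 0 = fun s => Complex.exp (s * l) := by funext s; simp [jordanExp]
  rw [e]
  exact h.congr_deriv (mul_comm _ _)

theorem hasDerivAt_jordanExp_succ (l : ℂ) (k : ℕ) (s : ℂ) :
    HasDerivAt (jordanExp l (k + 1)) (l * jordanExp l (k + 1) s + jordanExp l k s) s := by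
  have h := ((hasDerivAt_id s).mul_const l).cexp.fun_mul
    (((hasDerivAt_id s).fun_pow (k + 1)).div_const ((k + 1).factorial : ℂ))
  refine h.congr_deriv ?_
  have h1 : ((k.factorial : ℕ) : ℂ) ≠ 0 := by exact_mod_cast k.factorial_ne_zero
  have h2 : ((k : ℂ) + 1) ≠ 0 := by exact_mod_cast k.succ_ne_zero
  simp only [jordanExp, id, one_mul, mul_one, Nat.factorial_succ, Nat.cast_mul, Nat.cast_succ,
    Nat.add_sub_cancel]
  field_simp

theorem jordanExp_add (l : ℂ) (k : ℕ) (s t : ℂ) :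
    jordanExp l k (s + t) = ∑ i ∈ Finset.range (k + 1), jordanExp l (k - i) s * jordanExp l i t := by
  have h1 : ((k.factorial : ℕ) : ℂ) ≠ 0 := by exact_mod_cast k.factorial_ne_zero
  rw [jordanExp, add_mul, Complex.exp_add, add_comm s t, add_pow, Finset.sum_div, Finset.mul_sum]
  refine Finset.sum_congr rfl fun i hi => ?_
  have hik : i ≤ k := Nat.lt_succ_iff.1 (Finset.mem_range.1 hi)
  have h2 := Nat.choose_mul_factorial_mul_factorial hik
  have h3 : ((i.factorial : ℕ) : ℂ) ≠ 0 := by exact_mod_cast i.factorial_ne_zero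
  have h4 : (((k - i).factorial : ℕ) : ℂ) ≠ 0 := by exact_mod_cast (k - i).factorial_ne_zero
  have h5 : (k.choose i : ℂ) * i.factorial * (k - i).factorial = k.factorial := by
    exact_mod_cast h2
  have h6 : (k.choose i : ℂ) = k.factorial / (i.factorial * (k - i).factorial) := by
    rw [← h5]; field_simp
  rw [jordanExp, jordanExp, h6]
  field_simp

/-- The function `e^{sA} B`. -/
def BoundStates.expVec (D : BoundStates) (s : ℂ) : D.Idx → ℂ := fun i =>
  jordanExp (D.pole i.1) (i.2.rev : ℕ) s

theorem BoundStates.expVec_zero (D : BoundStates) : D.expVec 0 = D.B := by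
  funext i
  have : ((i.2.rev : ℕ) = 0) ↔ ((i.2 : ℕ) + 1 = D.mult i.1) := by
    rw [Fin.val_rev]; have := i.2.2; omega
  by_cases h : (i.2 : ℕ) + 1 = D.mult i.1
  · have h0 := this.2 h
    simp only [expVec, jordanExp, B, if_pos h, h0]
    simp
  · have h0 : (i.2.rev : ℕ) ≠ 0 := fun h' => h (this.1 h')
    simp only [expVec, jordanExp, B, if_neg h]
    rw [zero_pow h0, zero_div, mul_zero]

theorem BoundStates.A_mulVec (D : BoundStates) (v : D.Idx → ℂ) (i : D.Idx) :
    D.A.mulVec v i = D.pole i.1 * v i +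
      if h : (i.2 : ℕ) + 1 < D.mult i.1 then v ⟨i.1, ⟨i.2 + 1, h⟩⟩ else 0 := by
  obtain ⟨j, p⟩ := i
  have h1 : D.A.mulVec v ⟨j, p⟩ = ∑ s : Fin (D.mult j), D.block j p s * v ⟨j, s⟩ := by
    rw [Matrix.mulVec, dotProduct, Fintype.sum_sigma, Finset.sum_eq_single j]
    · simp [A, Matrix.blockDiagonal'_apply]
    · intro j' _ hj'
      refine Finset.sum_eq_zero fun s _ => ?_
      rw [A, Matrix.blockDiagonal'_apply_ne _ _ _ (Ne.symm hj'), zero_mul]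
    · simp
  rw [h1]
  have h2 : ∀ s : Fin (D.mult j), D.block j p s * v ⟨j, s⟩ =
      (if p = s then D.pole j * v ⟨j, s⟩ else 0) +
      (if (p : ℕ) + 1 = s then v ⟨j, s⟩ else 0) := by
    intro s
    rw [block, Matrix.of_apply]
    by_cases hps : p = s
    · subst hps; simp
    · simp [hps]
  simp only [h2, Finset.sum_add_distrib, Finset.sum_ite_eq, Finset.mem_univ, if_true]
  congr 1
  split_ifs with h
  · rw [Finset.sum_eq_single ⟨p + 1, h⟩]
    · rw [if_pos rfl]
    · intro s _ hs
      rw [if_neg]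
      rintro h'
      exact hs (Fin.ext h'.symm)
    · simp
  · refine Finset.sum_eq_zero fun s _ => ?_
    rw [if_neg]
    have := s.2
    omega

theorem BoundStates.hasDerivAt_expVec (D : BoundStates) (s : ℂ) :
    HasDerivAt D.expVec (D.A.mulVec (D.expVec s)) s := by
  rw [hasDerivAt_pi]
  intro i
  rw [A_mulVec]
  by_cases h : (i.2 : ℕ) + 1 < D.mult i.1
  · rw [dif_pos h]
    have e : (i.2.rev : ℕ) = ((⟨i.2 + 1, h⟩ : Fin (D.mult i.1)).rev : ℕ) + 1 := by
      rw [Fin.val_rev, Fin.val_rev]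
      change _ = D.mult i.1 - (i.2 + 1 + 1) + 1
      omega
    simp only [expVec]
    rw [e]
    exact hasDerivAt_jordanExp_succ _ _ _
  · rw [dif_neg h, add_zero]
    have e : (i.2.rev : ℕ) = 0 := by
      rw [Fin.val_rev]; omega
    simp only [expVec]
    rw [e]
    exact hasDerivAt_jordanExp_zero _ _

-- The vector `e^{-sA} v(s)`, with `v` the explicit candidate, has zero derivative and equals `B` at
-- `s = 0`. This replaces a computation of the full exponential of a Jordan block.
open scoped Matrix.Norms.Operator in
theorem BoundStates.exp_mulVec_B (D : BoundStates) (s : ℂ) :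
    (NormedSpace.exp (s • D.A)).mulVec D.B = D.expVec s := by
  have hd : ∀ s, HasDerivAt (fun s : ℂ => (NormedSpace.exp ((-s) • D.A)).mulVec (D.expVec s)) 0 s := by
    intro s
    have h1 : HasDerivAt (fun s : ℂ => NormedSpace.exp (s • D.A))
        (NormedSpace.exp ((-s) • D.A) * D.A) (-s) := hasDerivAt_exp_smul_const D.A (-s)
    have h2 := h1.scomp s (hasDerivAt_neg s)
    rw [hasDerivAt_pi]
    intro i
    have h3 : ∀ j, HasDerivAt (fun s : ℂ => NormedSpace.exp ((-s) • D.A) i j)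
        (-(NormedSpace.exp ((-s) • D.A) * D.A) i j) s := by
      intro j
      refine ((LinearMap.toContinuousLinearMap
        (Matrix.entryLinearMap ℂ ℂ i j)).hasFDerivAt.comp_hasDerivAt s h2).congr_deriv ?_
      change (-1 : ℂ) * (NormedSpace.exp ((-s) • D.A) * D.A) i j = _
      ring
    have h4 := hasDerivAt_pi.1 (D.hasDerivAt_expVec s)
    refine (HasDerivAt.fun_sum (u := Finset.univ) fun j _ => (h3 j).fun_mul (h4 j)).congr_deriv ?_
    rw [Finset.sum_add_distrib]
    have e1 : ∑ j, NormedSpace.exp ((-s) • D.A) i j * D.A.mulVec (D.expVec s) j =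
        (NormedSpace.exp ((-s) • D.A) * D.A).mulVec (D.expVec s) i := by
      rw [← Matrix.mulVec_mulVec]; rfl
    rw [e1]
    simp [Matrix.mulVec, dotProduct]
  have hc := is_const_of_deriv_eq_zero (fun s => (hd s).differentiableAt) (fun s => (hd s).deriv) s 0
  simp only [neg_zero, zero_smul, NormedSpace.exp_zero, Matrix.one_mulVec, D.expVec_zero] at hc
  rw [← hc, Matrix.mulVec_mulVec, neg_smul,
    ← Matrix.exp_add_of_commute _ _ (Commute.neg_right (Commute.refl (s • D.A))), add_neg_cancel,
    NormedSpace.exp_zero, Matrix.one_mulVec]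

theorem BoundStates.kernel_eq (D : BoundStates) (s : ℂ) :
    D.kernel s = ∑ j, ∑ k, D.c j k * jordanExp (D.pole j) k s := by
  rw [kernel, exp_mulVec_B, dotProduct, Fintype.sum_sigma]
  refine Finset.sum_congr rfl fun j _ => ?_
  -- The reversed order of the constants in `C` matches the descending powers of `s` in `e^{sA} B`.
  exact Fintype.sum_equiv Fin.revPerm _ _ fun p => rfl

/-! Laplace transforms of the kernel. -/

/-- Decay, on the positive half-line, faster than any power. -/
def RapidDecay (η : ℝ → ℂ) : Prop := ∀ n : ℕ, ∃ C, ∀ t, 0 ≤ t → (1 + t) ^ n * ‖η t‖ ≤ C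

namespace RapidDecay

variable {η ξ : ℝ → ℂ}

theorem add (hη : RapidDecay η) (hξ : RapidDecay ξ) : RapidDecay fun t => η t + ξ t := by
  intro n
  obtain ⟨C, hC⟩ := hη n
  obtain ⟨C', hC'⟩ := hξ n
  refine ⟨C + C', fun t ht => ?_⟩
  calc (1 + t) ^ n * ‖η t + ξ t‖ ≤ (1 + t) ^ n * (‖η t‖ + ‖ξ t‖) := by
        gcongr; exact norm_add_le _ _
    _ ≤ C + C' := by rw [mul_add]; exact add_le_add (hC t ht) (hC' t ht)

theorem const_mul (hη : RapidDecay η) (c : ℂ) : RapidDecay fun t => c * η t := by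
  intro n
  obtain ⟨C, hC⟩ := hη n
  refine ⟨‖c‖ * C, fun t ht => ?_⟩
  rw [norm_mul, mul_left_comm]
  exact mul_le_mul_of_nonneg_left (hC t ht) (norm_nonneg c)

theorem sum {ι : Type*} (s : Finset ι) {η : ι → ℝ → ℂ} (h : ∀ i ∈ s, RapidDecay (η i)) :
    RapidDecay fun t => ∑ i ∈ s, η i t := by
  classical
  induction s using Finset.induction_on with
  | empty => exact fun n => ⟨0, fun t _ => by simp⟩
  | insert i s his ih =>
    simp only [Finset.sum_insert his]
    exact (h i (Finset.mem_insert_self i s)).add (ih fun k hk => h k (Finset.mem_insert_of_mem hk))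

theorem norm_le (hη : RapidDecay η) (n : ℕ) : ∃ C, 0 ≤ C ∧ ∀ t, 0 ≤ t → ‖η t‖ ≤ C * ((1 + t) ^ n)⁻¹ := by
  obtain ⟨C, hC⟩ := hη n
  refine ⟨C, (by positivity : (0 : ℝ) ≤ (1 + 0) ^ n * ‖η 0‖).trans (hC 0 le_rfl), fun t ht => ?_⟩
  rw [← div_eq_mul_inv, le_div_iff₀ (by positivity), mul_comm]
  exact hC t ht

theorem integrableOn (hη : RapidDecay η) (hc : Continuous η) : IntegrableOn η (Ioi 0) := by
  obtain ⟨C, hC0, hC⟩ := hη.norm_le 2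
  refine Integrable.mono' ((integrable_inv_one_add_sq.const_mul C).integrableOn)
    hc.aestronglyMeasurable.restrict ?_
  filter_upwards [ae_restrict_mem measurableSet_Ioi] with t ht
  have ht' : 0 < t := ht
  refine (hC t ht'.le).trans ?_
  gcongr
  nlinarith

theorem tendsto_zero (hη : RapidDecay η) : Tendsto η atTop (𝓝 0) := by
  obtain ⟨C, hC0, hC⟩ := hη.norm_le 1
  have h : Tendsto (fun t : ℝ => C * ((1 + t) ^ 1)⁻¹) atTop (𝓝 (C * 0)) := by
    simp only [pow_one]
    exact ((tendsto_atTop_add_const_left _ 1 tendsto_id).inv_tendsto_atTop).const_mul C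
  rw [mul_zero] at h
  exact squeeze_zero_norm' ((eventually_ge_atTop 0).mono hC) h

theorem mul_bdd (hη : RapidDecay η) (hξ : ∀ t, ‖ξ t‖ ≤ 1) : RapidDecay fun t => η t * ξ t := by
  intro n
  obtain ⟨C, hC⟩ := hη n
  refine ⟨C, fun t ht => le_trans ?_ (hC t ht)⟩
  rw [norm_mul]
  gcongr
  exact mul_le_of_le_one_right (norm_nonneg _) (hξ t)

theorem integral_deriv {η' : ℝ → ℂ} (hη : RapidDecay η) (hη' : RapidDecay η')
    (hc : Continuous η') (hd : ∀ t, HasDerivAt η (η' t) t) : ∫ t in Ioi 0, η' t = -η 0 := by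
  rw [integral_Ioi_of_hasDerivAt_of_tendsto (f := η) (m := 0)
    (hd 0).continuousAt.continuousWithinAt (fun t _ => hd t) (hη'.integrableOn hc) hη.tendsto_zero]
  ring

/-- The transform of a derivative on the half-line. -/
theorem ft_deriv {η' : ℝ → ℂ} (hη : RapidDecay η) (hη' : RapidDecay η')
    (hc : Continuous η') (hd : ∀ t, HasDerivAt η (η' t) t) (l : ℝ) :
    ∫ t in Ioi (0 : ℝ), η' t * Complex.exp (-(Complex.I * l * t)) =
      -η 0 + Complex.I * l * ∫ t in Ioi (0 : ℝ), η t * Complex.exp (-(Complex.I * l * t)) := by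
  have hb : ∀ t : ℝ, ‖Complex.exp (-(Complex.I * l * t))‖ ≤ 1 := fun t => by
    rw [Complex.norm_exp, Real.exp_le_one_iff]; simp
  have hηc : Continuous η := continuous_iff_continuousAt.2 fun t => (hd t).continuousAt
  have h1 := hη.mul_bdd hb
  have h2 := hη'.mul_bdd hb
  have hexp : ∀ t : ℝ, HasDerivAt (fun t : ℝ => Complex.exp (-(Complex.I * l * t)))
      (Complex.exp (-(Complex.I * l * t)) * -(Complex.I * l)) t := by
    intro t
    simpa only [neg_mul] using hasDerivAt_exp_real_mul (-(Complex.I * l)) t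
  have h3 : RapidDecay fun t : ℝ => η' t * Complex.exp (-(Complex.I * l * t)) +
      -(Complex.I * l) * (η t * Complex.exp (-(Complex.I * l * t))) := h2.add (h1.const_mul _)
  have h := h1.integral_deriv h3 (by fun_prop) fun t =>
    ((hd t).fun_mul (hexp t)).congr_deriv (by ring)
  rw [integral_add (h2.integrableOn (by fun_prop))
    ((h1.const_mul _).integrableOn (by fun_prop)), integral_const_mul] at h
  simp only [Complex.ofReal_zero, mul_zero, neg_zero, Complex.exp_zero, mul_one] at h
  linear_combination h

end RapidDecay

theorem rapidDecay_pow_mul_exp (k : ℕ) {c : ℂ} (hc : c.re < 0) :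
    RapidDecay fun t : ℝ => (t : ℂ) ^ k * Complex.exp (c * t) := by
  intro n
  have hδ : 0 < -c.re := by linarith
  refine ⟨(n + k).factorial / (-c.re) ^ (n + k) * Real.exp (-c.re), fun t ht => ?_⟩
  -- One term of the exponential series at `-c.re (1 + t)` absorbs the power `n + k`; the factor
  -- `e^{-c.re}` in the constant comes from shifting `t` to `1 + t`.
  have h1 := Real.pow_div_factorial_le_exp (-c.re * (1 + t)) (by positivity) (n + k)
  rw [mul_pow, div_le_iff₀ (by positivity)] at h1
  have h2 : ‖(t : ℂ) ^ k * Complex.exp (c * t)‖ = t ^ k * Real.exp (c.re * t) := by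
    rw [norm_mul, norm_pow, Complex.norm_real, Real.norm_of_nonneg ht, Complex.norm_exp]
    simp
  rw [h2]
  have h3 : Real.exp (-c.re * (1 + t)) * Real.exp (c.re * t) = Real.exp (-c.re) := by
    rw [← Real.exp_add]; congr 1; ring
  calc (1 + t) ^ n * (t ^ k * Real.exp (c.re * t))
      ≤ (1 + t) ^ n * ((1 + t) ^ k * Real.exp (c.re * t)) := by gcongr; linarith
    _ = ((-c.re) ^ (n + k) * (1 + t) ^ (n + k)) / (-c.re) ^ (n + k) * Real.exp (c.re * t) := by
        field_simp
        rw [pow_add]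
    _ ≤ (Real.exp (-c.re * (1 + t)) * (n + k).factorial) / (-c.re) ^ (n + k) *
        Real.exp (c.re * t) := by gcongr
    _ = _ := by rw [← h3]; ring

theorem rapidDecay_jordanExp (k : ℕ) {l b : ℂ} (hc : (b * l).re < 0) :
    RapidDecay fun t : ℝ => jordanExp l k (b * t) := by
  have h := (rapidDecay_pow_mul_exp k hc).const_mul (b ^ k / k.factorial)
  have e : (fun t : ℝ => jordanExp l k (b * t)) = fun t : ℝ =>
      b ^ k / k.factorial * ((t : ℂ) ^ k * Complex.exp (b * l * t)) := by
    funext t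
    rw [jordanExp, mul_right_comm b, mul_pow]
    ring
  rw [e]
  exact h

theorem continuous_jordanExp (l : ℂ) (k : ℕ) : Continuous (jordanExp l k) := by
  unfold jordanExp
  fun_prop

/-- Induction on `k`: the derivative of an entry is `bl` times itself plus `b` times the previous
one, so transforming the derivative divides the previous transform by `iμ - bl`. -/
theorem integral_jordanExp (k : ℕ) {l b : ℂ} {μ : ℝ} (hc : (b * l).re < 0) :
    ∫ t in Ioi (0 : ℝ), jordanExp l k (b * t) * Complex.exp (-(Complex.I * μ * t)) =
      b ^ k / (Complex.I * μ - b * l) ^ (k + 1) := by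
  have hσ : Complex.I * μ - b * l ≠ 0 := by
    intro h
    have := congrArg Complex.re h
    simp at this
    simp at hc
    linarith
  have hd : ∀ {F : ℂ → ℂ} {F' : ℂ} {t : ℝ}, HasDerivAt F F' (b * t) →
      HasDerivAt (fun t : ℝ => F (b * t)) (F' * b) t := by
    intro F F' t hF
    have h : HasDerivAt (fun t : ℝ => b * (t : ℂ)) b t := by
      simpa using (Complex.ofRealCLM.hasDerivAt (x := t)).const_mul b
    exact HasDerivAt.comp t hF h
  induction k with
  | zero =>
    have h := (rapidDecay_jordanExp 0 hc).ft_deriv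
      ((rapidDecay_jordanExp 0 hc).const_mul (b * l))
      (by have := continuous_jordanExp l 0; fun_prop)
      (fun t => (hd (hasDerivAt_jordanExp_zero l (b * t))).congr_deriv (by ring)) μ
    simp only [mul_assoc (b * l), integral_const_mul] at h
    rw [pow_zero, zero_add, pow_one, eq_div_iff hσ]
    simp [jordanExp] at h ⊢
    linear_combination -h
  | succ k ih =>
    have h := (rapidDecay_jordanExp (k + 1) hc).ft_deriv
      (((rapidDecay_jordanExp (k + 1) hc).const_mul (b * l)).add
        ((rapidDecay_jordanExp k hc).const_mul b))
      (by have := continuous_jordanExp l k; have := continuous_jordanExp l (k + 1); fun_prop)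
      (fun t => (hd (hasDerivAt_jordanExp_succ l k (b * t))).congr_deriv (by ring)) μ
    have hb : ∀ t : ℝ, ‖Complex.exp (-(Complex.I * μ * t))‖ ≤ 1 := fun t => by
      rw [Complex.norm_exp, Real.exp_le_one_iff]; simp
    have i1 := ((rapidDecay_jordanExp (k + 1) hc).mul_bdd hb).integrableOn
      (by have := continuous_jordanExp l (k + 1); fun_prop)
    have i2 := ((rapidDecay_jordanExp k hc).mul_bdd hb).integrableOn
      (by have := continuous_jordanExp l k; fun_prop)
    simp only [add_mul, mul_assoc (b * l), mul_assoc b (jordanExp _ _ _)] at h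
    rw [integral_add (i1.const_mul _) (i2.const_mul _), integral_const_mul, integral_const_mul,
      ih] at h
    have h0 : jordanExp l (k + 1) (b * (0 : ℝ)) = 0 := by simp [jordanExp]
    rw [h0] at h
    rw [eq_div_iff (pow_ne_zero _ hσ), pow_succ (Complex.I * μ - b * l) (k + 1)]
    have h1 : (∫ t in Ioi (0 : ℝ), jordanExp l (k + 1) (b * t) * Complex.exp (-(Complex.I * μ * t)))
        * (Complex.I * μ - b * l) = b * (b ^ k / (Complex.I * μ - b * l) ^ (k + 1)) := by
      linear_combination -h
    calc _ = (∫ t in Ioi (0 : ℝ), jordanExp l (k + 1) (b * t) * Complex.exp (-(Complex.I * μ * t)))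
        * (Complex.I * μ - b * l) * (Complex.I * μ - b * l) ^ (k + 1) := by ring
      _ = _ := by rw [h1, pow_succ b]; field_simp

end

section

open scoped FourierTransform

/-! Fourier inversion for the reflection coefficients. -/

/-- Fourier inversion for Schwartz functions, with the variable rescaled by `2π` to pass to the
normalization without `2π` in the exponent. -/
theorem exists_schwartz_ft_eq (ρ : 𝓢(ℝ, ℂ)) : ∃ h : 𝓢(ℝ, ℂ),
    (∀ y, h y = 1 / (2 * Real.pi) * ∫ l : ℝ, ρ l * Complex.exp (Complex.I * l * y)) ∧
      ∀ l, ft h l = ρ l := by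
  have hπ : (2 * Real.pi) ≠ 0 := by positivity
  let L : ℝ ≃L[ℝ] ℝ := ContinuousLinearEquiv.unitsEquivAut ℝ (Units.mk0 (2 * Real.pi)⁻¹ (inv_ne_zero hπ))
  let h : 𝓢(ℝ, ℂ) := (1 / (2 * Real.pi) : ℂ) • SchwartzMap.compCLMOfContinuousLinearEquiv ℂ L (𝓕⁻ ρ)
  have hL : ∀ y, L y = y * (2 * Real.pi)⁻¹ := fun y => rfl
  have hh : ∀ y, h y = 1 / (2 * Real.pi) * (𝓕⁻ ρ) (y * (2 * Real.pi)⁻¹) := fun y => rfl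
  refine ⟨h, fun y => ?_, fun l => ?_⟩
  · rw [hh, SchwartzMap.fourierInv_coe, Real.fourierInv_eq']
    congr 1
    refine integral_congr_ae (ae_of_all _ fun v => ?_)
    simp only [smul_eq_mul, RCLike.inner_apply, conj_trivial]
    rw [mul_comm]
    congr 2
    push_cast
    field_simp
  · have e : ∀ s : ℝ, h s * Complex.exp (-(Complex.I * l * s)) = 1 / (2 * Real.pi) *
        ((𝓕⁻ ρ) (s * (2 * Real.pi)⁻¹) *
          Complex.exp (-(2 * Real.pi * Complex.I * l * (s * (2 * Real.pi)⁻¹ : ℝ)))) := by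
      intro s
      rw [hh, mul_assoc]
      congr 3
      push_cast
      field_simp
    rw [ft]
    simp only [e]
    rw [integral_const_mul]
    have e2 := Measure.integral_comp_mul_right (fun v : ℝ => (𝓕⁻ ρ) v *
      Complex.exp (-(2 * Real.pi * Complex.I * l * v))) (2 * Real.pi)⁻¹
    rw [e2]
    have h2 : (𝓕 (𝓕⁻ ρ)) l = ρ l := by rw [FourierTransform.fourier_fourierInv_eq]
    rw [← h2, SchwartzMap.fourier_coe, Real.fourier_real_eq_integral_exp_smul]
    rw [inv_inv, abs_of_pos (by positivity), Complex.real_smul, ← mul_assoc]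
    push_cast
    rw [one_div, inv_mul_cancel₀ (by exact_mod_cast hπ), one_mul]
    refine integral_congr_ae (ae_of_all _ fun v => ?_)
    simp only [smul_eq_mul]
    rw [mul_comm]
    congr 2
    ring

theorem ft_shift {h : ℝ → ℂ} (a l : ℝ) :
    ft (fun s => h (a + s)) l = Complex.exp (Complex.I * l * a) * ft h l := by
  rw [ft, ft, ← integral_const_mul,
    ← integral_add_left_eq_self (fun s : ℝ => Complex.exp (Complex.I * l * a) *
      (h s * Complex.exp (-(Complex.I * l * s)))) a]
  refine integral_congr_ae (ae_of_all _ fun s => ?_)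
  simp only
  rw [mul_left_comm, ← Complex.exp_add]
  congr 2
  push_cast
  ring

theorem norm_exp_neg_I_mul_le (l t : ℝ) : ‖Complex.exp (-(Complex.I * l * t))‖ ≤ 1 := by
  rw [Complex.norm_exp, Real.exp_le_one_iff]; simp

theorem integrable_mul_exp_neg {h : ℝ → ℂ} (hh : Integrable h) (l : ℝ) :
    Integrable fun s : ℝ => h s * Complex.exp (-(Complex.I * l * s)) :=
  hh.mul_bdd (c := 1) (by apply Continuous.aestronglyMeasurable; fun_prop)
    (ae_of_all _ (norm_exp_neg_I_mul_le l))

theorem ft_deriv_schwartz (h : 𝓢(ℝ, ℂ)) (l : ℝ) :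
    ft (deriv h) l = Complex.I * l * ft h l := by
  have hexp : ∀ t : ℝ, HasDerivAt (fun t : ℝ => Complex.exp (-(Complex.I * l * t)))
      (Complex.exp (-(Complex.I * l * t)) * -(Complex.I * l)) t := by
    intro t
    simpa only [neg_mul] using hasDerivAt_exp_real_mul (-(Complex.I * l)) t
  have i1 := integrable_mul_exp_neg (SchwartzMap.derivCLM ℝ ℂ h).integrable l
  have i2 := integrable_mul_exp_neg h.integrable l
  have hz := integral_eq_zero_of_hasDerivAt_of_integrable
    (f := fun t : ℝ => h t * Complex.exp (-(Complex.I * l * t)))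
    (f' := fun t : ℝ => SchwartzMap.derivCLM ℝ ℂ h t * Complex.exp (-(Complex.I * l * t)) +
      -(Complex.I * l) * (h t * Complex.exp (-(Complex.I * l * t))))
    (fun t => (h.differentiableAt.hasDerivAt.fun_mul (hexp t)).congr_deriv (by
      rw [SchwartzMap.derivCLM_apply]; ring))
    (i1.add (i2.const_mul _)) i2
  rw [integral_add i1 (i2.const_mul _), integral_const_mul] at hz
  simp only [SchwartzMap.derivCLM_apply] at hz
  rw [ft, ft]
  linear_combination hz

theorem rapidDecay_schwartz (h : 𝓢(ℝ, ℂ)) : RapidDecay h := by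
  intro n
  refine ⟨2 ^ n * (Finset.Iic (n, 0)).sup (fun m => SchwartzMap.seminorm ℝ m.1 m.2) h,
    fun t ht => ?_⟩
  have := SchwartzMap.one_add_le_sup_seminorm_apply (𝕜 := ℝ) (m := (n, 0)) le_rfl le_rfl h t
  rw [norm_iteratedFDeriv_zero, Real.norm_of_nonneg ht] at this
  exact this

/-! Transforms of the kernels of the Marchenko system. -/

/-- Rapid decay of a function and of its derivative. -/
def RapidDecayDeriv (η : ℝ → ℂ) : Prop := RapidDecay η ∧ ∃ η' : ℝ → ℂ, RapidDecay η' ∧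
  Continuous η' ∧ ∀ t, HasDerivAt η (η' t) t

namespace RapidDecayDeriv

variable {η : ℝ → ℂ}

theorem const_mul (hη : RapidDecayDeriv η) (c : ℂ) : RapidDecayDeriv fun t => c * η t := by
  obtain ⟨h, η', h', hc, hd⟩ := hη
  exact ⟨h.const_mul c, _, h'.const_mul c, hc.const_mul c, fun t => (hd t).const_mul c⟩

theorem sum {ι : Type*} (s : Finset ι) {η : ι → ℝ → ℂ} (h : ∀ i ∈ s, RapidDecayDeriv (η i)) :
    RapidDecayDeriv fun t => ∑ i ∈ s, η i t := by
  classical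
  refine ⟨RapidDecay.sum s fun i hi => (h i hi).1, ?_⟩
  have h' : ∀ i, ∃ η' : ℝ → ℂ, i ∈ s → RapidDecay η' ∧ Continuous η' ∧
      ∀ t, HasDerivAt (η i) (η' t) t := fun i => by
    by_cases hi : i ∈ s
    · obtain ⟨-, η', hη'⟩ := h i hi
      exact ⟨η', fun _ => hη'⟩
    · exact ⟨0, fun h => absurd h hi⟩
  choose η' hη' using h'
  exact ⟨fun t => ∑ i ∈ s, η' i t, RapidDecay.sum s fun i hi => (hη' i hi).1,
    continuous_finsetSum s fun i hi => (hη' i hi).2.1,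
    fun t => HasDerivAt.fun_sum fun i hi => (hη' i hi).2.2 t⟩

theorem continuous (hη : RapidDecayDeriv η) : Continuous η := by
  obtain ⟨-, η', -, -, hd⟩ := hη
  exact continuous_iff_continuousAt.2 fun t => (hd t).continuousAt

end RapidDecayDeriv

theorem rapidDecayDeriv_jordanExp (k : ℕ) {l b : ℂ} (hc : (b * l).re < 0) :
    RapidDecayDeriv fun t : ℝ => jordanExp l k (b * t) := by
  have hd : ∀ {F : ℂ → ℂ} {F' : ℂ} {t : ℝ}, HasDerivAt F F' (b * t) →
      HasDerivAt (fun t : ℝ => F (b * t)) (F' * b) t := by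
    intro F F' t hF
    have h : HasDerivAt (fun t : ℝ => b * (t : ℂ)) b t := by
      simpa using (Complex.ofRealCLM.hasDerivAt (x := t)).const_mul b
    exact HasDerivAt.comp t hF h
  refine ⟨rapidDecay_jordanExp k hc, ?_⟩
  cases k with
  | zero =>
    refine ⟨_, (rapidDecay_jordanExp 0 hc).const_mul (b * l), ?_, fun t =>
      (hd (hasDerivAt_jordanExp_zero l (b * t))).congr_deriv (by ring)⟩
    have := continuous_jordanExp l 0
    fun_prop
  | succ k =>
    refine ⟨_, ((rapidDecay_jordanExp (k + 1) hc).const_mul (b * l)).add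
      ((rapidDecay_jordanExp k hc).const_mul b), ?_, fun t =>
      (hd (hasDerivAt_jordanExp_succ l k (b * t))).congr_deriv (by ring)⟩
    have := continuous_jordanExp l k
    have := continuous_jordanExp l (k + 1)
    fun_prop

/-- The resolvent expression `C e^{sA} (w - A)⁻¹ B`. -/
def BoundStates.resolvent (D : BoundStates) (s w : ℂ) : ℂ :=
  ∑ j, ∑ k, D.c j k * ∑ i ∈ Finset.range (k + 1),
    jordanExp (D.pole j) (k - i) s * ((w - D.pole j) ^ (i + 1))⁻¹

theorem BoundStates.kernel_add (D : BoundStates) (s t : ℂ) :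
    D.kernel (s + t) = ∑ j, ∑ k, D.c j k * ∑ i ∈ Finset.range (k + 1),
      jordanExp (D.pole j) (k - i) s * jordanExp (D.pole j) i t := by
  rw [kernel_eq]
  simp only [jordanExp_add]

theorem BoundStates.rapidDecayDeriv_kernel (D : BoundStates) {b : ℂ}
    (hb : ∀ j, (b * D.pole j).re < 0) (s : ℂ) :
    RapidDecayDeriv fun t : ℝ => D.kernel (s + b * t) := by
  simp only [kernel_add]
  exact .sum _ fun j _ => .sum _ fun k _ => .const_mul (.sum _ fun i _ =>
    .const_mul (rapidDecayDeriv_jordanExp i (hb j)) _) _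

/-- The binomial expansion separates `s` from `t`, and each entry then transforms to a power of a
scalar resolvent. As `(εi)⁻¹ = -εi`, the same formula serves both half-planes. -/
theorem BoundStates.integral_kernel (D : BoundStates) {ε : ℂ} (hε : ε ^ 2 = 1)
    (hb : ∀ j, (ε * Complex.I * D.pole j).re < 0) (s : ℂ) (l : ℝ) :
    ∫ t in Ioi (0 : ℝ), D.kernel (s + ε * Complex.I * t) * Complex.exp (-(Complex.I * l * t)) =
      -(ε * Complex.I) * D.resolvent s (ε * l) := by
  have hi : ∀ j i, IntegrableOn (fun t : ℝ => jordanExp (D.pole j) i (ε * Complex.I * t) *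
      Complex.exp (-(Complex.I * l * t))) (Ioi 0) := fun j i =>
    ((rapidDecay_jordanExp i (hb j)).mul_bdd (norm_exp_neg_I_mul_le l)).integrableOn (by
      have := continuous_jordanExp (D.pole j) i
      fun_prop)
  simp only [kernel_add, Finset.sum_mul, mul_assoc (D.c _ _), mul_assoc (jordanExp _ _ _), resolvent]
  rw [integral_finsetSum]
  swap
  · exact fun j _ => integrable_finsetSum _ fun k _ => (integrable_finsetSum _ fun i _ =>
      (hi j i).const_mul _).const_mul _
  rw [Finset.mul_sum]
  refine Finset.sum_congr rfl fun j _ => ?_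
  rw [integral_finsetSum]
  swap
  · exact fun k _ => (integrable_finsetSum _ fun i _ => (hi j i).const_mul _).const_mul _
  rw [Finset.mul_sum]
  refine Finset.sum_congr rfl fun k _ => ?_
  rw [integral_const_mul, integral_finsetSum _ fun i _ => (hi j i).const_mul _, mul_left_comm]
  congr 1
  rw [Finset.mul_sum]
  refine Finset.sum_congr rfl fun i _ => ?_
  rw [integral_const_mul, integral_jordanExp i (hb j), mul_left_comm]
  congr 1
  have hε0 : ε ≠ 0 := by rintro rfl; simp at hε
  have e : Complex.I * l - ε * Complex.I * D.pole j =
      ε * Complex.I * (ε * l - D.pole j) := by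
    linear_combination (-Complex.I * l) * hε
  have e2 : (ε * Complex.I)⁻¹ = -(ε * Complex.I) :=
    inv_eq_of_mul_eq_one_right (by linear_combination (-ε ^ 2) * Complex.I_sq + hε)
  rw [e, mul_pow (ε * Complex.I) (ε * l - D.pole j), pow_succ (ε * Complex.I), mul_assoc,
    div_mul_eq_div_div, div_self (pow_ne_zero _ (mul_ne_zero hε0 Complex.I_ne_zero)), one_div,
    mul_inv, e2]

theorem integrable_add_indicator (h : 𝓢(ℝ, ℂ)) {η : ℝ → ℂ} (hη : RapidDecay η)
    (hc : Continuous η) : Integrable fun s => h s + (Ici 0).indicator η s := by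
  refine h.integrable.add (IntegrableOn.integrable_indicator ?_ measurableSet_Ici)
  rw [integrableOn_Ici_iff_integrableOn_Ioi]
  exact hη.integrableOn hc

theorem continuousOn_add_indicator (h : 𝓢(ℝ, ℂ)) {η : ℝ → ℂ} (hc : Continuous η) :
    ContinuousOn (fun s => h s + (Ici 0).indicator η s) (Ici 0) := by
  refine ContinuousOn.congr (f := fun s => h s + η s) (by have := h.continuous; fun_prop) ?_
  intro s hs
  simp only [indicator_of_mem hs]

theorem exists_norm_add_indicator_le (h : 𝓢(ℝ, ℂ)) {η : ℝ → ℂ} (hη : RapidDecay η) :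
    ∃ C, 0 ≤ C ∧ ∀ s, 0 ≤ s → ‖h s + (Ici 0).indicator η s‖ ≤ C * ((1 + s) ^ 3)⁻¹ := by
  obtain ⟨C, hC0, hC⟩ := ((rapidDecay_schwartz h).add hη).norm_le 3
  refine ⟨C, hC0, fun s hs => ?_⟩
  rw [indicator_of_mem (mem_Ici.2 hs)]
  exact hC s hs

theorem ft_add_indicator (h : 𝓢(ℝ, ℂ)) {η : ℝ → ℂ} (hη : RapidDecay η) (hc : Continuous η) (l : ℝ) :
    ft (fun s => h s + (Ici 0).indicator η s) l =
      ft h l + ∫ t in Ioi (0 : ℝ), η t * Complex.exp (-(Complex.I * l * t)) := by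
  have hi : Integrable ((Ici (0 : ℝ)).indicator η) := by
    refine IntegrableOn.integrable_indicator ?_ measurableSet_Ici
    rw [integrableOn_Ici_iff_integrableOn_Ioi]
    exact hη.integrableOn hc
  rw [ft]
  simp only [add_mul]
  rw [integral_add (integrable_mul_exp_neg h.integrable l) (integrable_mul_exp_neg hi l), ft]
  congr 1
  rw [← integral_Ici_eq_integral_Ioi, ← integral_indicator measurableSet_Ici]
  refine integral_congr_ae (ae_of_all _ fun s => ?_)
  simp only
  rw [indicator_mul_left]

/-- Only the values of `ω(2x + s)` and of its derivative for `s ≥ 0` enter the Marchenko equations.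
The bound-state part may grow exponentially for negative `s` and is cut off there, while the
Schwartz part is kept on the whole line. The transforms of the cut-off parts are resolvents of the
Jordan matrix; for `κ₁` the jump at `s = 0` contributes the constant `εi D.kernel(2εix)`. -/
theorem exists_marchenko_kernels (D : BoundStates) {ε : ℂ} (hε : ε ^ 2 = 1)
    (hb : ∀ j, (ε * Complex.I * D.pole j).re < 0) (ρ : 𝓢(ℝ, ℂ)) {ω : ℝ → ℂ}
    (hω : ∀ y : ℝ, ω y = ε * (1 / (2 * Real.pi) * ∫ l : ℝ, ρ l * Complex.exp (Complex.I * l * y)) +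
      D.kernel (ε * Complex.I * y)) (x : ℝ) :
    ∃ κ₁ κ₂ : ℝ → ℂ, Integrable κ₁ ∧ Integrable κ₂ ∧
      ContinuousOn κ₁ (Ici 0) ∧ ContinuousOn κ₂ (Ici 0) ∧
      (∃ C, 0 ≤ C ∧ ∀ s, 0 ≤ s → ‖κ₁ s‖ ≤ C * ((1 + s) ^ 3)⁻¹) ∧
      (∃ C, 0 ≤ C ∧ ∀ s, 0 ≤ s → ‖κ₂ s‖ ≤ C * ((1 + s) ^ 3)⁻¹) ∧
      (∀ s, 0 ≤ s → κ₁ s = -(ε * Complex.I) * deriv ω (2 * x + s)) ∧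
      (∀ s, 0 ≤ s → κ₂ s = ω (2 * x + s)) ∧
      (∀ l : ℝ, ft κ₁ l = l * (Complex.exp (2 * Complex.I * l * x) * ρ l) +
        (ε * Complex.I * D.kernel (ε * Complex.I * (2 * x)) -
          Complex.I * l * D.resolvent (ε * Complex.I * (2 * x)) (ε * l))) ∧
      ∀ l : ℝ, ft κ₂ l = ε * (Complex.exp (2 * Complex.I * l * x) * ρ l -
          Complex.I * D.resolvent (ε * Complex.I * (2 * x)) (ε * l)) := by
  obtain ⟨h, hh, hft⟩ := exists_schwartz_ft_eq ρ
  set b := ε * Complex.I with hbdef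
  have hk := D.rapidDecayDeriv_kernel hb (b * (2 * x))
  have hkc := hk.continuous
  have hint := D.integral_kernel hε hb (b * (2 * x))
  obtain ⟨hη, η', hη', hη'c, hd⟩ := hk
  set η : ℝ → ℂ := fun t => D.kernel (b * (2 * x) + b * t) with hηdef
  let h₂ : 𝓢(ℝ, ℂ) := ε • h.compSubConstCLM ℂ (-(2 * x))
  have eh₂ : ∀ s, h₂ s = ε * h (2 * x + s) := fun s => by
    change ε * h (s - -(2 * x)) = _
    rw [sub_neg_eq_add, add_comm]
  let h₁ : 𝓢(ℝ, ℂ) := (-b) • SchwartzMap.derivCLM ℂ ℂ h₂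
  have eh₁ : ∀ s, h₁ s = -b * deriv h₂ s := fun s => rfl
  have hη₁ := hη'.const_mul (-b)
  have hη₁c : Continuous fun t => -b * η' t := hη'c.const_mul _
  have ehω : ∀ s : ℝ, ω (2 * x + s) = h₂ s + η s := by
    intro s
    rw [hω, eh₂, hh, hηdef]
    congr 2
    push_cast
    ring
  have ft₂ : ∀ l, ft h₂ l = ε * (Complex.exp (2 * Complex.I * l * x) * ρ l) := by
    intro l
    have h1 : ft h₂ l = ε * ft (fun s => h (2 * x + s)) l := by
      rw [ft, ft, ← integral_const_mul]
      refine integral_congr_ae (ae_of_all _ fun s => ?_)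
      simp only [eh₂, mul_assoc]
    rw [h1, ft_shift, hft]
    congr 3
    push_cast
    ring
  refine ⟨fun s => h₁ s + (Ici 0).indicator (fun t => -b * η' t) s,
    fun s => h₂ s + (Ici 0).indicator η s, integrable_add_indicator h₁ hη₁ hη₁c,
    integrable_add_indicator h₂ hη hkc, continuousOn_add_indicator h₁ hη₁c,
    continuousOn_add_indicator h₂ hkc, exists_norm_add_indicator_le h₁ hη₁,
    exists_norm_add_indicator_le h₂ hη, fun s hs => ?_, fun s hs => ?_, fun l => ?_, fun l => ?_⟩
  · simp only [indicator_of_mem (mem_Ici.2 hs)]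
    rw [eh₁, ← mul_add]
    congr 1
    have h1 : HasDerivAt (fun s => h₂ s + η s) (deriv h₂ s + η' s) s :=
      h₂.differentiableAt.hasDerivAt.fun_add (hd s)
    rw [← h1.deriv, ← deriv_comp_const_add]
    congr 1
    funext s
    exact (ehω s).symm
  · simp only [indicator_of_mem (mem_Ici.2 hs)]
    exact (ehω s).symm
  · rw [ft_add_indicator h₁ hη₁ hη₁c]
    have h1 : ft h₁ l = -b * (Complex.I * l * ft h₂ l) := by
      rw [← ft_deriv_schwartz, ft, ft, ← integral_const_mul]
      refine integral_congr_ae (ae_of_all _ fun s => ?_)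
      simp only [eh₁, mul_assoc]
    have h2 := hη.ft_deriv hη' hη'c hd l
    simp only [mul_assoc (-b), integral_const_mul]
    rw [h2, h1, ft₂, hint]
    have e0 : η 0 = D.kernel (b * (2 * x)) := by simp [hηdef]
    rw [e0, hbdef]
    linear_combination (-(ε ^ 2 * l * Complex.exp (2 * Complex.I * l * x) * ρ l)) * Complex.I_sq +
      (l * (Complex.exp (2 * Complex.I * l * x) * ρ l)) * hε +
      (ε ^ 2 * Complex.I * l * D.resolvent (ε * Complex.I * (2 * x)) (ε * l)) * Complex.I_sq -
      (Complex.I * l * D.resolvent (ε * Complex.I * (2 * x)) (ε * l)) * hε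
  · rw [ft_add_indicator h₂ hη hkc, hint, ft₂]
    rw [hbdef]
    ring

end

section

/-! The principal parts at the bound states. -/

theorem differentiableAt_resolvent (D : BoundStates) (s : ℂ) {w : ℂ} (hw : w ∉ range D.pole) :
    DifferentiableAt ℂ (D.resolvent s) w := by
  unfold BoundStates.resolvent
  refine DifferentiableAt.fun_sum fun j _ => DifferentiableAt.fun_sum fun k _ =>
    (DifferentiableAt.fun_sum fun i _ => ?_).const_mul _
  refine DifferentiableAt.const_mul (DifferentiableAt.fun_inv (by fun_prop) ?_) _
  exact pow_ne_zero _ (sub_ne_zero.2 fun h => hw ⟨j, h.symm⟩)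

/-- Every term of the resolvent carries at least one inverse power of `w - l`, which pays for the
factor `w`. -/
theorem isBigO_mul_resolvent (D : BoundStates) (s : ℂ) :
    (fun w => w * D.resolvent s w) =O[Bornology.cobounded ℂ] (fun _ => (1 : ℂ)) := by
  have key : ∀ (l : ℂ) (i : ℕ), (fun w : ℂ => w * ((w - l) ^ (i + 1))⁻¹) =O[Bornology.cobounded ℂ]
      (fun _ => (1 : ℂ)) := by
    intro l i
    have h1 : Tendsto (fun w : ℂ => (w - l)⁻¹) (Bornology.cobounded ℂ) (𝓝 0) :=
      tendsto_inv₀_cobounded.comp (tendsto_sub_const_cobounded l)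
    have h2 : Tendsto (fun w : ℂ => 1 + l * (w - l)⁻¹) (Bornology.cobounded ℂ) (𝓝 1) := by
      simpa using (h1.const_mul l).const_add 1
    have h3 : (fun w : ℂ => (1 + l * (w - l)⁻¹) * ((w - l)⁻¹) ^ i) =O[Bornology.cobounded ℂ]
        (fun _ => (1 : ℂ)) := by
      simpa using (h2.isBigO_one ℂ).mul ((h1.isBigO_one ℂ).pow i)
    refine h3.congr' ?_ (EventuallyEq.refl _ _)
    have : ∀ᶠ w : ℂ in Bornology.cobounded ℂ, w ≠ l := by
      have h : Bornology.IsBounded ({l} : Set ℂ) := Bornology.isBounded_singleton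
      exact Bornology.isBounded_def.1 h
    filter_upwards [this] with w hw
    have hw' := sub_ne_zero.2 hw
    rw [inv_pow, pow_succ, mul_inv, show 1 + l * (w - l)⁻¹ = w * (w - l)⁻¹ by field_simp; ring]
    ring
  simp only [BoundStates.resolvent, Finset.mul_sum]
  refine Asymptotics.IsBigO.fun_sum fun j _ => Asymptotics.IsBigO.fun_sum fun k _ =>
    Asymptotics.IsBigO.fun_sum fun i _ => ?_
  refine ((key (D.pole j) i).const_mul_left (D.c j k * jordanExp (D.pole j) (k - i) s)).congr_left ?_
  intro w
  ring

/-- Up to the factor `e^{sl}`, the sum is the Taylor polynomial of `e^{s(w - l)}` of degree `k`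
divided by `(w - l)^(k+1)`, so the difference is a Taylor remainder of order `k + 1` over that
power. -/
theorem isBigO_sum_jordanExp_sub (l s : ℂ) (k : ℕ) :
    (fun w => ∑ i ∈ Finset.range (k + 1), jordanExp l (k - i) s * ((w - l) ^ (i + 1))⁻¹ -
      Complex.exp (s * w) / (w - l) ^ (k + 1)) =O[𝓝[≠] l] (fun _ => (1 : ℂ)) := by
  have h1 : ∀ w, w ≠ l → ∑ i ∈ Finset.range (k + 1), jordanExp l (k - i) s * ((w - l) ^ (i + 1))⁻¹ -
      Complex.exp (s * w) / (w - l) ^ (k + 1) = -(Complex.exp (s * l) * ((w - l) ^ (k + 1))⁻¹ *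
        (Complex.exp (s * (w - l)) -
          ∑ n ∈ Finset.range (k + 1), (s * (w - l)) ^ n / n.factorial)) := by
    intro w hw
    have hw' := sub_ne_zero.2 hw
    have e1 : Complex.exp (s * w) = Complex.exp (s * l) * Complex.exp (s * (w - l)) := by
      rw [← Complex.exp_add]; congr 1; ring
    rw [mul_sub, neg_sub, Finset.mul_sum, ← Finset.sum_range_reflect, e1]
    congr 1
    · refine Finset.sum_congr rfl fun i hi => ?_
      have hik : i ≤ k := Nat.lt_succ_iff.1 (Finset.mem_range.1 hi)
      have e2 : k + 1 - 1 - i = k - i := by omega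
      have e3 : k - (k - i) = i := by omega
      have e4 : k + 1 = (k - i + 1) + i := by omega
      have e5 : (w - l) ^ (k + 1) = (w - l) ^ (k - i + 1) * (w - l) ^ i := by
        rw [← pow_add, ← e4]
      rw [e2, e3, e5, jordanExp, mul_pow]
      field_simp
    · ring
  have hne : ∀ᶠ w in 𝓝[≠] l, w ≠ l := self_mem_nhdsWithin
  have hsmall : ∀ᶠ w in 𝓝[≠] l, ‖s * (w - l)‖ ≤ 1 := by
    have : Tendsto (fun w => ‖s * (w - l)‖) (𝓝 l) (𝓝 0) := by
      have hc : Continuous fun w => ‖s * (w - l)‖ := by fun_prop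
      simpa using hc.tendsto l
    exact (this.mono_left nhdsWithin_le_nhds).eventually_le_const one_pos
  refine Asymptotics.IsBigO.of_bound (‖Complex.exp (s * l)‖ * (‖s‖ ^ (k + 1) *
    ((k + 1).succ * ((k + 1).factorial * ((k + 1 : ℕ) : ℝ))⁻¹))) ?_
  filter_upwards [hne, hsmall] with w hw hs
  rw [h1 w hw, norm_neg, norm_mul, norm_mul, norm_one, mul_one, mul_assoc]
  have hb := Complex.exp_bound hs k.succ_pos
  have h0 : 0 < ‖w - l‖ := norm_pos_iff.2 (sub_ne_zero.2 hw)
  refine mul_le_mul_of_nonneg_left ?_ (norm_nonneg _)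
  calc _ ≤ ‖((w - l) ^ (k + 1))⁻¹‖ * (‖s * (w - l)‖ ^ (k + 1) *
        ((k + 1).succ * ((k + 1).factorial * ((k + 1 : ℕ) : ℝ))⁻¹)) := by gcongr
    _ = _ := by
      rw [norm_mul, mul_pow, norm_inv, norm_pow]
      field_simp

/-- The block of `D.pole j` produces the stated singularity up to a bounded term, and the other
blocks are continuous there because the poles are distinct. This matches the definition of the
normalization constants with the matrix exponential in the kernel. -/
theorem isBigO_resolvent_sub_principal (D : BoundStates) (hD : Function.Injective D.pole) (s : ℂ)
    (j : Fin D.N) : (fun w => D.resolvent s w - Complex.exp (s * w) *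
      ∑ k, D.c j k / (w - D.pole j) ^ ((k : ℕ) + 1)) =O[𝓝[≠] (D.pole j)] (fun _ => (1 : ℂ)) := by
  have e : (fun w => D.resolvent s w - Complex.exp (s * w) *
      ∑ k, D.c j k / (w - D.pole j) ^ ((k : ℕ) + 1)) = fun w =>
      ∑ k, D.c j k * (∑ i ∈ Finset.range (k + 1),
        jordanExp (D.pole j) (k - i) s * ((w - D.pole j) ^ (i + 1))⁻¹ -
          Complex.exp (s * w) / (w - D.pole j) ^ ((k : ℕ) + 1)) +
      ∑ j' ∈ Finset.univ.erase j, ∑ k, D.c j' k * ∑ i ∈ Finset.range (k + 1),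
        jordanExp (D.pole j') (k - i) s * ((w - D.pole j') ^ (i + 1))⁻¹ := by
    funext w
    rw [BoundStates.resolvent, ← Finset.add_sum_erase _ _ (Finset.mem_univ j), Finset.mul_sum]
    simp only [mul_sub, Finset.sum_sub_distrib]
    have : ∀ k : Fin (D.mult j), Complex.exp (s * w) * (D.c j k / (w - D.pole j) ^ ((k : ℕ) + 1)) =
      D.c j k * (Complex.exp (s * w) / (w - D.pole j) ^ ((k : ℕ) + 1)) := fun k => by ring
    simp only [this]
    ring
  rw [e]
  refine Asymptotics.IsBigO.add (Asymptotics.IsBigO.fun_sum fun k _ =>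
    (isBigO_sum_jordanExp_sub _ s k).const_mul_left _) ?_
  refine Asymptotics.IsBigO.fun_sum fun j' hj' => ?_
  have hne : D.pole j - D.pole j' ≠ 0 :=
    sub_ne_zero.2 fun h => (Finset.ne_of_mem_erase hj') (hD h).symm
  have hc : ContinuousAt (fun w => ∑ k, D.c j' k * ∑ i ∈ Finset.range (k + 1),
        jordanExp (D.pole j') (k - i) s * ((w - D.pole j') ^ (i + 1))⁻¹) (D.pole j) := by
    refine tendsto_finsetSum _ fun k _ => Tendsto.const_mul _ (tendsto_finsetSum _ fun i _ =>
      Tendsto.const_mul _ (ContinuousAt.inv₀ (by fun_prop) (pow_ne_zero _ hne)))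
  exact (hc.tendsto.mono_left nhdsWithin_le_nhds).isBigO_one ℂ

end

/-! ### Scattering data on one side and its pole-free Riemann–Hilbert functions -/

section

/-- The Jost functions of one of the two half-planes at a point `x`, with the reflection coefficient
`ρ` and the bound states `D`; the half-plane is that of `λ = ε z`, `z` in the upper half-plane. -/
structure IsScatteringSide (D : BoundStates) (ε : ℂ) (ρ : ℝ → ℂ) (x : ℝ) (p : ℂ)
    (a f₁ f₂ g₁ g₂ G₁ G₂ : ℂ → ℂ) : Prop where
  sq : ε ^ 2 = 1
  inj : Function.Injective D.pole
  pole_mem : ∀ j, ε * D.pole j ∈ upperOpen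
  exists_pole : ∀ z ∈ upper, a z = 0 → ∃ j, ε * D.pole j = z
  hol_a : HolOff ∅ a
  hol_f₁ : HolOff ∅ f₁
  hol_f₂ : HolOff ∅ f₂
  hol_g₁ : HolOff ∅ g₁
  hol_g₂ : HolOff ∅ g₂
  inf_a : (fun z => (a z)⁻¹) =O[atInf] (fun _ => (1 : ℂ))
  inf_f₁ : f₁ =O[atInf] (fun _ => (1 : ℂ))
  inf_f₂ : (fun z => z * f₂ z) =O[atInf] (fun _ => (1 : ℂ))
  inf_g₁ : g₁ =O[atInf] (fun _ => (1 : ℂ))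
  inf_g₂ : g₂ =O[atInf] (fun _ => (1 : ℂ))
  near₁ : ∀ j, (fun z => f₁ z / a z - Complex.I * z * (Complex.exp (2 * Complex.I * z * x) *
    ∑ k, D.c j k / (ε * z - D.pole j) ^ ((k : ℕ) + 1)) * g₁ z)
      =O[𝓝[≠] (ε * D.pole j)] (fun _ => (1 : ℂ))
  near₂ : ∀ j, (fun z => f₂ z / a z - Complex.I * (Complex.exp (2 * Complex.I * z * x) *
    ∑ k, D.c j k / (ε * z - D.pole j) ^ ((k : ℕ) + 1)) * g₂ z)
      =O[𝓝[≠] (ε * D.pole j)] (fun _ => (1 : ℂ))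
  jump₁ : ∀ l : ℝ, f₁ l = a l * (G₁ (-l) + l * (Complex.exp (2 * Complex.I * l * x) * ρ l) * g₁ l)
  jump₂ : ∀ l : ℝ, f₂ l = a l * (G₂ (-l) + (Complex.exp (2 * Complex.I * l * x) * ρ l) * g₂ l)
  wronskian : ∀ z ∈ upper, f₁ z * g₂ z - z * f₂ z * g₁ z = a z * p

section BigO

variable {F : Filter ℂ} {f g : ℂ → ℂ}

theorem isBigO_one_mul (hf : f =O[F] (fun _ => (1 : ℂ))) (hg : g =O[F] (fun _ => (1 : ℂ))) :
    (fun z => f z * g z) =O[F] (fun _ => (1 : ℂ)) := by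
  simpa using hf.mul hg

theorem HolOff.isBigO_one (hf : HolOff ∅ f) {s : ℂ} (hs : s ∈ upperOpen) :
    f =O[𝓝[≠] s] (fun _ => (1 : ℂ)) :=
  ((hf.differentiableAt isClosed_empty hs (notMem_empty s)).continuousAt.tendsto.mono_left
    nhdsWithin_le_nhds).isBigO_one ℂ

end BigO

theorem tendsto_mul_nhdsNE {ε : ℂ} (hε : ε ^ 2 = 1) (l : ℂ) :
    Tendsto (fun z => ε * z) (𝓝[≠] (ε * l)) (𝓝[≠] l) := by
  have hε0 : ε ≠ 0 := by rintro rfl; simp at hε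
  refine tendsto_nhdsWithin_iff.2 ⟨?_, ?_⟩
  · have hc : Continuous fun z => ε * z := by fun_prop
    have := hc.tendsto (ε * l)
    rw [show ε * (ε * l) = l by linear_combination l * hε] at this
    exact this.mono_left nhdsWithin_le_nhds
  · filter_upwards [self_mem_nhdsWithin] with z hz h
    exact hz (mul_left_cancel₀ hε0 (by rw [show ε * z = l from h]; linear_combination -l * hε))

/-- The quotients `f₁ / a` and `f₂ / a` have poles at the bound states. Adding the transform of the
bound-state kernel times `g₁` or `g₂` makes them bounded there and completes the reflection
coefficient in the jump to the full transform. Wronskians survive, since only multiples of the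
second solution are added. -/
theorem IsScatteringSide.exists_functions {D : BoundStates} {ε : ℂ} {ρ : ℝ → ℂ} {x : ℝ} {p : ℂ}
    {a f₁ f₂ g₁ g₂ G₁ G₂ : ℂ → ℂ} (h : IsScatteringSide D ε ρ x p a f₁ f₂ g₁ g₂ G₁ G₂) (c₀ : ℂ) :
    ∃ (S : Set ℂ) (X₁ X₂ Z₁ Z₂ : ℂ → ℂ), (S.Finite ∧ S ⊆ upperOpen) ∧
      (HolOff S X₁ ∧ HolOff S X₂ ∧ HolOff S Z₁ ∧ HolOff S Z₂) ∧
      (X₁ =O[atInf] (fun _ => (1 : ℂ)) ∧ X₂ =O[atInf] (fun _ => (1 : ℂ)) ∧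
        Z₁ =O[atInf] (fun _ => (1 : ℂ)) ∧ Z₂ =O[atInf] (fun _ => (1 : ℂ))) ∧
      (∀ s ∈ S, X₁ =O[𝓝[≠] s] (fun _ => (1 : ℂ)) ∧ X₂ =O[𝓝[≠] s] (fun _ => (1 : ℂ)) ∧
        Z₁ =O[𝓝[≠] s] (fun _ => (1 : ℂ)) ∧ Z₂ =O[𝓝[≠] s] (fun _ => (1 : ℂ))) ∧
      (∀ z ∈ upper \ S, X₁ z * g₂ z - X₂ z * g₁ z = p ∧ Z₂ z * g₂ z - z * Z₁ z * g₁ z = p) ∧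
      ∀ l : ℝ, ∀ θ₁ θ₂ : ℂ, θ₁ = l * (Complex.exp (2 * Complex.I * l * x) * ρ l) +
          (c₀ - Complex.I * l * D.resolvent (ε * Complex.I * (2 * x)) (ε * l)) →
        θ₂ = ε * (Complex.exp (2 * Complex.I * l * x) * ρ l -
          Complex.I * D.resolvent (ε * Complex.I * (2 * x)) (ε * l)) →
        X₁ l = G₁ (-l) + θ₁ * g₁ l ∧ X₂ l = l * G₂ (-l) + θ₁ * g₂ l ∧
        Z₁ l = G₂ (-l) + ε * θ₂ * g₂ l ∧ Z₂ l = G₁ (-l) + l * (ε * θ₂) * g₁ l := by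
  set S : Set ℂ := range fun j => ε * D.pole j with hS
  set Q : ℂ → ℂ := fun z => D.resolvent (ε * Complex.I * (2 * x)) (ε * z) with hQ
  have hε := h.sq
  have hnorm : ‖ε‖ = 1 := by
    have := congrArg norm hε
    rw [norm_pow, norm_one] at this
    exact (pow_eq_one_iff_of_nonneg (norm_nonneg _) two_ne_zero).1 this
  have hSf : S.Finite := finite_range _
  have hSu : S ⊆ upperOpen := by rintro _ ⟨j, rfl⟩; exact h.pole_mem j
  have hnot : ∀ l : ℝ, (l : ℂ) ∉ S := fun l hl => by
    have := hSu hl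
    simp at this
  have ha0 : ∀ z ∈ upper \ S, a z ≠ 0 := fun z hz h0 => hz.2 (h.exists_pole z hz.1 h0)
  have hai : HolOff S fun z => (a z)⁻¹ := (h.hol_a.mono (empty_subset S)).inv ha0
  have hQd : HolOff S Q := by
    refine HolOff.of_differentiableOn fun z hz => DifferentiableAt.differentiableWithinAt ?_
    have hz' : ε * z ∉ range D.pole := by
      rintro ⟨j, hj⟩
      exact hz.2 ⟨j, by simp only [hj]; linear_combination z * hε⟩
    exact (differentiableAt_resolvent D _ hz').comp z (by fun_prop)
  have hzQ : (fun z => z * Q z) =O[atInf] (fun _ => (1 : ℂ)) := by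
    have h1 : Tendsto (fun z => ε * z) atInf (Bornology.cobounded ℂ) := by
      rw [← tendsto_norm_atTop_iff_cobounded]
      simp only [norm_mul, hnorm, one_mul]
      exact tendsto_norm_cobounded_atTop.mono_left inf_le_left
    refine (((isBigO_mul_resolvent D (ε * Complex.I * (2 * x))).comp_tendsto h1).const_mul_left
      ε).congr_left fun z => ?_
    simp only [Function.comp_apply, hQ]
    linear_combination z * D.resolvent (ε * Complex.I * (2 * x)) (ε * z) * hε
  have hlow : ∀ {f : ℂ → ℂ}, (fun z => z * f z) =O[atInf] (fun _ => (1 : ℂ)) →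
      f =O[atInf] (fun _ => (1 : ℂ)) := by
    intro f hf
    have h1 : Tendsto (fun z : ℂ => z⁻¹) atInf (𝓝 0) :=
      tendsto_inv₀_cobounded.mono_left inf_le_left
    have hne : ∀ᶠ z in atInf, z ≠ 0 := by
      have := (tendsto_norm_cobounded_atTop (E := ℂ)).eventually_gt_atTop 0
      have h2 : ∀ᶠ z : ℂ in atInf, 0 < ‖z‖ := this.filter_mono inf_le_left
      exact h2.mono fun z hz => norm_pos_iff.1 hz
    refine (isBigO_one_mul (h1.isBigO_one ℂ) hf).congr' ?_ (EventuallyEq.refl _ _)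
    filter_upwards [hne] with z hz
    field_simp
  have hc₀ : ∀ F : Filter ℂ, (fun _ : ℂ => c₀) =O[F] (fun _ => (1 : ℂ)) := fun F =>
    Asymptotics.isBigO_const_const _ one_ne_zero _
  have hθ : (fun z => c₀ - Complex.I * (z * Q z)) =O[atInf] (fun _ => (1 : ℂ)) :=
    (hc₀ _).sub (hzQ.const_mul_left _)
  have hnearQ : ∀ j, (fun z => Q z - Complex.exp (2 * Complex.I * z * x) *
      ∑ k, D.c j k / (ε * z - D.pole j) ^ ((k : ℕ) + 1)) =O[𝓝[≠] (ε * D.pole j)]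
        (fun _ => (1 : ℂ)) := by
    intro j
    refine ((isBigO_resolvent_sub_principal D h.inj (ε * Complex.I * (2 * x)) j).comp_tendsto
      (tendsto_mul_nhdsNE hε _)).congr_left fun z => ?_
    simp only [Function.comp_apply]
    congr 3
    linear_combination (2 * Complex.I * x * z) * hε
  have hzid : ∀ {s : ℂ}, (fun z : ℂ => z) =O[𝓝[≠] s] (fun _ => (1 : ℂ)) := fun {s} =>
    ((continuous_id.tendsto s).mono_left nhdsWithin_le_nhds).isBigO_one ℂ
  have mono : ∀ {f : ℂ → ℂ}, HolOff ∅ f → HolOff S f := fun hf => hf.mono (empty_subset S)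
  have near₁ : ∀ j, (fun z => f₁ z * (a z)⁻¹ - Complex.I * (z * Q z) * g₁ z)
      =O[𝓝[≠] (ε * D.pole j)] (fun _ => (1 : ℂ)) := by
    intro j
    have hg := h.hol_g₁.isBigO_one (h.pole_mem j)
    refine ((h.near₁ j).sub ((isBigO_one_mul (isBigO_one_mul hzid (hnearQ j)) hg).const_mul_left
      Complex.I)).congr_left fun z => ?_
    ring
  have near₂ : ∀ j, (fun z => f₂ z * (a z)⁻¹ - Complex.I * Q z * g₂ z)
      =O[𝓝[≠] (ε * D.pole j)] (fun _ => (1 : ℂ)) := by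
    intro j
    have hg := h.hol_g₂.isBigO_one (h.pole_mem j)
    refine ((h.near₂ j).sub ((isBigO_one_mul (hnearQ j) hg).const_mul_left
      Complex.I)).congr_left fun z => ?_
    ring
  -- The multiplier `c₀ - i z Q` is the discrete part of `θ₁` and `-i Q` that of `ε θ₂`, continued
  -- from the real axis. The `X` carry the factor λ on the second component, the `Z` on the first.
  refine ⟨S, fun z => f₁ z * (a z)⁻¹ + (c₀ - Complex.I * (z * Q z)) * g₁ z,
    fun z => z * f₂ z * (a z)⁻¹ + (c₀ - Complex.I * (z * Q z)) * g₂ z,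
    fun z => f₂ z * (a z)⁻¹ - Complex.I * Q z * g₂ z,
    fun z => f₁ z * (a z)⁻¹ - Complex.I * (z * Q z) * g₁ z, ⟨hSf, hSu⟩, ⟨?_, ?_, ?_, ?_⟩,
    ⟨?_, ?_, ?_, ?_⟩, ?_, ?_, ?_⟩
  · exact ((mono h.hol_f₁).mul hai).add (((HolOff.const c₀).sub ((HolOff.const _).mul
      (HolOff.id.mul hQd))).mul (mono h.hol_g₁))
  · exact ((HolOff.id.mul (mono h.hol_f₂)).mul hai).add (((HolOff.const c₀).sub
      ((HolOff.const _).mul (HolOff.id.mul hQd))).mul (mono h.hol_g₂))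
  · exact ((mono h.hol_f₂).mul hai).sub (((HolOff.const _).mul hQd).mul (mono h.hol_g₂))
  · exact ((mono h.hol_f₁).mul hai).sub (((HolOff.const _).mul (HolOff.id.mul hQd)).mul
      (mono h.hol_g₁))
  · exact (isBigO_one_mul h.inf_f₁ h.inf_a).add (isBigO_one_mul hθ h.inf_g₁)
  · exact (isBigO_one_mul h.inf_f₂ h.inf_a).add (isBigO_one_mul hθ h.inf_g₂)
  · exact (isBigO_one_mul (hlow h.inf_f₂) h.inf_a).sub
      (isBigO_one_mul ((hlow hzQ).const_mul_left _) h.inf_g₂)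
  · exact (isBigO_one_mul h.inf_f₁ h.inf_a).sub (isBigO_one_mul (hzQ.const_mul_left _) h.inf_g₁)
  · rintro _ ⟨j, rfl⟩
    have hg₁ := h.hol_g₁.isBigO_one (h.pole_mem j)
    have hg₂ := h.hol_g₂.isBigO_one (h.pole_mem j)
    refine ⟨?_, ?_, near₂ j, near₁ j⟩
    · refine ((near₁ j).add (hg₁.const_mul_left c₀)).congr_left fun z => ?_
      ring
    · refine ((isBigO_one_mul hzid (near₂ j)).add (hg₂.const_mul_left c₀)).congr_left fun z => ?_
      ring
  · intro z hz
    have w := h.wronskian z hz.1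
    have e := mul_inv_cancel₀ (ha0 z hz)
    constructor
    · linear_combination (a z)⁻¹ * w + p * e
    · linear_combination (a z)⁻¹ * w + p * e
  · rintro l θ₁ θ₂ rfl rfl
    have e := mul_inv_cancel₀ (ha0 l ⟨ofReal_mem_upper l, hnot l⟩)
    have j₁ := h.jump₁ l
    have j₂ := h.jump₂ l
    refine ⟨?_, ?_, ?_, ?_⟩
    · simp only [hQ]
      rw [j₁]
      linear_combination (G₁ (-l) + l * (Complex.exp (2 * Complex.I * l * x) * ρ l) * g₁ l) * e
    · simp only [hQ]
      rw [j₂]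
      linear_combination l * (G₂ (-l) + (Complex.exp (2 * Complex.I * l * x) * ρ l) * g₂ l) * e
    · simp only [hQ]
      rw [j₂]
      linear_combination (G₂ (-l) + (Complex.exp (2 * Complex.I * l * x) * ρ l) * g₂ l) * e -
        (Complex.exp (2 * Complex.I * l * x) * ρ l -
          Complex.I * D.resolvent (ε * Complex.I * (2 * x)) (ε * l)) * g₂ l * hε
    · simp only [hQ]
      rw [j₁]
      linear_combination (G₁ (-l) + l * (Complex.exp (2 * Complex.I * l * x) * ρ l) * g₁ l) * e -
        l * (Complex.exp (2 * Complex.I * l * x) * ρ l -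
          Complex.I * D.resolvent (ε * Complex.I * (2 * x)) (ε * l)) * g₁ l * hε

end

section

variable {q r : 𝓢(ℝ, ℂ)} {x : ℝ} {z : ℂ}

/-! Analyticity and growth of the reduced Jost solutions. -/

theorem HolOff.of_differentiableOn_upper {f : ℂ → ℂ} (hf : DifferentiableOn ℂ f upper) :
    HolOff ∅ f := .of_differentiableOn (by rwa [sdiff_empty])

theorem holOff_jostA (u v : 𝓢(ℝ, ℂ)) (x : ℝ) : HolOff ∅ fun z => jostA u v z x :=
  .of_differentiableOn_upper (differentiableOn_jostA u v x)

theorem holOff_jostB (u v : 𝓢(ℝ, ℂ)) (x : ℝ) : HolOff ∅ fun z => jostB u v z x :=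
  .of_differentiableOn_upper (differentiableOn_jostB u v x)

theorem holOff_jostAlpha (u v : 𝓢(ℝ, ℂ)) : HolOff ∅ (jostAlpha u v) :=
  .of_differentiableOn_upper (differentiableOn_jostAlpha u v)

theorem isBigO_mul_jostB (u v : 𝓢(ℝ, ℂ)) (x : ℝ) :
    (fun z => z * jostB u v z x) =O[atInf] (fun _ => (1 : ℂ)) := by
  obtain ⟨C, -, hC⟩ := exists_norm_mul_jostB_le u v
  refine Asymptotics.IsBigO.of_bound C ?_
  have : ∀ᶠ z in atInf, z ∈ upper := Filter.mem_inf_of_right (mem_principal_self _)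
  filter_upwards [this] with z hz
  rw [norm_mul, norm_one, mul_one]
  exact hC z hz x

variable (q r x)

theorem holOff_redF₁ : HolOff ∅ (redF₁ q r x) :=
  ((HolOff.const _).mul (holOff_jostA _ _ x)).sub ((HolOff.const _).mul (holOff_jostB _ _ x))

theorem holOff_redF₂ : HolOff ∅ (redF₂ q r x) := holOff_jostB _ _ x

theorem holOff_redFBar₁ : HolOff ∅ (redFBar₁ q r x) := (HolOff.const _).mul (holOff_jostB _ _ x)

theorem holOff_redFBar₂ : HolOff ∅ (redFBar₂ q r x) :=
  (holOff_jostA _ _ x).add ((HolOff.const _).mul (holOff_jostB _ _ x))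

theorem holOff_redG₁ : HolOff ∅ (redG₁ q r x) := (HolOff.const _).mul (holOff_jostB _ _ (-x))

theorem holOff_redG₂ : HolOff ∅ (redG₂ q r x) :=
  (holOff_jostA _ _ (-x)).add ((HolOff.const _).mul (holOff_jostB _ _ (-x)))

theorem holOff_redGBar₁ : HolOff ∅ (redGBar₁ q r x) :=
  (HolOff.const _).mul
    (((HolOff.const _).mul (holOff_jostA _ _ (-x))).sub ((HolOff.const _).mul (holOff_jostB _ _ (-x))))

theorem holOff_redGBar₂ : HolOff ∅ (redGBar₂ q r x) := (HolOff.const _).mul (holOff_jostB _ _ (-x))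

theorem tendsto_redF₁_atInf : Tendsto (redF₁ q r x) atInf (𝓝 (E q r x)) := by
  have h := ((tendsto_jostA_atInf (gaugeU₁ q r) (gaugeV₁ q r) x).const_mul (E q r x)).sub
    ((tendsto_jostB_atInf (gaugeU₁ q r) (gaugeV₁ q r) x).const_mul (Complex.I / 2 * q x))
  rw [mul_one, mul_zero, sub_zero] at h
  exact h

theorem tendsto_redFBar₂_atInf : Tendsto (redFBar₂ q r x) atInf (𝓝 1) := by
  have h := (tendsto_jostA_atInf (gaugeU₂ q r) (gaugeV₂ q r) x).add
    ((tendsto_jostB_atInf (gaugeU₂ q r) (gaugeV₂ q r) x).const_mul (Complex.I / 2 * r x * E q r x))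
  rw [mul_zero, add_zero] at h
  exact h

theorem tendsto_redG₁_atInf : Tendsto (redG₁ q r x) atInf (𝓝 0) := by
  have h := (tendsto_jostB_atInf (reflNeg (gaugeU₂ q r)) (reflNeg (gaugeV₂ q r)) (-x)).const_mul
    (E q r x)
  rw [mul_zero] at h
  exact h

theorem tendsto_redG₂_atInf : Tendsto (redG₂ q r x) atInf (𝓝 1) := by
  have h := (tendsto_jostA_atInf (reflNeg (gaugeU₂ q r)) (reflNeg (gaugeV₂ q r)) (-x)).add
    ((tendsto_jostB_atInf (reflNeg (gaugeU₂ q r)) (reflNeg (gaugeV₂ q r)) (-x)).const_mul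
      (Complex.I / 2 * r x * E q r x))
  rw [mul_zero, add_zero] at h
  exact h

theorem tendsto_redGBar₁_atInf : Tendsto (redGBar₁ q r x) atInf (𝓝 (wronskianFactor q r x)) := by
  have h := (((tendsto_jostA_atInf (reflNeg (gaugeU₁ q r)) (reflNeg (gaugeV₁ q r)) (-x)).const_mul
    (E q r x)).sub ((tendsto_jostB_atInf (reflNeg (gaugeU₁ q r)) (reflNeg (gaugeV₁ q r))
      (-x)).const_mul (Complex.I / 2 * q x))).const_mul (Complex.exp (-(Complex.I * mu q r / 2)))
  rw [mul_one, mul_zero, sub_zero, mul_comm _ (E q r x)] at h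
  exact h

theorem tendsto_redGBar₂_atInf : Tendsto (redGBar₂ q r x) atInf (𝓝 0) := by
  have h := (tendsto_jostB_atInf (reflNeg (gaugeU₁ q r)) (reflNeg (gaugeV₁ q r)) (-x)).const_mul
    (Complex.exp (-(Complex.I * mu q r / 2)))
  rw [mul_zero] at h
  exact h

theorem tendsto_scatA_atInf :
    Tendsto (scatA q r) atInf (𝓝 (Complex.exp (Complex.I * mu q r / 2))) := by
  have h := (tendsto_jostAlpha_atInf (gaugeU₁ q r) (gaugeV₁ q r)).const_mul
    (Complex.exp (Complex.I * mu q r / 2))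
  rw [mul_one] at h
  exact h

theorem tendsto_scatABar_atInf : Tendsto (scatABar q r) atInf (𝓝 1) :=
  tendsto_jostAlpha_atInf (gaugeU₂ q r) (gaugeV₂ q r)

theorem isBigO_mul_redF₂ : (fun z => z * redF₂ q r x z) =O[atInf] (fun _ => (1 : ℂ)) :=
  isBigO_mul_jostB _ _ x

theorem isBigO_mul_redFBar₁ : (fun z => z * redFBar₁ q r x z) =O[atInf] (fun _ => (1 : ℂ)) :=
  ((isBigO_mul_jostB (gaugeU₂ q r) (gaugeV₂ q r) x).const_mul_left (E q r x)).congr_left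
    fun z => by rw [redFBar₁]; ring

theorem isBigO_mul_redG₁ : (fun z => z * redG₁ q r x z) =O[atInf] (fun _ => (1 : ℂ)) :=
  ((isBigO_mul_jostB (reflNeg (gaugeU₂ q r)) (reflNeg (gaugeV₂ q r)) (-x)).const_mul_left
    (E q r x)).congr_left fun z => by rw [redG₁]; ring

theorem isBigO_mul_redGBar₂ : (fun z => z * redGBar₂ q r x z) =O[atInf] (fun _ => (1 : ℂ)) :=
  ((isBigO_mul_jostB (reflNeg (gaugeU₁ q r)) (reflNeg (gaugeV₁ q r)) (-x)).const_mul_left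
    (Complex.exp (-(Complex.I * mu q r / 2)))).congr_left fun z => by rw [redGBar₂]; ring

variable {q r x}

/-! The zeros of `1 / T`. -/

theorem meromorphicOrderAt_neg_of_zero {b τ : ℂ → ℂ} {w : ℂ} (hb : AnalyticAt ℂ b w) (h0 : b w = 0)
    (hne : ¬ ∀ᶠ z in 𝓝 w, b z = 0) (hτ : τ =ᶠ[𝓝[≠] w] fun z => (b z)⁻¹) :
    meromorphicOrderAt τ w < 0 := by
  rw [meromorphicOrderAt_congr hτ]
  have h1 : (fun z => (b z)⁻¹) = b⁻¹ := rfl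
  rw [h1, meromorphicOrderAt_inv, hb.meromorphicOrderAt_eq]
  have h2 : analyticOrderAt b w ≠ 0 := hb.analyticOrderAt_ne_zero.2 h0
  have h3 : analyticOrderAt b w ≠ ⊤ := fun h => hne (analyticOrderAt_eq_top.1 h)
  lift analyticOrderAt b w to ℕ using h3 with n hn
  have h4 : 0 < n := Nat.pos_of_ne_zero (by exact_mod_cast h2)
  rw [ENat.map_natCast, ← WithTop.LinearOrderedAddCommGroup.coe_neg]
  exact_mod_cast (by omega : -(n : ℤ) < 0)

/-- By the identity theorem on the connected half-plane, local vanishing would force vanishing along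
the imaginary axis, against the nonzero limit at infinity. Zeros of the inverse transmission
coefficient thus have finite order and are genuine poles of its reciprocal. -/
theorem not_eventually_zero {f : ℂ → ℂ} (hf : HolOff ∅ f) {c : ℂ} (hc : c ≠ 0)
    (hlim : Tendsto f atInf (𝓝 c)) {z : ℂ} (hz : z ∈ upperOpen) : ¬ ∀ᶠ w in 𝓝 z, f w = 0 := by
  intro h
  have ha : AnalyticOnNhd ℂ f upperOpen := by
    have := hf.diff
    rw [sdiff_empty] at this
    exact this.analyticOnNhd isOpen_upperOpen
  have hconn : IsPreconnected upperOpen := (convex_halfSpace_im_gt 0).isPreconnected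
  have h0 : EqOn f 0 upperOpen :=
    ha.eqOn_zero_of_preconnected_of_eventuallyEq_zero hconn hz h
  have h1 : Tendsto (fun t : ℝ => f (Complex.I * t)) atTop (𝓝 0) := by
    refine tendsto_const_nhds.congr' ?_
    filter_upwards [eventually_gt_atTop 0] with t ht
    exact (h0 (by simpa using ht)).symm
  exact hc (tendsto_nhds_unique (hlim.comp tendsto_I_mul_atInf) h1)

theorem HolOff.analyticAt {f : ℂ → ℂ} (hf : HolOff ∅ f) {z : ℂ} (hz : z ∈ upperOpen) :
    AnalyticAt ℂ f z := by
  have := hf.diff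
  rw [sdiff_empty] at this
  exact this.analyticAt (isOpen_upperOpen.mem_nhds hz)

theorem isBigO_root_inv {l : ℂ} (hl : l.im ≠ 0) :
    (fun w => (root w)⁻¹) =O[𝓝[≠] l] (fun _ => (1 : ℂ)) := by
  have h0 : l ≠ 0 := by rintro rfl; simp at hl
  have hc : ContinuousAt root l := continuousAt_id.cpow continuousAt_const (Or.inr hl)
  exact ((hc.inv₀ (root_ne_zero h0)).tendsto.mono_left nhdsWithin_le_nhds).isBigO_one ℂ

theorem isBigO_cexp_mul (c l : ℂ) :
    (fun w => Complex.exp (c * w)) =O[𝓝[≠] l] (fun _ => (1 : ℂ)) := by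
  have hc : Continuous fun w => Complex.exp (c * w) := by fun_prop
  exact ((hc.tendsto l).mono_left nhdsWithin_le_nhds).isBigO_one ℂ

end

section

variable {q r : 𝓢(ℝ, ℂ)}

/-! The two half-planes. -/

theorem ae_ne_zero_real : ∀ᵐ l : ℝ, l ≠ 0 := by
  filter_upwards [(countable_singleton (0 : ℝ)).ae_notMem volume] with l hl using hl

theorem scatA_ofReal_ne_zero (hT : ∀ l : ℝ, invT q r (root l) ≠ 0) (l : ℝ) : scatA q r l ≠ 0 := by
  rw [← invT_eq (ofReal_mem_upper l) (root_sq l)]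
  exact hT l

theorem scatABar_ofReal_ne_zero (hT : ∀ l : ℝ, invTBar q r (root l) ≠ 0) (m : ℝ) :
    scatABar q r m ≠ 0 := by
  have h : root ((-m : ℝ) : ℂ) ^ 2 = -(m : ℂ) := by rw [root_sq]; push_cast; ring
  rw [← invTBar_eq (ofReal_mem_upper m) h]
  exact hT (-m)

/-- The factor ζ of the reflection coefficient cancels except at `λ = 0`, a null set for the Fourier
integral. -/
theorem exists_schwartz_reflection (hT : ∀ l : ℝ, invT q r (root l) ≠ 0) : ∃ ρ : 𝓢(ℝ, ℂ),
    (∀ l : ℝ, ρ l = jostN (gaugeU₁ q r) (gaugeV₁ q r) l / scatA q r l) ∧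
    ∀ y, RHat q r y = 1 / (2 * Real.pi) * ∫ l : ℝ, ρ l * Complex.exp (Complex.I * l * y) := by
  obtain ⟨ρ, hρ⟩ := exists_schwartz_jostN_div (gaugeU₁ q r) (gaugeV₁ q r)
    fun l => right_ne_zero_of_mul (scatA_ofReal_ne_zero hT l)
  have hρ' : ∀ l : ℝ, (Complex.exp (Complex.I * mu q r / 2))⁻¹ * ρ l =
      jostN (gaugeU₁ q r) (gaugeV₁ q r) l / scatA q r l := by
    intro l
    rw [hρ, scatA]
    ring
  refine ⟨(Complex.exp (Complex.I * mu q r / 2))⁻¹ • ρ, hρ', fun y => ?_⟩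
  rw [RHat]
  congr 1
  refine integral_congr_ae ?_
  filter_upwards [ae_ne_zero_real] with l hl
  have h0 : root l ≠ 0 := root_ne_zero (by exact_mod_cast hl)
  rw [R_eq (root_sq l), mul_div_cancel_left₀ _ h0, ← hρ']
  rfl

/-- Here `λ = -m`, which reverses the exponential in the Fourier integral. The sign of `ρ` is that
of the second components `-redFBar₁` and `-redG₁` on this side. -/
theorem exists_schwartz_reflectionBar (hT : ∀ l : ℝ, invTBar q r (root l) ≠ 0) : ∃ ρ : 𝓢(ℝ, ℂ),
    (∀ m : ℝ, ρ m = -(Complex.exp (Complex.I * mu q r / 2) *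
      jostN (gaugeU₂ q r) (gaugeV₂ q r) m / scatABar q r m)) ∧
    ∀ y, RBarHat q r y =
      -1 * (1 / (2 * Real.pi) * ∫ l : ℝ, ρ l * Complex.exp (Complex.I * l * y)) := by
  obtain ⟨ρ, hρ⟩ := exists_schwartz_jostN_div (gaugeU₂ q r) (gaugeV₂ q r)
    fun l => scatABar_ofReal_ne_zero hT l
  have hρ' : ∀ m : ℝ, -Complex.exp (Complex.I * mu q r / 2) * ρ m =
      -(Complex.exp (Complex.I * mu q r / 2) *
        jostN (gaugeU₂ q r) (gaugeV₂ q r) m / scatABar q r m) := by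
    intro m
    rw [hρ, scatABar]
    ring
  refine ⟨(-Complex.exp (Complex.I * mu q r / 2)) • ρ, hρ', fun y => ?_⟩
  rw [RBarHat, mul_left_comm, neg_one_mul, ← integral_neg, ← integral_neg_eq_self]
  congr 1
  refine integral_congr_ae ?_
  filter_upwards [ae_ne_zero_real] with m hm
  have h0 : root ((-m : ℝ) : ℂ) ≠ 0 := root_ne_zero (by simpa using hm)
  have h : root ((-m : ℝ) : ℂ) ^ 2 = -(m : ℂ) := by rw [root_sq]; push_cast; ring
  rw [RBar_eq h, mul_div_cancel_left₀ _ h0]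
  change _ = -((-Complex.exp (Complex.I * mu q r / 2) * ρ m) * _)
  rw [hρ']
  push_cast
  rw [show -Complex.I * -(m : ℂ) * y = Complex.I * m * y by ring]
  ring

theorem IsBoundStates.isScatteringSide (hT : ∀ l : ℝ, invT q r (root l) ≠ 0) {D : BoundStates}
    (hD : IsBoundStates q r D) {ρ : ℝ → ℂ}
    (hρ : ∀ l : ℝ, ρ l = jostN (gaugeU₁ q r) (gaugeV₁ q r) l / scatA q r l) (x : ℝ) :
    IsScatteringSide D 1 ρ x (wronskianFactor q r x) (scatA q r) (redF₁ q r x) (redF₂ q r x)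
      (redG₁ q r x) (redG₂ q r x) (redGBar₁ q r x) (redGBar₂ q r x) := by
  obtain ⟨hinj, hrange, -, hpp⟩ := hD
  have hmem : ∀ j, 0 < (D.pole j).im := fun j => by
    have : D.pole j ∈ range D.pole := ⟨j, rfl⟩
    rw [hrange] at this
    exact this.1
  have hev : ∀ j, ∀ᶠ l in 𝓝[≠] (D.pole j), l ∈ upper := fun j =>
    nhdsWithin_le_nhds (mem_of_superset (isOpen_upperOpen.mem_nhds (hmem j)) upperOpen_subset)
  have hexp : ∀ l : ℂ, Complex.exp (Complex.I * l * x) * Complex.exp (-(Complex.I * l * x)) = 1 :=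
    fun l => by rw [← Complex.exp_add, add_neg_cancel, Complex.exp_zero]
  have hexp2 : ∀ l : ℂ, Complex.exp (Complex.I * l * x) * Complex.exp (Complex.I * l * x) =
      Complex.exp (2 * Complex.I * l * x) := fun l => by
    rw [← Complex.exp_add]; congr 1; ring
  have hO : ∀ l : ℂ, (fun w : ℂ => Complex.exp (Complex.I * w * x)) =O[𝓝[≠] l]
      (fun _ => (1 : ℂ)) := fun l => by
    refine (isBigO_cexp_mul (Complex.I * x) l).congr_left fun w => ?_
    congr 1; ring
  have ha : HolOff ∅ (scatA q r) := (HolOff.const _).mul (holOff_jostAlpha _ _)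
  refine
    { sq := one_pow 2
      inj := hinj
      pole_mem := fun j => by rw [one_mul]; exact hmem j
      exists_pole := fun z hz h0 => ?_
      hol_a := ha
      hol_f₁ := holOff_redF₁ q r x
      hol_f₂ := holOff_redF₂ q r x
      hol_g₁ := holOff_redG₁ q r x
      hol_g₂ := holOff_redG₂ q r x
      inf_a := ((tendsto_scatA_atInf q r).inv₀ (Complex.exp_ne_zero _)).isBigO_one ℂ
      inf_f₁ := (tendsto_redF₁_atInf q r x).isBigO_one ℂ
      inf_f₂ := isBigO_mul_redF₂ q r x
      inf_g₁ := (tendsto_redG₁_atInf q r x).isBigO_one ℂ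
      inf_g₂ := (tendsto_redG₂_atInf q r x).isBigO_one ℂ
      near₁ := fun j => ?_
      near₂ := fun j => ?_
      jump₁ := fun l => ?_
      jump₂ := fun l => ?_
      wronskian := fun z hz => wronskian_redF_redG hz x }
  -- Real zeros are excluded by `hT`; a zero in the open half-plane is a pole of `T` and hence
  -- listed in `D`.
  · have hz' : z ∈ upperOpen := by
      rcases (mem_upper.1 hz).lt_or_eq with h | h
      · exact h
      · have : z = (z.re : ℂ) := Complex.ext rfl (by simpa using h.symm)
        rw [this] at h0
        exact absurd h0 (scatA_ofReal_ne_zero hT _)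
    have : z ∈ range D.pole := by
      rw [hrange]
      refine ⟨hz', meromorphicOrderAt_neg_of_zero (ha.analyticAt hz') h0
        (not_eventually_zero ha (Complex.exp_ne_zero _) (tendsto_scatA_atInf q r) hz') ?_⟩
      filter_upwards [nhdsWithin_le_nhds (isOpen_upperOpen.mem_nhds hz')] with w hw
      rw [T, invT_eq (upperOpen_subset hw) (root_sq w)]
    obtain ⟨j, hj⟩ := this
    exact ⟨j, by rw [one_mul, hj]⟩
  -- Multiplication by `e^{iλx}` strips the exponential from φ and doubles that of ψ; the ζ in front
  -- of the sum and the ζ in the first component of ψ combine to λ.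
  · rw [one_mul]
    refine (isBigO_one_mul (hO _) (hpp j x 0)).congr' ?_ (EventuallyEq.refl _ _)
    filter_upwards [hev j] with l hl
    rw [T, invT_eq hl (root_sq l), phi_eq hl (root_sq l), psi_eq hl (root_sq l)]
    simp only [Matrix.cons_val_zero, one_mul]
    linear_combination ((scatA q r l)⁻¹ * redF₁ q r x l) * hexp l -
      (Complex.I * root l ^ 2 * (∑ k, D.c j k / (l - D.pole j) ^ ((k : ℕ) + 1)) * redG₁ q r x l) *
        hexp2 l - (Complex.I * Complex.exp (2 * Complex.I * l * x) *
        (∑ k, D.c j k / (l - D.pole j) ^ ((k : ℕ) + 1)) * redG₁ q r x l) * root_sq l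
  -- In the second component a single ζ is common to both terms and is divided out; the root is
  -- continuous and nonzero near a nonreal pole.
  · rw [one_mul]
    refine (isBigO_one_mul (isBigO_one_mul (isBigO_root_inv (hmem j).ne') (hO _))
      (hpp j x 1)).congr' ?_ (EventuallyEq.refl _ _)
    filter_upwards [hev j, nhdsWithin_le_nhds (isOpen_upperOpen.mem_nhds (hmem j))] with l hl hl'
    have h0 : l ≠ 0 := by rintro rfl; simp at hl'
    have hr := inv_mul_cancel₀ (root_ne_zero h0)
    rw [T, invT_eq hl (root_sq l), phi_eq hl (root_sq l), psi_eq hl (root_sq l)]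
    simp only [Matrix.cons_val_zero, Matrix.cons_val_one, one_mul]
    linear_combination ((root l)⁻¹ * root l * (scatA q r l)⁻¹ * redF₂ q r x l) * hexp l -
      ((root l)⁻¹ * root l * Complex.I * (∑ k, D.c j k / (l - D.pole j) ^ ((k : ℕ) + 1)) *
        redG₂ q r x l) * hexp2 l + ((scatA q r l)⁻¹ * redF₂ q r x l - Complex.I *
        Complex.exp (2 * Complex.I * l * x) *
        (∑ k, D.c j k / (l - D.pole j) ^ ((k : ℕ) + 1)) * redG₂ q r x l) * hr
  · rw [(redF_eq_add l x).1, hρ]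
    field_simp [scatA_ofReal_ne_zero hT l]
  · rw [(redF_eq_add l x).2, hρ]
    field_simp [scatA_ofReal_ne_zero hT l]

/-- Exchanging the components and changing the sign of `redFBar₁` and `redG₁` gives this side
exactly the jump and Wronskian relations of the other one. -/
theorem IsBoundStatesBar.isScatteringSide (hT : ∀ l : ℝ, invTBar q r (root l) ≠ 0) {D : BoundStates}
    (hD : IsBoundStatesBar q r D) {ρ : ℝ → ℂ}
    (hρ : ∀ m : ℝ, ρ m = -(Complex.exp (Complex.I * mu q r / 2) *
      jostN (gaugeU₂ q r) (gaugeV₂ q r) m / scatABar q r m)) (x : ℝ) :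
    IsScatteringSide D (-1) ρ x (wronskianFactor q r x) (scatABar q r) (redFBar₂ q r x)
      (fun z => -redFBar₁ q r x z) (redGBar₂ q r x) (redGBar₁ q r x) (redG₂ q r x)
      (fun z => -redG₁ q r x z) := by
  obtain ⟨hinj, hrange, -, hpp⟩ := hD
  have hmem : ∀ j, (D.pole j).im < 0 := fun j => by
    have : D.pole j ∈ range D.pole := ⟨j, rfl⟩
    rw [hrange] at this
    exact this.1
  have hmem' : ∀ j, -1 * D.pole j ∈ upperOpen := fun j => by
    simpa using hmem j
  have hev : ∀ j, ∀ᶠ z in 𝓝[≠] (-1 * D.pole j), z ∈ upperOpen := fun j =>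
    nhdsWithin_le_nhds (isOpen_upperOpen.mem_nhds (hmem' j))
  have hexp : ∀ l : ℂ, Complex.exp (Complex.I * l * x) * Complex.exp (-(Complex.I * l * x)) = 1 :=
    fun l => by rw [← Complex.exp_add, add_neg_cancel, Complex.exp_zero]
  have hexp2 : ∀ l : ℂ, Complex.exp (Complex.I * l * x) * Complex.exp (Complex.I * l * x) =
      Complex.exp (2 * Complex.I * l * x) := fun l => by
    rw [← Complex.exp_add]; congr 1; ring
  have hO : ∀ l : ℂ, (fun w : ℂ => Complex.exp (Complex.I * w * x)) =O[𝓝[≠] l]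
      (fun _ => (1 : ℂ)) := fun l => by
    refine (isBigO_cexp_mul (Complex.I * x) l).congr_left fun w => ?_
    congr 1; ring
  have hpp' := fun j i => (hpp j x i).comp_tendsto
    (tendsto_mul_nhdsNE (ε := -1) (by norm_num) (D.pole j))
  have hroot : ∀ z : ℂ, root (-1 * z) ^ 2 = -z := fun z => by rw [root_sq]; ring
  have ha : HolOff ∅ (scatABar q r) := holOff_jostAlpha _ _
  have e1 : ∀ z : ℂ, Complex.exp (Complex.I * -z * x) = Complex.exp (-(Complex.I * z * x)) :=
    fun z => by congr 1; ring
  have e2 : ∀ z : ℂ, Complex.exp (-(Complex.I * -z * x)) = Complex.exp (Complex.I * z * x) :=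
    fun z => by congr 1; ring
  refine
    { sq := by norm_num
      inj := hinj
      pole_mem := hmem'
      exists_pole := fun z hz h0 => ?_
      hol_a := ha
      hol_f₁ := holOff_redFBar₂ q r x
      hol_f₂ := (holOff_redFBar₁ q r x).neg
      hol_g₁ := holOff_redGBar₂ q r x
      hol_g₂ := holOff_redGBar₁ q r x
      inf_a := ((tendsto_scatABar_atInf q r).inv₀ one_ne_zero).isBigO_one ℂ
      inf_f₁ := (tendsto_redFBar₂_atInf q r x).isBigO_one ℂ
      inf_f₂ := (isBigO_mul_redFBar₁ q r x).neg_left.congr_left fun z => by ring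
      inf_g₁ := (tendsto_redGBar₂_atInf q r x).isBigO_one ℂ
      inf_g₂ := (tendsto_redGBar₁_atInf q r x).isBigO_one ℂ
      near₁ := fun j => ?_
      near₂ := fun j => ?_
      jump₁ := fun m => ?_
      jump₂ := fun m => ?_
      wronskian := fun z hz => ?_ }
  · have hz' : z ∈ upperOpen := by
      rcases (mem_upper.1 hz).lt_or_eq with h | h
      · exact h
      · have : z = (z.re : ℂ) := Complex.ext rfl (by simpa using h.symm)
        rw [this] at h0
        exact absurd h0 (scatABar_ofReal_ne_zero hT _)
    have : -z ∈ range D.pole := by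
      rw [hrange]
      have hneg : AnalyticAt ℂ (fun w : ℂ => -w) (-z) := analyticAt_id.neg
      have hcont : Tendsto (fun w : ℂ => -w) (𝓝 z) (𝓝 (-z)) := continuous_neg.tendsto z
      have hcont' : Tendsto (fun w : ℂ => -w) (𝓝 (-z)) (𝓝 z) := by
        simpa using (continuous_neg (G := ℂ)).tendsto (-z)
      refine ⟨by simpa using hz', meromorphicOrderAt_neg_of_zero
        (b := fun w => scatABar q r (-w)) ?_ (by rwa [neg_neg]) (fun h => ?_) ?_⟩
      · exact AnalyticAt.comp (g := scatABar q r) (by rw [neg_neg]; exact ha.analyticAt hz') hneg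
      · refine not_eventually_zero ha one_ne_zero (tendsto_scatABar_atInf q r) hz' ?_
        have := hcont.eventually h
        simpa only [neg_neg] using this
      · filter_upwards [nhdsWithin_le_nhds
          (hcont'.eventually (isOpen_upperOpen.mem_nhds hz'))] with w hw
        rw [TBar, invTBar_eq (z := -w) (upperOpen_subset hw) (by rw [root_sq, neg_neg])]
    obtain ⟨j, hj⟩ := this
    exact ⟨j, by rw [hj]; ring⟩
  · refine (isBigO_one_mul (hO _) (hpp' j 1)).congr' ?_ (EventuallyEq.refl _ _)
    filter_upwards [hev j] with z hz'
    have hz := upperOpen_subset hz'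
    simp only [Function.comp_apply]
    rw [TBar, invTBar_eq hz (hroot z), phiBar_eq hz (hroot z), psiBar_eq hz (hroot z)]
    simp only [Matrix.cons_val_zero, Matrix.cons_val_one, e1, e2]
    linear_combination ((scatABar q r z)⁻¹ * redFBar₂ q r x z) * hexp z +
      (Complex.I * root (-1 * z) ^ 2 * (∑ k, D.c j k / (-1 * z - D.pole j) ^ ((k : ℕ) + 1)) *
        redGBar₂ q r x z) * hexp2 z + (Complex.I * Complex.exp (2 * Complex.I * z * x) *
        (∑ k, D.c j k / (-1 * z - D.pole j) ^ ((k : ℕ) + 1)) * redGBar₂ q r x z) * hroot z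
  · have hroot' := ((isBigO_root_inv (hmem j).ne).comp_tendsto
      (tendsto_mul_nhdsNE (ε := -1) (by norm_num) (D.pole j)))
    refine (isBigO_one_mul (isBigO_one_mul hroot' (hO _))
      (hpp' j 0)).neg_left.congr' ?_ (EventuallyEq.refl _ _)
    filter_upwards [hev j] with z hz'
    have hz := upperOpen_subset hz'
    have h0 : -1 * z ≠ 0 := by
      rintro h
      have : z = 0 := by linear_combination -h
      rw [this] at hz'
      simp at hz'
    have hr := inv_mul_cancel₀ (root_ne_zero h0)
    simp only [Function.comp_apply]
    rw [TBar, invTBar_eq hz (hroot z), phiBar_eq hz (hroot z), psiBar_eq hz (hroot z)]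
    simp only [Matrix.cons_val_zero, e1, e2]
    linear_combination (-((root (-1 * z))⁻¹ * root (-1 * z) * (scatABar q r z)⁻¹ *
        redFBar₁ q r x z)) * hexp z -
      ((root (-1 * z))⁻¹ * root (-1 * z) * Complex.I *
        (∑ k, D.c j k / (-1 * z - D.pole j) ^ ((k : ℕ) + 1)) * redGBar₁ q r x z) * hexp2 z +
      (-((scatABar q r z)⁻¹ * redFBar₁ q r x z) - Complex.I *
        Complex.exp (2 * Complex.I * z * x) *
        (∑ k, D.c j k / (-1 * z - D.pole j) ^ ((k : ℕ) + 1)) * redGBar₁ q r x z) * hr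
  · rw [(redFBar_eq_add m x).2, hρ]
    field_simp [scatABar_ofReal_ne_zero hT m]
    ring
  · rw [(redFBar_eq_add m x).1, hρ]
    field_simp [scatABar_ofReal_ne_zero hT m]
    ring
  · linear_combination wronskian_redFBar_redGBar hz x

end

section

/-! The solution of the Marchenko system. -/

theorem measurePreserving_add_left_Ioi (x : ℝ) :
    MeasurePreserving (fun w : ℝ => x + w) (volume.restrict (Ioi 0)) (volume.restrict (Ioi x)) := by
  have h := (measurePreserving_add_left volume x).restrict_preimage (s := Ioi x) measurableSet_Ioi
  simpa using h

theorem setIntegral_Ioi_shift (f : ℝ → ℂ) (x : ℝ) :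
    ∫ z in Ioi x, f z = ∫ z in Ioi (0 : ℝ), f (x + z) :=
  ((measurePreserving_add_left_Ioi x).integral_comp (measurableEmbedding_addLeft x) f).symm

theorem memLp_shift {f : ℝ → ℂ} {x : ℝ} (hf : MemLp f 2 (volume.restrict (Ioi x))) :
    MemLp (fun w => f (x + w)) 2 (volume.restrict (Ioi 0)) :=
  hf.comp_measurePreserving (measurePreserving_add_left_Ioi x)

/-- One row of the Marchenko system, for either row. The side `h` supplies the kernel of the
equation for `kb` and `h'` that of the equation for `k`; the Jost functions of `h'` are those of `h`
in interchanged roles. The row transforms are identified by the Riemann–Hilbert argument and the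
initial value theorem finishes. -/
theorem tendsto_of_scatteringSides {D D' : BoundStates} {ε : ℂ} {ρ ρ' : 𝓢(ℝ, ℂ)} {x : ℝ} {p c : ℂ}
    {a f₁ f₂ g₁ g₂ G₁ G₂ a' f₁' f₂' : ℂ → ℂ} {ω ω' : ℝ → ℂ}
    (h : IsScatteringSide D ε ρ x p a f₁ f₂ g₁ g₂ G₁ G₂)
    (h' : IsScatteringSide D' (-ε) ρ' x p a' f₁' f₂' (fun z => ε * G₂ z) G₁ g₂
      (fun z => -ε * g₁ z))
    (hb : ∀ j, (ε * Complex.I * D.pole j).re < 0) (hb' : ∀ j, (-ε * Complex.I * D'.pole j).re < 0)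
    (hω : ∀ y : ℝ, ω y = ε * (1 / (2 * Real.pi) * ∫ l : ℝ, ρ l * Complex.exp (Complex.I * l * y)) +
      D.kernel (ε * Complex.I * y))
    (hω' : ∀ y : ℝ, ω' y = -ε * (1 / (2 * Real.pi) *
      ∫ l : ℝ, ρ' l * Complex.exp (Complex.I * l * y)) + D'.kernel (-ε * Complex.I * y))
    (hp : p ≠ 0) (ig₁ : Tendsto g₁ atInf (𝓝 0)) (ig₂ : Tendsto g₂ atInf (𝓝 c))
    (iG₂ : (fun z => z * G₂ z) =O[atInf] (fun _ => (1 : ℂ)))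
    {k kb : ℝ → ℂ} (hk : MemLp k 2 (volume.restrict (Ioi x)))
    (hkb : MemLp kb 2 (volume.restrict (Ioi x)))
    (ekb : ∀ y, x < y → kb y = ε * Complex.I * ∫ z in Ioi x, k z * deriv ω (z + y))
    (ek : ∀ y, x < y → k y = -ω' (x + y) - ∫ z in Ioi x, kb z * ω' (z + y))
    {L Lb : ℂ} (hL : Tendsto (fun t : ℝ => t * g₁ (Complex.I * t)) atTop (𝓝 L))
    (hLb : Tendsto (fun t : ℝ => t * (c * G₁ (Complex.I * t) - p)) atTop (𝓝 Lb)) :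
    Tendsto k (𝓝[>] x) (𝓝 (c * L / p)) ∧ Tendsto kb (𝓝[>] x) (𝓝 (Lb / p)) := by
  obtain ⟨κ₁, _, iκ₁, -, cκ₁, -, ⟨C₁, C₁0, bκ₁⟩, -, vκ₁, -, fκ₁, -⟩ :=
    exists_marchenko_kernels D h.sq hb ρ hω x
  obtain ⟨_, κ₂, -, iκ₂, -, cκ₂, -, ⟨C₂, C₂0, bκ₂⟩, -, vκ₂, -, fκ₂⟩ :=
    exists_marchenko_kernels D' h'.sq hb' ρ' hω' x
  obtain ⟨S, X₁, X₂, _, _, ⟨Sf, Su⟩, ⟨oX₁, oX₂, -, -⟩, ⟨nX₁, nX₂, -, -⟩, sX, wX, jX⟩ :=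
    h.exists_functions (ε * Complex.I * D.kernel (ε * Complex.I * (2 * x)))
  obtain ⟨S', _, _, Z₁, Z₂, ⟨Sf', Su'⟩, ⟨-, -, oZ₁, oZ₂⟩, ⟨-, -, nZ₁, nZ₂⟩, sZ, wZ, jZ⟩ :=
    h'.exists_functions (-ε * Complex.I * D'.kernel (-ε * Complex.I * (2 * x)))
  have hε := h.sq
  set m : ℝ → ℂ := fun w => k (x + w) with hm
  set mb : ℝ → ℂ := fun w => kb (x + w) with hmb
  have mL := memLp_shift hk
  have mbL := memLp_shift hkb
  have emb : ∀ y, 0 < y → mb y = -∫ z in Ioi (0 : ℝ), m z * κ₁ (z + y) := by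
    intro y hy
    change kb (x + y) = _
    rw [ekb (x + y) (by linarith), setIntegral_Ioi_shift, ← integral_const_mul, ← integral_neg]
    refine setIntegral_congr_fun measurableSet_Ioi fun z hz => ?_
    have hz' : 0 < z := hz
    simp only [hm]
    rw [vκ₁ (z + y) (by positivity), show x + z + (x + y) = 2 * x + (z + y) by ring]
    ring
  have em : ∀ y, 0 < y → m y = -κ₂ y - ∫ z in Ioi (0 : ℝ), mb z * κ₂ (z + y) := by
    intro y hy
    change k (x + y) = _
    rw [ek (x + y) (by linarith), setIntegral_Ioi_shift, vκ₂ y hy.le,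
      show x + (x + y) = 2 * x + y by ring]
    congr 1
    refine setIntegral_congr_fun measurableSet_Ioi fun z hz => ?_
    have hz' : 0 < z := hz
    simp only [hmb]
    rw [vκ₂ (z + y) (by positivity), show x + z + (x + y) = 2 * x + (z + y) by ring]
  obtain ⟨imb, tmb, bmb⟩ := integrableOn_and_tendsto_of_decay
    (f := fun y => -∫ z in Ioi (0 : ℝ), m z * κ₁ (z + y)) (continuousOn_conv cκ₁ bκ₁ C₁0 mL).neg
    (C := C₁ * ∫ z in Ioi (0 : ℝ), ‖m z‖ * (1 + z ^ 2)⁻¹ ^ (1 / 2 : ℝ))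
    (fun y hy => by
      rw [norm_neg]
      exact (norm_conv_le bκ₁ C₁0 mL hy).trans_eq (by ring)) emb
  obtain ⟨im, tm, bm⟩ := integrableOn_and_tendsto_of_decay
    (f := fun y => -κ₂ y - ∫ z in Ioi (0 : ℝ), mb z * κ₂ (z + y))
    (cκ₂.neg.sub (continuousOn_conv cκ₂ bκ₂ C₂0 mbL))
    (C := C₂ + C₂ * ∫ z in Ioi (0 : ℝ), ‖mb z‖ * (1 + z ^ 2)⁻¹ ^ (1 / 2 : ℝ))
    (fun y hy => by
      rw [add_mul]
      refine norm_sub_le_of_le ?_ ((norm_conv_le bκ₂ C₂0 mbL hy).trans_eq (by ring))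
      rw [norm_neg]
      refine (bκ₂ y hy).trans ?_
      gcongr
      nlinarith [pow_nonneg hy 3, pow_nonneg hy 2]) em
  have oG₂ : HolOff ∅ G₂ := by
    have : G₂ = fun z => ε * (ε * G₂ z) := by
      funext z
      linear_combination (-G₂ z) * hε
    rw [this]
    exact (HolOff.const ε).mul h'.hol_g₁
  -- The factor `-ε` undoes the one in the last Jost function of `h'`.
  obtain ⟨c₁, c₂⟩ := laplace_eq_of_riemannHilbert (Y₁ := fun z => -ε * Z₁ z) (c := c) (p := p)
    Sf Sf' Su Su' h.hol_g₁ h.hol_g₂ h'.hol_g₂ oG₂ oX₁ oX₂ ((HolOff.const (-ε)).mul oZ₁) oZ₂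
    ig₁ ig₂ h'.inf_g₂ iG₂ nX₁ nX₂ (nZ₁.const_mul_left _) nZ₂ (fun s hs => (sX s hs).1)
    (fun s hs => (sX s hs).2.1) (fun s hs => (sZ s hs).2.2.1.const_mul_left _)
    (fun s hs => (sZ s hs).2.2.2) (fun z hz => (wX z hz).1)
    (fun z hz => by
      linear_combination (wZ z hz).2) (fun l => (jX l _ _ (fκ₁ l) rfl).1)
    (fun l => (jX l _ _ (fκ₁ l) rfl).2.1)
    (fun l => by
      have := (jZ (-l) _ _ rfl (fκ₂ (-l))).2.2.1
      push_cast at this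
      rw [neg_neg] at this
      rw [this]
      linear_combination (g₁ l + ft κ₂ (-l) * G₁ (-l)) * hε)
    (fun l => by
      have := (jZ (-l) _ _ rfl (fκ₂ (-l))).2.2.2
      push_cast at this
      rw [neg_neg] at this
      rw [this]
      linear_combination (l * ft κ₂ (-l) * G₂ (-l)) * hε)
    iκ₁ iκ₂ im imb emb em
  have hev : ∀ (S : Set ℂ), S.Finite → ∀ᶠ t : ℝ in atTop, Complex.I * t ∈ upper \ S := by
    intro S hS
    have h1 : ∀ᶠ z in atInf, z ∉ S := by
      have : ∀ᶠ z in Bornology.cobounded ℂ, z ∉ S := Bornology.isBounded_def.1 hS.isBounded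
      exact this.filter_mono inf_le_left
    filter_upwards [tendsto_I_mul_atInf.eventually h1, eventually_ge_atTop 0] with t ht ht0
    exact ⟨I_mul_mem_upper ht0, ht⟩
  have hshift : Tendsto (fun y => y - x) (𝓝[>] x) (𝓝[>] 0) := by
    refine tendsto_nhdsWithin_iff.2 ⟨?_, ?_⟩
    · have hc : Continuous fun y : ℝ => y - x := by fun_prop
      have := hc.tendsto x
      rw [sub_self] at this
      exact this.mono_left nhdsWithin_le_nhds
    · filter_upwards [self_mem_nhdsWithin] with y hy
      exact mem_Ioi.2 (sub_pos.2 (mem_Ioi.1 hy))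
  constructor
  · have t1 := tendsto_mul_laplace im bm tm
    have t2 : Tendsto (fun t : ℝ => (t : ℂ) * laplace m (Complex.I * t)) atTop (𝓝 (c * L / p)) := by
      refine ((hL.const_mul c).div_const p).congr' ?_
      filter_upwards [hev S Sf] with t ht
      rw [div_eq_iff hp]
      linear_combination (-(t : ℂ)) * c₁ _ ht
    rw [tendsto_nhds_unique t1 t2] at tm
    refine (tm.comp hshift).congr fun y => ?_
    simp [hm]
  · have t1 := tendsto_mul_laplace imb bmb tmb
    have t2 : Tendsto (fun t : ℝ => (t : ℂ) * laplace mb (Complex.I * t)) atTop (𝓝 (Lb / p)) := by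
      refine (hLb.div_const p).congr' ?_
      filter_upwards [hev S' Sf'] with t ht
      rw [div_eq_iff hp]
      linear_combination (-(t : ℂ)) * c₂ _ ht
    rw [tendsto_nhds_unique t1 t2] at tmb
    refine (tmb.comp hshift).congr fun y => ?_
    simp [hmb]

end

section

variable {q r : 𝓢(ℝ, ℂ)} {x : ℝ}

/-! Leading behaviour of the Jost solutions along the imaginary axis. -/

theorem tendsto_mul_jostB_reflNeg (u v : 𝓢(ℝ, ℂ)) (x : ℝ) :
    Tendsto (fun t : ℝ => t * jostB (reflNeg u) (reflNeg v) (Complex.I * t) (-x)) atTop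
      (𝓝 (-(v x / 2))) := by
  -- On the imaginary axis `2i · (it) = -2t`, whence the factor `-1 / 2`.
  have h := (tendsto_mul_jostB (reflNeg u) (reflNeg v) (-x)).const_mul (-1 / 2)
  refine (tendsto_of_eq h ?_).congr fun t => ?_
  · rw [reflNeg_apply, neg_neg, neg_neg]; ring
  · linear_combination
      (-(t * jostB (reflNeg u) (reflNeg v) (Complex.I * t) (-x))) * Complex.I_sq

theorem tendsto_mul_jostA_reflNeg_sub_one (u v : 𝓢(ℝ, ℂ)) (x : ℝ) :
    Tendsto (fun t : ℝ => t * (jostA (reflNeg u) (reflNeg v) (Complex.I * t) (-x) - 1)) atTop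
      (𝓝 ((∫ s in Ioi x, u s * v s) / 2)) := by
  have h := (tendsto_mul_jostA_sub_one (reflNeg u) (reflNeg v) (-x)).const_mul (-1 / 2)
  refine (tendsto_of_eq h ?_).congr fun t => ?_
  · have e : ∫ s in Iic (-x), reflNeg u s * reflNeg v s = ∫ s in Ioi x, u s * v s := by
      rw [← neg_neg x, ← integral_comp_neg_Iic, neg_neg]
      refine integral_congr_ae (ae_of_all _ fun s => ?_)
      simp only [reflNeg_apply]
      ring
    rw [e]; ring
  · linear_combination
      (-(t * (jostA (reflNeg u) (reflNeg v) (Complex.I * t) (-x) - 1))) * Complex.I_sq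

theorem tendsto_mul_redG₁ :
    Tendsto (fun t : ℝ => t * redG₁ q r x (Complex.I * t)) atTop (𝓝 (-(q x / 2))) := by
  have h := (tendsto_mul_jostB_reflNeg (gaugeU₂ q r) (gaugeV₂ q r) x).const_mul (E q r x)
  refine (tendsto_of_eq h ?_).congr fun t => ?_
  · rw [gaugeV₂_apply]
    have := E_ne_zero q r x
    field_simp
  · rw [redG₁]; ring

theorem tendsto_mul_redGBar₂ :
    Tendsto (fun t : ℝ => t * redGBar₂ q r x (Complex.I * t)) atTop
      (𝓝 (-(Complex.exp (-(Complex.I * mu q r / 2)) / 2) * r x * E q r x)) := by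
  have h := (tendsto_mul_jostB_reflNeg (gaugeU₁ q r) (gaugeV₁ q r) x).const_mul
    (Complex.exp (-(Complex.I * mu q r / 2)))
  refine (tendsto_of_eq h ?_).congr fun t => ?_
  · rw [gaugeV₁_apply]; ring
  · rw [redGBar₂]; ring

theorem integral_deriv_mul (q r : 𝓢(ℝ, ℂ)) (x : ℝ) :
    ∫ y in Ioi x, deriv q y * r y = -(q x * r x) - ∫ y in Ioi x, q y * deriv r y := by
  have i1 := integrable_mul_schwartz r (SchwartzMap.derivCLM ℝ ℂ q)
  have i2 := integrable_mul_schwartz (SchwartzMap.derivCLM ℝ ℂ r) q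
  simp only [SchwartzMap.derivCLM_apply] at i1 i2
  have hd : ∀ y, HasDerivAt (fun y => q y * r y) (deriv q y * r y + q y * deriv r y) y := fun y =>
    q.differentiableAt.hasDerivAt.fun_mul r.differentiableAt.hasDerivAt
  have h := integral_Ioi_of_hasDerivAt_of_tendsto (f := fun y => q y * r y) (a := x) (m := 0)
    (hd x).continuousAt.continuousWithinAt (fun y _ => hd y) (i1.add i2).integrableOn
    (tendsto_of_eq ((tendsto_schwartz_atTop q).mul (tendsto_schwartz_atTop r)) (mul_zero 0))
  rw [integral_add i1.integrableOn i2.integrableOn] at h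
  linear_combination h

/-- The `A` part contributes `(i/4) ∫ q' r`; after integration by parts its boundary term is
cancelled by the `B` part of the gauge transformation, so only the integral of `q r'` remains. -/
theorem tendsto_mul_redGBar₁_sub :
    Tendsto (fun t : ℝ => t * (redGBar₁ q r x (Complex.I * t) - wronskianFactor q r x)) atTop
      (𝓝 (wronskianFactor q r x * (-(Complex.I / 4) * ∫ y in Ioi x, q y * deriv r y))) := by
  have h := (((tendsto_mul_jostA_reflNeg_sub_one (gaugeU₁ q r) (gaugeV₁ q r) x).const_mul
    (E q r x)).sub ((tendsto_mul_jostB_reflNeg (gaugeU₁ q r) (gaugeV₁ q r) x).const_mul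
      (Complex.I / 2 * q x))).const_mul (Complex.exp (-(Complex.I * mu q r / 2)))
  refine (tendsto_of_eq h ?_).congr fun t => ?_
  · have e : ∫ s in Ioi x, gaugeU₁ q r s * gaugeV₁ q r s =
        Complex.I / 2 * ∫ s in Ioi x, deriv q s * r s := by
      rw [← integral_const_mul]
      refine integral_congr_ae (ae_of_all _ fun s => ?_)
      simp only [gaugeU₁_apply, gaugeV₁_apply]
      have := E_ne_zero q r s
      field_simp
    rw [e, integral_deriv_mul, gaugeV₁_apply, wronskianFactor]
    ring
  · rw [redGBar₁, wronskianFactor]; ring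

/-- Here the `A` part is already an integral of `q r'`, and the `B` part of the gauge transformation
leaves the local term in `qr`. -/
theorem tendsto_mul_redG₂_sub :
    Tendsto (fun t : ℝ => t * (redG₂ q r x (Complex.I * t) - 1)) atTop
      (𝓝 (-(Complex.I * q x * r x / 4) - Complex.I / 4 * ∫ y in Ioi x, q y * deriv r y)) := by
  have h := (tendsto_mul_jostA_reflNeg_sub_one (gaugeU₂ q r) (gaugeV₂ q r) x).add
    ((tendsto_mul_jostB_reflNeg (gaugeU₂ q r) (gaugeV₂ q r) x).const_mul
      (Complex.I / 2 * r x * E q r x))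
  refine (tendsto_of_eq h ?_).congr fun t => ?_
  · have e : ∫ s in Ioi x, gaugeU₂ q r s * gaugeV₂ q r s =
        -(Complex.I / 2) * ∫ s in Ioi x, q s * deriv r s := by
      rw [← integral_const_mul]
      refine integral_congr_ae (ae_of_all _ fun s => ?_)
      simp only [gaugeU₂_apply, gaugeV₂_apply]
      have := E_ne_zero q r s
      field_simp
    have := E_ne_zero q r x
    rw [e, gaugeV₂_apply]
    field_simp
    ring
  · rw [redG₂]; ring

end

end CLL

end

/-! ### The diagonal limits of the Marchenko solution -/

open CLL

theorem theorem4p3 (q r : 𝓢(ℝ, ℂ))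
    (hT : ∀ l : ℝ, CLL.invT q r (CLL.root l) ≠ 0)
    (hTBar : ∀ l : ℝ, CLL.invTBar q r (CLL.root l) ≠ 0)
    (D DBar : CLL.BoundStates)
    (hD : CLL.IsBoundStates q r D) (hDBar : CLL.IsBoundStatesBar q r DBar)
    (K : ℝ → ℝ → Matrix (Fin 2) (Fin 2) ℂ)
    (hK : CLL.IsMarchenkoSolution (CLL.Omega q r D) (CLL.OmegaBar q r DBar) K)
    (x : ℝ) :
    Tendsto (fun y => K x y 0 1) (𝓝[>] x)
      (𝓝 (-(Complex.exp (Complex.I * CLL.mu q r / 2) / 2) * (q x / CLL.E q r x))) ∧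
    Tendsto (fun y => K x y 1 1) (𝓝[>] x)
      (𝓝 (-(Complex.I * q x * r x / 4) - Complex.I / 4 * ∫ y in Ioi x, q y * deriv r y)) ∧
    Tendsto (fun y => K x y 0 0) (𝓝[>] x)
      (𝓝 (-(Complex.I / 4) * ∫ y in Ioi x, q y * deriv r y)) ∧
    Tendsto (fun y => K x y 1 0) (𝓝[>] x)
      (𝓝 (-(Complex.exp (-(Complex.I * CLL.mu q r) / 2) / 2) * r x * CLL.E q r x)) := by
  obtain ⟨ρ, hρ, hR⟩ := exists_schwartz_reflection hT
  obtain ⟨ρb, hρb, hRb⟩ := exists_schwartz_reflectionBar hTBar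
  have h := hD.isScatteringSide hT hρ x
  have hb := hDBar.isScatteringSide hTBar hρb x
  have hp : wronskianFactor q r x ≠ 0 := wronskianFactor_ne_zero
  have hω : ∀ y : ℝ, Omega q r D y = 1 * (1 / (2 * Real.pi) *
      ∫ l : ℝ, ρ l * Complex.exp (Complex.I * l * y)) + D.kernel (1 * Complex.I * y) := fun y => by
    rw [Omega, hR, one_mul, one_mul]
  have hωb : ∀ y : ℝ, OmegaBar q r DBar y = -1 * (1 / (2 * Real.pi) *
      ∫ l : ℝ, ρb l * Complex.exp (Complex.I * l * y)) + DBar.kernel (-1 * Complex.I * y) :=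
    fun y => by rw [OmegaBar, hRb, neg_one_mul Complex.I]
  have hpole : ∀ j, (1 * Complex.I * D.pole j).re < 0 := fun j => by
    have := h.pole_mem j
    simpa using this
  have hpoleb : ∀ j, (-1 * Complex.I * DBar.pole j).re < 0 := fun j => by
    have := hb.pole_mem j
    simpa using this
  obtain ⟨hmem, hM⟩ := hK x
  have hM' : ∀ y, x < y →
      K x y 0 0 = 1 * Complex.I * (∫ z in Ioi x, K x z 0 1 * deriv (Omega q r D) (z + y)) ∧
      K x y 0 1 = -OmegaBar q r DBar (x + y) -
        (∫ z in Ioi x, K x z 0 0 * OmegaBar q r DBar (z + y)) ∧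
      K x y 1 0 = -Omega q r D (x + y) - (∫ z in Ioi x, K x z 1 1 * Omega q r D (z + y)) ∧
      K x y 1 1 = -1 * Complex.I *
        (∫ z in Ioi x, K x z 1 0 * deriv (OmegaBar q r DBar) (z + y)) := by
    intro y hy
    have hM := hM y hy
    have h00 := congrFun (congrFun hM 0) 0
    have h01 := congrFun (congrFun hM 0) 1
    have h10 := congrFun (congrFun hM 1) 0
    have h11 := congrFun (congrFun hM 1) 1
    simp only [Matrix.zero_apply, Matrix.add_apply, Matrix.of_apply, Matrix.cons_val',
      Matrix.cons_val_zero, Matrix.cons_val_one, Matrix.cons_val_fin_one, mul_assoc,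
      integral_const_mul] at h00 h01 h10 h11
    refine ⟨?_, ?_, ?_, ?_⟩
    · linear_combination -h00
    · linear_combination -h01
    · linear_combination -h10
    · linear_combination -h11
  -- First row: ψ gives `k` and ψ̄ gives `kb`. Since `redG₂ → 1` at infinity, `c = 1`, and the
  -- division by the Wronskian factor `p` puts `e^{iμ/2} / E` into the limit of `K x y 0 1`.
  have row₁ := tendsto_of_scatteringSides (c := 1) h (by simpa using hb) hpole hpoleb hω hωb hp
    (tendsto_redG₁_atInf q r x) (tendsto_redG₂_atInf q r x) (isBigO_mul_redGBar₂ q r x)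
    (hmem 0 1) (hmem 0 0) (fun y hy => (hM' y hy).1) (fun y hy => (hM' y hy).2.1)
    tendsto_mul_redG₁ (by simpa only [one_mul] using tendsto_mul_redGBar₁_sub)
  -- Second row, with the sides interchanged: `redGBar₁` tends to the Wronskian factor, so `c = p`
  -- and the two cancel.
  have row₂ := tendsto_of_scatteringSides (c := wronskianFactor q r x) hb (by simpa using h)
    hpoleb (by simpa using hpole) hωb (by simpa using hω) hp
    (tendsto_redGBar₂_atInf q r x) (tendsto_redGBar₁_atInf q r x)
    ((isBigO_mul_redG₁ q r x).neg_left.congr_left fun z => by ring)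
    (hmem 1 0) (hmem 1 1) (fun y hy => (hM' y hy).2.2.2) (fun y hy => (hM' y hy).2.2.1)
    tendsto_mul_redGBar₂ ((tendsto_mul_redG₂_sub.const_mul (wronskianFactor q r x)).congr
      fun t => by ring)
  refine ⟨tendsto_of_eq row₁.1 ?_, tendsto_of_eq row₂.2 ?_, tendsto_of_eq row₁.2 ?_,
    tendsto_of_eq row₂.1 ?_⟩
  · rw [one_mul, wronskianFactor, Complex.exp_neg]
    have := E_ne_zero q r x
    have := Complex.exp_ne_zero (Complex.I * mu q r / 2)
    field_simp
  · field_simp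
  · field_simp
  · rw [mul_div_cancel_left₀ _ hp, neg_div]
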